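/- We work over $\mathbb{C}$. Put $\xi_k=e^{2\pi i/k}$, write $C_n$ for the cyclic group of order $n$, $\mathrm{Diag}(\dots)$ for a diagonal matrix, and $\pi:\mathrm{GL}(5,\mathbb{C})\to\mathrm{PGL}(5,\mathbb{C})=\mathrm{Aut}(\mathbb{P}^4)$ for the natural projection. Let $X=\{F=0\}\subset\mathbb{P}^4$ be a smooth cubic threefold, where $F\in\mathbb{C}[x_1,\dots,x_5]$ is an irreducible homogeneous polynomial of degree $3$, and let $\mathrm{Aut}(X)=\{f\in\mathrm{PGL}(5,\mathbb{C}) : f(X)=X\}$. For $A=(a_{ij})\in\mathrm{GL}(5,\mathbb{C})$ let $A(F)=F(\sum_i a_{1i}x_i,\dots,\sum_i a_{5i}x_i)$. An $F$-lifting of a subgroup $G<\mathrm{PGL}(5,\mathbb{C})$ is a subgroup $\widetilde G<\mathrm{GL}(5,\mathbb{C})$ which $\pi$ maps isomorphically onto $G$ and such that $A(F)=F$ for all $A\in\widetilde G$. Define the cubic threefolds - $X_1$: $x_1^3+x_2^3+x_3^3+x_4^3+x_5^3=0$; - $X_2$: $x_1^3+x_2^3+x_3^3+3(\sqrt3-1)x_1x_2x_3+x_4^3+x_5^3=0$;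 - $X_3$: $x_1^2x_2+x_2^2x_3+x_3^2x_4+x_4^3+x_5^3=0$; - $X_4$: $x_1^2x_2+x_2^2x_3+x_3^2x_4+x_4^2x_5+x_5^3=0$; - $X_5$: $x_1^2x_2+x_2^2x_3+x_3^2x_4+x_4^2x_5+x_5^2x_1=0$; - $X_6$: $x_1^3+x_2^3+x_3^3+x_4^3+x_5^3+x_6^3=x_1+x_2+x_3+x_4+x_5=0$ in $\mathbb{P}^5$. **Theorem.** Let $G\subset\mathrm{Aut}(X)$ be a nontrivial abelian subgroup. (1) $G$ is isomorphic to one of the following 25 groups: $C_2$, $C_3$, $C_4$, $C_2^2$, $C_5$, $C_6$, $C_8$, $C_4\times C_2$, $C_9$, $C_3^2$, $C_{11}$, $C_{12}$, $C_6\times C_2$, $C_{15}$, $C_{16}$, $C_{18}$, $C_6\times C_3$, $C_{24}$, $C_{12}\times C_2$, $C_9\times C_3$, $C_3^3$, $C_{12}\times C_3$, $C_6^2$, $C_6\times C_3^2$, $C_3^4$. (2) There is a row of the table below, and values of its parameters, such that $G$ is isomorphic to the group $H$ of that row and, for some $P\in\mathrm{GL}(5,\mathbb{C})$, the group $P\widetilde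 HP^{-1}$ is an $F$-lifting of $G$, where $\widetilde H$ is generated by the listed matrices. (3) Whenever, for some $P\in\mathrm{GL}(5,\mathbb{C})$, $P\widetilde HP^{-1}$ is an $F$-lifting of $G$ for a group $\widetilde H$ of the table whose row states $X\cong X_i$ (for its parameter values), then $X$ is isomorphic to $X_i$, by a projective linear map (for $X_6$: by a linear embedding $\mathbb{P}^4\to\mathbb{P}^5$). Table (row. $H$: generators of $\widetilde H$; parameters; isomorphism type of $X$, if stated). All parameters are integers. 1. $C_2$: $\mathrm{Diag}(-1,(-1)^a,1,1,1)$; $a=0,1$. 2. $C_3$: $\mathrm{Diag}(1,1,1,\xi_3,\xi_3^a)$; $a=0,1,2$. 3. $C_3$: $\mathrm{Diag}(1,1,\xi_3,\xi_3,\xi_3^2)$. 4. $C_4$: $\mathrm{Diag}(\xi_4,-1,1,\xi_4^a,1)$; $a=0,2,3$. 5. $C_2^2$: $\mathrm{Diag}(-1,(-1)^a,1,1,1)$, $\mathrm{Diag}(1,(-1)^a,-1,1,1)$; $a=0,1$. 6. $C_5$: $\mathrm{Diag}(\xi_5,\xi_5^3,\xi_5^4,\xi_5^2,1)$. 7. $C_2\times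 C_3$: $\mathrm{Diag}(-1,1,-1,1,1)$, $\mathrm{Diag}(1,1,1,\xi_3,1)$. 8. $C_2\times C_3$: $\mathrm{Diag}(-1,1,-1,1,1)$, $\mathrm{Diag}(1,1,\xi_3,\xi_3,\xi_3^a)$; $a=0,1,2$. 9. $C_2\times C_3$: $\mathrm{Diag}(-1,1,1,1,1)$, $\mathrm{Diag}(1,1,\xi_3,\xi_3^a,\xi_3^b)$; $0\le a\le b\le2$. 10. $C_8$: $\mathrm{Diag}(\xi_8,\xi_8^6,-1,1,\xi_8^a)$; $a=0,2$. 11. $C_4\times C_2$: $\mathrm{Diag}(\xi_4,-1,1,1,1)$, $\mathrm{Diag}(1,1,1,-1,1)$. 12. $C_9$: $\mathrm{Diag}(\xi_9,\xi_9^7,\xi_9^4,\xi_3^a,\xi_3^b)$; $0\le a\le b\le2$; $X\cong X_1$. 13. $C_3^2$: $\mathrm{Diag}(1,\xi_3,1,\xi_3^a,\xi_3^b)$, $\mathrm{Diag}(1,1,\xi_3,\xi_3^c,\xi_3^d)$; $0\le a\le b\le2$, $0\le c\le d\le2$. 14. $C_{11}$: $\mathrm{Diag}(\xi_{11},\xi_{11}^9,\xi_{11}^4,\xi_{11}^3,\xi_{11}^5)$;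 $X\cong X_5$. 15. $C_4\times C_3$: $\mathrm{Diag}(\xi_4,-1,1,1,1)$, $\mathrm{Diag}(1,1,1,\xi_3,\xi_3^a)$; $a=0,1,2$. 16. $C_4\times C_3$: $\mathrm{Diag}(\xi_4,-1,1,1,-1)$, $\mathrm{Diag}(1,1,1,\xi_3,\xi_3)$. 17. $C_4\times C_3$: $\mathrm{Diag}(\xi_4,-1,1,1,\xi_4^3)$, $\mathrm{Diag}(1,1,1,\xi_3,1)$. 18. $C_2^2\times C_3$: $\mathrm{Diag}(-1,1,1,1,1)$, $\mathrm{Diag}(1,1,-1,1,1)$, $\mathrm{Diag}(1,1,\xi_3,\xi_3,\xi_3^a)$; $a=0,1,2$. 19. $C_2^2\times C_3$: $\mathrm{Diag}(-1,1,1,1,(-1)^a)$, $\mathrm{Diag}(1,1,-1,1,(-1)^a)$, $\mathrm{Diag}(1,1,1,\xi_3,1)$; $a=0,1$. 20. $C_5\times C_3$: $\mathrm{Diag}(\xi_5,\xi_5^3,\xi_5^4,\xi_5^2,1)$, $\mathrm{Diag}(1,1,1,1,\xi_3)$; $X\cong X_6$. 21. $C_{16}$: $\mathrm{Diag}(\xi_{16},\xi_{16}^{-2},\xi_{16}^4,-1,1)$;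 $X\cong X_4$. 22. $C_9\times C_2$: $\mathrm{Diag}(\xi_9,\xi_9^7,\xi_9^4,\xi_3^a,\xi_3^a)$, $\mathrm{Diag}(1,1,1,-1,1)$; $a=0,1,2$; $X\cong X_1$. 23. $C_2\times C_3^2$: $\mathrm{Diag}(-1,1,1,1,1)$, $\mathrm{Diag}(1,1,\xi_3,1,1)$, $\mathrm{Diag}(1,1,1,\xi_3,\xi_3^a)$; $a=0,1,2$; $X\cong X_1$ if $a=1$. 24. $C_2\times C_3^2$: $\mathrm{Diag}(-1,1,1,1,1)$, $\mathrm{Diag}(1,1,\xi_3,1,\xi_3^a)$, $\mathrm{Diag}(1,1,1,\xi_3,\xi_3^a)$; $a=1,2$; $X\cong X_1$ if $a=1$. 25. $C_2\times C_3^2$: $\mathrm{Diag}(-1,1,1,1,-1)$, $\mathrm{Diag}(1,1,\xi_3,1,1)$, $\mathrm{Diag}(1,1,1,\xi_3,\xi_3)$; $X\cong X_1$. 26. $C_8\times C_3$: $\mathrm{Diag}(\xi_8,\xi_8^6,-1,1,1)$, $\mathrm{Diag}(1,1,1,1,\xi_3)$; $X\cong X_3$. 27. $C_4\times C_2\times C_3$: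 $\mathrm{Diag}(\xi_4,-1,1,1,1)$, $\mathrm{Diag}(1,1,1,-1,1)$, $\mathrm{Diag}(1,1,1,\xi_3,\xi_3)$; $X\cong X_2$. 28. $C_9\times C_3$: $\mathrm{Diag}(\xi_9,\xi_9^7,\xi_9^4,1,\xi_3^a)$, $\mathrm{Diag}(1,1,1,\xi_3,\xi_3^b)$; $0\le a\le2$, $b=0,2$; $X\cong X_1$. 29. $C_3^3$: $\mathrm{Diag}(1,\xi_3,1,1,\xi_3^a)$, $\mathrm{Diag}(1,1,\xi_3,1,\xi_3^b)$, $\mathrm{Diag}(1,1,1,\xi_3,\xi_3^c)$; $0\le a\le b\le c\le2$. 30. $C_4\times C_3^2$: $\mathrm{Diag}(\xi_4,-1,1,1,1)$, $\mathrm{Diag}(1,1,1,\xi_3,1)$, $\mathrm{Diag}(1,1,1,1,\xi_3)$; $X\cong X_2$. 31. $C_2^2\times C_3^2$: $\mathrm{Diag}(-1,1,1,1,1)$, $\mathrm{Diag}(1,-1,1,1,1)$, $\mathrm{Diag}(1,\xi_3,1,\xi_3,1)$, $\mathrm{Diag}(1,1,1,1,\xi_3)$; $X\cong X_1$. 32.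 $C_2\times C_3^3$: $\mathrm{Diag}(-1,1,1,1,1)$, $\mathrm{Diag}(1,1,\xi_3,1,1)$, $\mathrm{Diag}(1,1,1,\xi_3,1)$, $\mathrm{Diag}(1,1,1,1,\xi_3)$; $X\cong X_1$. 33. $C_3^4$: $\mathrm{Diag}(1,\xi_3,1,1,1)$, $\mathrm{Diag}(1,1,\xi_3,1,1)$, $\mathrm{Diag}(1,1,1,\xi_3,1)$, $\mathrm{Diag}(1,1,1,1,\xi_3)$; $X\cong X_1$. In particular, if $G$ is isomorphic to $C_9$, $C_{16}$, $C_{11}$ or $C_3^4$, then $X$ is isomorphic to $X_1$, $X_4$, $X_5$ or $X_1$ respectively. -/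

import Mathlib

open scoped LinearAlgebra.Projectivization MatrixGroups Pointwise

noncomputable section

namespace CubicThreefold

open MvPolynomial

/-- The locus in `ℙⁿ⁻¹` of the lines through the origin of `ℂⁿ` on which all polynomials of `S`
vanish. -/
def projZeros {n : ℕ} (S : Set (MvPolynomial (Fin n) ℂ)) : Set (ℙ ℂ (Fin n → ℂ)) :=
  {p | ∀ f ∈ S, ∀ v ∈ p.submodule, eval v f = 0}

/-- The hypersurface `{F = 0}` in `ℙ⁴`. -/
def hypersurface (F : MvPolynomial (Fin 5) ℂ) : Set (ℙ ℂ (Fin 5 → ℂ)) :=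
  projZeros {F}

/-- `F` is an irreducible homogeneous polynomial of degree 3 in five variables and the cubic
threefold `{F = 0}` in `ℙ⁴` is smooth (Jacobian criterion). -/
structure IsSmoothCubic (F : MvPolynomial (Fin 5) ℂ) : Prop where
  homogeneous : F.IsHomogeneous 3
  irreducible : Irreducible F
  smooth : ∀ v : Fin 5 → ℂ, v ≠ 0 → eval v F = 0 → ∃ i, eval v (pderiv i F) ≠ 0

/-- `Aut(X) = {f ∈ Aut(ℙ⁴) | f(X) = X}` for `X = {F = 0}`, a subgroup of `PGL(5, ℂ) = Aut(ℙ⁴)`. -/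
def aut (F : MvPolynomial (Fin 5) ℂ) : Subgroup PGL(5, ℂ) :=
  MulAction.stabilizer PGL(5, ℂ) (hypersurface F)

/-- `A(F) = F(∑ᵢ a₁ᵢ xᵢ, …, ∑ᵢ a₅ᵢ xᵢ)`. -/
def subst (A : GL (Fin 5) ℂ) (F : MvPolynomial (Fin 5) ℂ) : MvPolynomial (Fin 5) ℂ :=
  bind₁ (fun i => ∑ j, C (A.val i j) * X j) F

/-- `H < GL(5, ℂ)` is an `F`-lifting of `G < PGL(5, ℂ)`: the projection `GL(5, ℂ) → PGL(5, ℂ)`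
restricts to a bijection (hence an isomorphism) from `H` onto `G`, and `A(F) = F` for all
`A ∈ H`. -/
structure IsFLifting (F : MvPolynomial (Fin 5) ℂ) (H : Subgroup (GL (Fin 5) ℂ))
    (G : Subgroup PGL(5, ℂ)) : Prop where
  map_eq : H.map Matrix.ProjGenLinGroup.mk = G
  injOn : Set.InjOn Matrix.ProjGenLinGroup.mk (H : Set (GL (Fin 5) ℂ))
  invariant : ∀ A ∈ H, subst A F = F

/-- The conjugate subgroup `P H P⁻¹`. -/
def conj (P : GL (Fin 5) ℂ) (H : Subgroup (GL (Fin 5) ℂ)) : Subgroup (GL (Fin 5) ℂ) :=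
  H.map (MulAut.conj P).toMonoidHom

/-- `ξ k = exp (2πi/k)`, a primitive `k`-th root of unity for `k ≥ 1`. -/
def ξ (k : ℕ) : ℂˣ :=
  Units.mk0 (Complex.exp (2 * Real.pi * Complex.I / k)) (Complex.exp_ne_zero _)

/-- The invertible diagonal matrix with diagonal entries `d`. -/
def diag (d : Fin 5 → ℂˣ) : GL (Fin 5) ℂ where
  val := Matrix.diagonal fun i => (d i : ℂ)
  inv := Matrix.diagonal fun i => ((d i)⁻¹ : ℂˣ)
  val_inv := by simp
  inv_val := by simp

/-- The subgroup of `GL(5, ℂ)` generated by the diagonal matrices in the list `ds`. -/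
def diagGroup (ds : List (Fin 5 → ℂˣ)) : Subgroup (GL (Fin 5) ℂ) :=
  Subgroup.closure {A | ∃ d ∈ ds, A = diag d}

/-- The product of cyclic groups `C_{n₁} × ⋯ × C_{n_r}` for `ns = [n₁, …, n_r]`. -/
abbrev ProdCyclic (ns : List ℕ) : Type :=
  (i : Fin ns.length) → Multiplicative (ZMod (ns.get i))

/-- The 25 abelian groups, as products of cyclic groups. -/
def abelianTypes : List (List ℕ) :=
  [[2], [3], [4], [2, 2], [5], [6], [8], [4, 2], [9], [3, 3], [11], [12], [6, 2], [15], [16],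
   [18], [6, 3], [24], [12, 2], [9, 3], [3, 3, 3], [12, 3], [6, 6], [6, 3, 3], [3, 3, 3, 3]]

/-- Names of the six special cubic threefolds. -/
inductive Special : Type
  | X₁ | X₂ | X₃ | X₄ | X₅ | X₆

/-- `X₁ : x₁³ + x₂³ + x₃³ + x₄³ + x₅³ = 0` (Fermat). -/
def cubic₁ : MvPolynomial (Fin 5) ℂ :=
  X 0 ^ 3 + X 1 ^ 3 + X 2 ^ 3 + X 3 ^ 3 + X 4 ^ 3

/-- `X₂ : x₁³ + x₂³ + x₃³ + 3(√3 - 1)x₁x₂x₃ + x₄³ + x₅³ = 0`. -/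
def cubic₂ : MvPolynomial (Fin 5) ℂ :=
  X 0 ^ 3 + X 1 ^ 3 + X 2 ^ 3 + C (3 * (((Real.sqrt 3 : ℝ) : ℂ) - 1)) * X 0 * X 1 * X 2
    + X 3 ^ 3 + X 4 ^ 3

/-- `X₃ : x₁²x₂ + x₂²x₃ + x₃²x₄ + x₄³ + x₅³ = 0`. -/
def cubic₃ : MvPolynomial (Fin 5) ℂ :=
  X 0 ^ 2 * X 1 + X 1 ^ 2 * X 2 + X 2 ^ 2 * X 3 + X 3 ^ 3 + X 4 ^ 3

/-- `X₄ : x₁²x₂ + x₂²x₃ + x₃²x₄ + x₄²x₅ + x₅³ = 0`. -/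
def cubic₄ : MvPolynomial (Fin 5) ℂ :=
  X 0 ^ 2 * X 1 + X 1 ^ 2 * X 2 + X 2 ^ 2 * X 3 + X 3 ^ 2 * X 4 + X 4 ^ 3

/-- `X₅ : x₁²x₂ + x₂²x₃ + x₃²x₄ + x₄²x₅ + x₅²x₁ = 0` (Klein). -/
def cubic₅ : MvPolynomial (Fin 5) ℂ :=
  X 0 ^ 2 * X 1 + X 1 ^ 2 * X 2 + X 2 ^ 2 * X 3 + X 3 ^ 2 * X 4 + X 4 ^ 2 * X 0

/-- `X₆ ⊂ ℙ⁵ : x₁³ + x₂³ + x₃³ + x₄³ + x₅³ + x₆³ = x₁ + x₂ + x₃ + x₄ + x₅ = 0`. -/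
def locus₆ : Set (ℙ ℂ (Fin 6 → ℂ)) :=
  projZeros {X 0 ^ 3 + X 1 ^ 3 + X 2 ^ 3 + X 3 ^ 3 + X 4 ^ 3 + X 5 ^ 3,
    X 0 + X 1 + X 2 + X 3 + X 4}

/-- `Y` is the image of `X` under the linear embedding of projective spaces induced by an
injective linear map. For `m = n` this is projective equivalence. -/
def LinearlyIsomorphic {m n : ℕ} (X : Set (ℙ ℂ (Fin m → ℂ))) (Y : Set (ℙ ℂ (Fin n → ℂ))) : Prop :=
  ∃ (L : (Fin m → ℂ) →ₗ[ℂ] (Fin n → ℂ)) (hL : Function.Injective L),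
    Projectivization.map L hL '' X = Y

/-- `X ≅ Xᵢ`; smooth cubic threefolds are isomorphic if and only if they are so by a projective
linear map. -/
def IsIsoTo (X : Set (ℙ ℂ (Fin 5 → ℂ))) : Special → Prop
  | .X₁ => LinearlyIsomorphic X (hypersurface cubic₁)
  | .X₂ => LinearlyIsomorphic X (hypersurface cubic₂)
  | .X₃ => LinearlyIsomorphic X (hypersurface cubic₃)
  | .X₄ => LinearlyIsomorphic X (hypersurface cubic₄)
  | .X₅ => LinearlyIsomorphic X (hypersurface cubic₅)
  | .X₆ => LinearlyIsomorphic X locus₆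

/-- The table of `F`-liftings. `Table ns ds u` means that some row of the table, for some
admissible values of its parameters, lists the abstract group `∏ C_n` for `n` in `ns`, the diagonal
generators `ds`, and in the uniqueness column `X ≅ Xᵢ` (`u = some Xᵢ`) or nothing (`u = none`). -/
inductive Table : List ℕ → List (Fin 5 → ℂˣ) → Option Special → Prop
  | row1 (a : ℕ) (ha : a ≤ 1) :
      Table [2] [![-1, (-1) ^ a, 1, 1, 1]] none
  | row2 (a : ℕ) (ha : a ≤ 2) :
      Table [3] [![1, 1, 1, ξ 3, ξ 3 ^ a]] none
  | row3 :
      Table [3] [![1, 1, ξ 3, ξ 3, ξ 3 ^ 2]] none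
  | row4 (a : ℕ) (ha : a = 0 ∨ a = 2 ∨ a = 3) :
      Table [4] [![ξ 4, -1, 1, ξ 4 ^ a, 1]] none
  | row5 (a : ℕ) (ha : a ≤ 1) :
      Table [2, 2] [![-1, (-1) ^ a, 1, 1, 1], ![1, (-1) ^ a, -1, 1, 1]] none
  | row6 :
      Table [5] [![ξ 5, ξ 5 ^ 3, ξ 5 ^ 4, ξ 5 ^ 2, 1]] none
  | row7 :
      Table [2, 3] [![-1, 1, -1, 1, 1], ![1, 1, 1, ξ 3, 1]] none
  | row8 (a : ℕ) (ha : a ≤ 2) :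
      Table [2, 3] [![-1, 1, -1, 1, 1], ![1, 1, ξ 3, ξ 3, ξ 3 ^ a]] none
  | row9 (a b : ℕ) (hab : a ≤ b) (hb : b ≤ 2) :
      Table [2, 3] [![-1, 1, 1, 1, 1], ![1, 1, ξ 3, ξ 3 ^ a, ξ 3 ^ b]] none
  | row10 (a : ℕ) (ha : a = 0 ∨ a = 2) :
      Table [8] [![ξ 8, ξ 8 ^ 6, -1, 1, ξ 8 ^ a]] none
  | row11 :
      Table [4, 2] [![ξ 4, -1, 1, 1, 1], ![1, 1, 1, -1, 1]] none
  | row12 (a b : ℕ) (hab : a ≤ b) (hb : b ≤ 2) :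
      Table [9] [![ξ 9, ξ 9 ^ 7, ξ 9 ^ 4, ξ 3 ^ a, ξ 3 ^ b]] (some .X₁)
  | row13 (a b c d : ℕ) (hab : a ≤ b) (hb : b ≤ 2) (hcd : c ≤ d) (hd : d ≤ 2) :
      Table [3, 3] [![1, ξ 3, 1, ξ 3 ^ a, ξ 3 ^ b], ![1, 1, ξ 3, ξ 3 ^ c, ξ 3 ^ d]] none
  | row14 :
      Table [11] [![ξ 11, ξ 11 ^ 9, ξ 11 ^ 4, ξ 11 ^ 3, ξ 11 ^ 5]] (some .X₅)
  | row15 (a : ℕ) (ha : a ≤ 2) :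
      Table [4, 3] [![ξ 4, -1, 1, 1, 1], ![1, 1, 1, ξ 3, ξ 3 ^ a]] none
  | row16 :
      Table [4, 3] [![ξ 4, -1, 1, 1, -1], ![1, 1, 1, ξ 3, ξ 3]] none
  | row17 :
      Table [4, 3] [![ξ 4, -1, 1, 1, ξ 4 ^ 3], ![1, 1, 1, ξ 3, 1]] none
  | row18 (a : ℕ) (ha : a ≤ 2) :
      Table [2, 2, 3] [![-1, 1, 1, 1, 1], ![1, 1, -1, 1, 1], ![1, 1, ξ 3, ξ 3, ξ 3 ^ a]] none
  | row19 (a : ℕ) (ha : a ≤ 1) :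
      Table [2, 2, 3]
        [![-1, 1, 1, 1, (-1) ^ a], ![1, 1, -1, 1, (-1) ^ a], ![1, 1, 1, ξ 3, 1]] none
  | row20 :
      Table [5, 3] [![ξ 5, ξ 5 ^ 3, ξ 5 ^ 4, ξ 5 ^ 2, 1], ![1, 1, 1, 1, ξ 3]] (some .X₆)
  | row21 :
      Table [16] [![ξ 16, ξ 16 ^ (-2 : ℤ), ξ 16 ^ 4, -1, 1]] (some .X₄)
  | row22 (a : ℕ) (ha : a ≤ 2) :
      Table [9, 2] [![ξ 9, ξ 9 ^ 7, ξ 9 ^ 4, ξ 3 ^ a, ξ 3 ^ a], ![1, 1, 1, -1, 1]] (some .X₁)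
  | row23 (a : ℕ) (ha : a ≤ 2) :
      Table [2, 3, 3] [![-1, 1, 1, 1, 1], ![1, 1, ξ 3, 1, 1], ![1, 1, 1, ξ 3, ξ 3 ^ a]]
        (if a = 1 then some .X₁ else none)
  | row24 (a : ℕ) (ha : a = 1 ∨ a = 2) :
      Table [2, 3, 3] [![-1, 1, 1, 1, 1], ![1, 1, ξ 3, 1, ξ 3 ^ a], ![1, 1, 1, ξ 3, ξ 3 ^ a]]
        (if a = 1 then some .X₁ else none)
  | row25 :
      Table [2, 3, 3] [![-1, 1, 1, 1, -1], ![1, 1, ξ 3, 1, 1], ![1, 1, 1, ξ 3, ξ 3]] (some .X₁)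
  | row26 :
      Table [8, 3] [![ξ 8, ξ 8 ^ 6, -1, 1, 1], ![1, 1, 1, 1, ξ 3]] (some .X₃)
  | row27 :
      Table [4, 2, 3] [![ξ 4, -1, 1, 1, 1], ![1, 1, 1, -1, 1], ![1, 1, 1, ξ 3, ξ 3]] (some .X₂)
  | row28 (a b : ℕ) (ha : a ≤ 2) (hb : b = 0 ∨ b = 2) :
      Table [9, 3] [![ξ 9, ξ 9 ^ 7, ξ 9 ^ 4, 1, ξ 3 ^ a], ![1, 1, 1, ξ 3, ξ 3 ^ b]] (some .X₁)
  | row29 (a b c : ℕ) (hab : a ≤ b) (hbc : b ≤ c) (hc : c ≤ 2) :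
      Table [3, 3, 3]
        [![1, ξ 3, 1, 1, ξ 3 ^ a], ![1, 1, ξ 3, 1, ξ 3 ^ b], ![1, 1, 1, ξ 3, ξ 3 ^ c]] none
  | row30 :
      Table [4, 3, 3] [![ξ 4, -1, 1, 1, 1], ![1, 1, 1, ξ 3, 1], ![1, 1, 1, 1, ξ 3]] (some .X₂)
  | row31 :
      Table [2, 2, 3, 3]
        [![-1, 1, 1, 1, 1], ![1, -1, 1, 1, 1], ![1, ξ 3, 1, ξ 3, 1], ![1, 1, 1, 1, ξ 3]]
        (some .X₁)
  | row32 :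
      Table [2, 3, 3, 3]
        [![-1, 1, 1, 1, 1], ![1, 1, ξ 3, 1, 1], ![1, 1, 1, ξ 3, 1], ![1, 1, 1, 1, ξ 3]]
        (some .X₁)
  | row33 :
      Table [3, 3, 3, 3]
        [![1, ξ 3, 1, 1, 1], ![1, 1, ξ 3, 1, 1], ![1, 1, 1, ξ 3, 1], ![1, 1, 1, 1, ξ 3]]
        (some .X₁)

end CubicThreefold

end

/-! # Abelian automorphism groups of smooth cubic threefolds

Coordinates are numbered `x₀, …, x₄`, as the elements of `Fin 5`.

An automorphism of `X` lifts to a matrix which preserves `F`: the Nullstellensatz and irreducibility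
show that a lift multiplies `F` by a scalar, and a cube root of that scalar corrects the lift
(`exists_lift`). Lifts of commuting automorphisms commute, since their commutator is a scalar `u`
with `u ^ 3 = 1` (it preserves `F`) and `u ^ 5 = 1` (it has determinant one): `liftGroup_comm`.

Let `B` be the symmetric trilinear form with `B v v v = F v`; smoothness says that `B v v ·` is not
zero for `v ≠ 0`. A matrix which preserves `B` has finite order (`exists_pow_eq_one`). Indeed, if `v`
is an eigenvector for `x`, then `B v v ·` is one for `x⁻²` of the transpose, so the finite set of
eigenvalues is closed under `x ↦ x⁻²` and consists of roots of unity; and a nontrivial unipotent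
matrix `U` is excluded by comparing the polynomial growth of the two sides of
`B (Uⁿ w) (Uⁿ w) u = B w w (U⁻ⁿ u)`. Hence all lifts are diagonal in one basis
(`exists_diagonalization`). They form a group `Γ` of diagonal matrices that contains the scalar `ξ₃`.

In a diagonalizing basis `F` involves only `Γ`-invariant monomials. A form with too few monomials is
singular at a common zero of a few quadrics in at most three variables, so the set of invariant
monomials satisfies the combinatorial condition `Good` (`NonSing.good`). The rest of the
classification uses nothing but `Good` and `ξ₃ ∈ Γ`. For each `i` there is `j` with `xᵢ² xⱼ`
invariant, so `dⱼ = dᵢ⁻²` for `d ∈ Γ`. Iterating `i ↦ j` runs into a cycle of length at most five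
after at most four steps, so the order of `d` divides `7920 = 16 · 9 · 5 · 11` (`Good.pow_eq_one`).
Elements of order `11`, `5` and `9` make the iteration run through cycles of lengths five, four and
three, which determines them up to a permutation of the coordinates, and then `Γ` itself
(`exists_eleven`, `exists_five`, `exists_nine`). In all other cases the exponent of `Γ` divides `48`.
Then the `2`-part of `Γ` is built up by adjoining elements whose double is already present, and the
`3`-part by adjoining elements of order three, always up to a permutation of the coordinates and as
long as `Good` holds. These two finite searches are the Boolean computations `twoCheck` and
`threeCheck` on lists of exponents, evaluated by the kernel; `exists_two_part` and
`exists_normal_form` translate their outcome back to `Γ`. The outcome is the list `rows`: up to a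
permutation of the coordinates, `Γ` is generated by the scalar `ξ₃` and the matrices of a row of the
table (`exists_eq_modelGroup`, `exists_table`). A finite check shows that the generators of a row are
independent modulo scalars, so that the row gives an `F`-lifting of the stated isomorphism type
(`exists_row`).

For the rows that determine `X`, only a few monomials are invariant, and smoothness makes the
necessary coefficients nonzero. A linear change of coordinates then brings `F` into the required
form: a binary cubic without multiple root is a sum of two cubes (`exists_binary`), a loop
`x² y + y² z + z² x` is a sum of three cubes by a discrete Fourier transform (`exists_loop_three`), a
chain `x² y + y² z + z³` is the Hesse cubic with parameter `3 (√3 - 1)` (`hesse_eq_chain`), a loop of length four is mapped to the hyperplane section of the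
Fermat cubic by the fifth roots of unity (`fourier_cubes`), and longer chains and the loop of length
five only need a rescaling of the coordinates (`isIsoTo_of_table`). The last four claims follow since
the order of the group, and for `C₉` its structure, single out the row. -/

noncomputable section

namespace CubicThreefold

open MvPolynomial

/-! ### Symmetric trilinear forms -/

/-- A symmetric trilinear form on `ℂ⁵`, as a function that is additive and homogeneous in its first
argument and invariant under exchanging neighbouring arguments. -/
structure SymTrilinear (B : (Fin 5 → ℂ) → (Fin 5 → ℂ) → (Fin 5 → ℂ) → ℂ) : Prop where
  swap₁₂ : ∀ u v w, B u v w = B v u w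
  swap₂₃ : ∀ u v w, B u v w = B u w v
  add : ∀ u u' v w, B (u + u') v w = B u v w + B u' v w
  smul : ∀ (a : ℂ) u v w, B (a • u) v w = a * B u v w

/-- No nonzero `v` is a singular point of the cubic `v ↦ B v v v`, the derivative of which at `v` is
`3 B v v ·`. -/
def NonSing (B : (Fin 5 → ℂ) → (Fin 5 → ℂ) → (Fin 5 → ℂ) → ℂ) : Prop :=
  ∀ v, v ≠ 0 → ∃ u, B v v u ≠ 0

namespace SymTrilinear

variable {B : (Fin 5 → ℂ) → (Fin 5 → ℂ) → (Fin 5 → ℂ) → ℂ}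

lemma swap₁₃ (hB : SymTrilinear B) (u v w) : B u v w = B w v u := by
  rw [hB.swap₁₂, hB.swap₂₃, hB.swap₁₂]

lemma add₂ (hB : SymTrilinear B) (u v v' w) : B u (v + v') w = B u v w + B u v' w := by
  rw [hB.swap₁₂, hB.add, hB.swap₁₂ v, hB.swap₁₂ v']

lemma add₃ (hB : SymTrilinear B) (u v w w') : B u v (w + w') = B u v w + B u v w' := by
  rw [hB.swap₁₃, hB.add, hB.swap₁₃ w, hB.swap₁₃ w']

lemma smul₂ (hB : SymTrilinear B) (a : ℂ) (u v w) : B u (a • v) w = a * B u v w := by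
  rw [hB.swap₁₂, hB.smul, hB.swap₁₂ v]

lemma smul₃ (hB : SymTrilinear B) (a : ℂ) (u v w) : B u v (a • w) = a * B u v w := by
  rw [hB.swap₁₃, hB.smul, hB.swap₁₃ w]

/-- The linear form `B u v ·`. -/
def lin₃ (hB : SymTrilinear B) (u v : Fin 5 → ℂ) : (Fin 5 → ℂ) →ₗ[ℂ] ℂ where
  toFun := B u v
  map_add' := hB.add₃ u v
  map_smul' a w := hB.smul₃ a u v w

lemma sum₃ (hB : SymTrilinear B) {ι : Type*} (s : Finset ι) (f : ι → Fin 5 → ℂ) (u v) :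
    B u v (∑ i ∈ s, f i) = ∑ i ∈ s, B u v (f i) :=
  map_sum (hB.lin₃ u v) f s

lemma sum₁ (hB : SymTrilinear B) {ι : Type*} (s : Finset ι) (f : ι → Fin 5 → ℂ) (u v) :
    B (∑ i ∈ s, f i) u v = ∑ i ∈ s, B (f i) u v := by
  rw [hB.swap₁₃, hB.sum₃]; simp_rw [hB.swap₁₃ v u]

lemma sum₂ (hB : SymTrilinear B) {ι : Type*} (s : Finset ι) (f : ι → Fin 5 → ℂ) (u v) :
    B u (∑ i ∈ s, f i) v = ∑ i ∈ s, B u (f i) v := by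
  rw [hB.swap₂₃, hB.sum₃]; simp_rw [hB.swap₂₃ u v]

lemma expand₃ (hB : SymTrilinear B) (u v w) :
    B u v w = ∑ k, w k * B u v (Pi.single k 1) := by
  conv_lhs => rw [← (Pi.basisFun ℂ (Fin 5)).sum_repr w]
  simp only [hB.sum₃, hB.smul₃, Pi.basisFun_repr, Pi.basisFun_apply]

lemma expand (hB : SymTrilinear B) (u v w) :
    B u v w = ∑ i, ∑ j, ∑ k, u i * v j * w k *
      B (Pi.single i 1) (Pi.single j 1) (Pi.single k 1) := by
  rw [hB.swap₁₃, hB.expand₃]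
  refine Finset.sum_congr rfl fun i _ => ?_
  rw [hB.swap₁₃, hB.swap₂₃, hB.expand₃, Finset.mul_sum]
  refine Finset.sum_congr rfl fun j _ => ?_
  rw [hB.swap₂₃, hB.expand₃, Finset.mul_sum, Finset.mul_sum]
  exact Finset.sum_congr rfl fun k _ => by ring

lemma comp (hB : SymTrilinear B) (L : (Fin 5 → ℂ) →ₗ[ℂ] (Fin 5 → ℂ)) :
    SymTrilinear fun u v w => B (L u) (L v) (L w) where
  swap₁₂ u v w := hB.swap₁₂ _ _ _
  swap₂₃ u v w := hB.swap₂₃ _ _ _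
  add u u' v w := by simp [hB.add]
  smul a u v w := by simp [hB.smul]

/-- The polarization identity. -/
lemma six_mul (hB : SymTrilinear B) (u v w) : 6 * B u v w =
    B (u + v + w) (u + v + w) (u + v + w) - B (u + v) (u + v) (u + v) - B (u + w) (u + w) (u + w)
      - B (v + w) (v + w) (v + w) + B u u u + B v v v + B w w w := by
  simp only [hB.add, hB.add₂, hB.add₃]
  rw [hB.swap₁₂ v u w, hB.swap₂₃ v w u, hB.swap₁₂ v u w, hB.swap₂₃ u w v, hB.swap₁₂ w u v,
    hB.swap₂₃ u w v, hB.swap₁₃ w v u, hB.swap₁₂ v u u, hB.swap₂₃ u v u, hB.swap₁₂ v u v,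
    hB.swap₁₃ v v u, hB.swap₁₂ w u u, hB.swap₂₃ u w u, hB.swap₁₂ w u w, hB.swap₁₃ w w u,
    hB.swap₁₂ w v v, hB.swap₂₃ v w v, hB.swap₁₂ w v w, hB.swap₁₃ w w v]
  ring

lemma six_mul_diag (hB : SymTrilinear B) (v u) : 6 * B v v u =
    B (v + u) (v + u) (v + u) - B (v - u) (v - u) (v - u) - 2 * B u u u := by
  have : v - u = v + (-1 : ℂ) • u := by simp [sub_eq_add_neg]
  rw [this]
  simp only [hB.add, hB.add₂, hB.add₃, hB.smul, hB.smul₂, hB.smul₃]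
  rw [hB.swap₁₂ u v v, hB.swap₂₃ v u v, hB.swap₁₂ u v u, hB.swap₁₃ u u v]
  ring

/-- A linear map preserving the cubic preserves its polarization. -/
lemma eq_of_diag (hB : SymTrilinear B) (L : (Fin 5 → ℂ) →ₗ[ℂ] (Fin 5 → ℂ))
    (h : ∀ v, B (L v) (L v) (L v) = B v v v) (u v w) : B (L u) (L v) (L w) = B u v w := by
  have h1 := hB.six_mul u v w
  have h2 := hB.six_mul (L u) (L v) (L w)
  simp only [← map_add, h] at h2
  rw [← h1] at h2
  exact mul_left_cancel₀ (by norm_num) h2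

end SymTrilinear

lemma NonSing.comp {B : (Fin 5 → ℂ) → (Fin 5 → ℂ) → (Fin 5 → ℂ) → ℂ} (hB : NonSing B)
    (L : (Fin 5 → ℂ) ≃ₗ[ℂ] (Fin 5 → ℂ)) :
    NonSing fun u v w => B (L u) (L v) (L w) := by
  intro v hv
  obtain ⟨u, hu⟩ := hB (L v) (by simpa using hv)
  exact ⟨L.symm u, by simpa using hu⟩

/-- The polarization of a cubic form `F`, with coefficients `∂ᵢ∂ⱼ∂ₖF / 6`. The third derivatives of
a cubic form are constant; evaluating them at `0` defines a trilinear form for every polynomial. -/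
def polar (F : MvPolynomial (Fin 5) ℂ) (u v w : Fin 5 → ℂ) : ℂ :=
  ∑ i, ∑ j, ∑ k, u i * v j * w k * (eval 0 (pderiv i (pderiv j (pderiv k F))) / 6)

lemma pderiv_comm' (i j : Fin 5) (F : MvPolynomial (Fin 5) ℂ) :
    pderiv i (pderiv j F) = pderiv j (pderiv i F) := by
  have h : ⁅(pderiv i : Derivation ℂ (MvPolynomial (Fin 5) ℂ) (MvPolynomial (Fin 5) ℂ)),
      (pderiv j : Derivation ℂ (MvPolynomial (Fin 5) ℂ) (MvPolynomial (Fin 5) ℂ))⁆ = 0 := by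
    refine derivation_ext fun k => ?_
    rw [Derivation.commutator_apply, pderiv_X, pderiv_X]
    simp only [Pi.single_apply, apply_ite (pderiv i), apply_ite (pderiv j), pderiv_one, map_zero,
      ite_self, sub_self, Derivation.zero_apply]
  have := congrArg (fun D => D F) h
  simpa [Derivation.commutator_apply, sub_eq_zero] using this

lemma polar_symTrilinear (F : MvPolynomial (Fin 5) ℂ) : SymTrilinear (polar F) where
  swap₁₂ u v w := by
    simp only [polar]
    rw [Finset.sum_comm]
    refine Finset.sum_congr rfl fun i _ => Finset.sum_congr rfl fun j _ =>
      Finset.sum_congr rfl fun k _ => ?_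
    rw [pderiv_comm' j i]; ring
  swap₂₃ u v w := by
    simp only [polar]
    refine Finset.sum_congr rfl fun i _ => ?_
    rw [Finset.sum_comm]
    refine Finset.sum_congr rfl fun j _ => Finset.sum_congr rfl fun k _ => ?_
    rw [pderiv_comm' k j]; ring
  add u u' v w := by
    simp only [polar, ← Finset.sum_add_distrib]
    refine Finset.sum_congr rfl fun i _ => Finset.sum_congr rfl fun j _ =>
      Finset.sum_congr rfl fun k _ => ?_
    simp only [Pi.add_apply]; ring
  smul a u v w := by
    simp only [polar, Finset.mul_sum]
    refine Finset.sum_congr rfl fun i _ => Finset.sum_congr rfl fun j _ =>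
      Finset.sum_congr rfl fun k _ => ?_
    simp only [Pi.smul_apply, smul_eq_mul]; ring

lemma euler_eval {F : MvPolynomial (Fin 5) ℂ} {n : ℕ} (hF : F.IsHomogeneous n) (v : Fin 5 → ℂ) :
    ∑ i, v i * eval v (pderiv i F) = n * eval v F := by
  simpa using congrArg (eval v) hF.sum_X_mul_pderiv

lemma eval_eq_of_isHomogeneous_zero {F : MvPolynomial (Fin 5) ℂ} (hF : F.IsHomogeneous 0)
    (v : Fin 5 → ℂ) : eval v F = eval 0 F := by
  rw [← totalDegree_zero_iff_isHomogeneous, totalDegree_eq_zero_iff_eq_C] at hF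
  rw [hF]; simp

lemma polar_diag_eq {F : MvPolynomial (Fin 5) ℂ} (hF : F.IsHomogeneous 3) (v : Fin 5 → ℂ)
    (k : Fin 5) : 3 * polar F v v (Pi.single k 1) = eval v (pderiv k F) := by
  have h2 := fun j => euler_eval (hF.pderiv (i := k) |>.pderiv (i := j)) v
  have h1 := euler_eval (hF.pderiv (i := k)) v
  have h0 := fun i j => eval_eq_of_isHomogeneous_zero
    (hF.pderiv (i := k) |>.pderiv (i := j) |>.pderiv (i := i)) v
  simp only [h0] at h2
  have : polar F v v (Pi.single k 1) =
      ∑ j, v j * (∑ i, v i * eval 0 (pderiv i (pderiv j (pderiv k F)))) / 6 := by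
    simp only [polar, Finset.mul_sum, Finset.sum_div]
    rw [Finset.sum_comm]
    refine Finset.sum_congr rfl fun j _ => Finset.sum_congr rfl fun i _ => ?_
    rw [Finset.sum_eq_single k] <;> simp +contextual
    ring
  rw [this]
  simp only [h2]
  norm_num at h1 ⊢
  rw [← Finset.sum_div, h1]; ring

lemma polar_diag {F : MvPolynomial (Fin 5) ℂ} (hF : F.IsHomogeneous 3) (v : Fin 5 → ℂ) :
    polar F v v v = eval v F := by
  have h := euler_eval hF v
  simp only [← polar_diag_eq hF] at h
  rw [(polar_symTrilinear F).expand₃]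
  have h3 : (3 : ℂ) ≠ 0 := by norm_num
  apply mul_left_cancel₀ h3
  rw [Finset.mul_sum]
  norm_num at h
  rw [← h]
  exact Finset.sum_congr rfl fun i _ => by ring

/-- At the points of `X` this is the Jacobian criterion, elsewhere `B v v v ≠ 0`. -/
lemma IsSmoothCubic.nonSing {F : MvPolynomial (Fin 5) ℂ} (hF : IsSmoothCubic F) :
    NonSing (polar F) := by
  intro v hv
  by_cases h : eval v F = 0
  · obtain ⟨i, hi⟩ := hF.smooth v hv h
    refine ⟨Pi.single i 1, fun h0 => hi ?_⟩
    rw [← polar_diag_eq hF.homogeneous, h0, mul_zero]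
  · exact ⟨v, by rwa [polar_diag hF.homogeneous]⟩

lemma eval_subst (A : GL (Fin 5) ℂ) (F : MvPolynomial (Fin 5) ℂ) (v : Fin 5 → ℂ) :
    eval v (subst A F) = eval (A.val.mulVec v) F := by
  have h := eval₂Hom_bind₁ (RingHom.id ℂ) v (fun i => ∑ j, C (A.val i j) * X j) F
  refine h.trans ?_
  change eval (fun i => eval v (∑ j, C (A.val i j) * X j)) F = _
  congr 2
  ext i
  simp [Matrix.mulVec, dotProduct]

lemma subst_eq_iff (A : GL (Fin 5) ℂ) (F G : MvPolynomial (Fin 5) ℂ) :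
    subst A F = G ↔ ∀ v, eval (A.val.mulVec v) F = eval v G := by
  constructor
  · rintro rfl v; rw [eval_subst]
  · intro h; apply MvPolynomial.funext; intro v; rw [eval_subst, h]

/-! ### Linear maps preserving a nonsingular cubic form have finite order -/

section FiniteOrder

open Filter Topology

/-- The powers `x ^ (-2)ᵏ` stay in a finite set, so two of them agree. -/
lemma exists_pow_eq_one_of_closed {s : Set ℂ} (hs : s.Finite) (h0 : ∀ x ∈ s, x ≠ 0)
    (h : ∀ x ∈ s, (x ^ 2)⁻¹ ∈ s) {x : ℂ} (hx : x ∈ s) : ∃ m : ℕ, 0 < m ∧ x ^ m = 1 := by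
  have hmem : ∀ k : ℕ, x ^ ((-2 : ℤ) ^ k) ∈ s := by
    intro k
    induction k with
    | zero => simpa using hx
    | succ k ih =>
      have := h _ ih
      rwa [← zpow_natCast, ← zpow_mul, ← zpow_neg, ← mul_neg, Nat.cast_ofNat, ← pow_succ] at this
  obtain ⟨i, -, j, -, hij, he⟩ := Set.infinite_univ.exists_ne_map_eq_of_mapsTo
    (f := fun k : ℕ => x ^ ((-2 : ℤ) ^ k)) (fun k _ => hmem k) hs
  have hne : (-2 : ℤ) ^ i - (-2) ^ j ≠ 0 := by
    rw [sub_ne_zero]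
    intro h2
    have := congrArg Int.natAbs h2
    simp only [Int.natAbs_pow] at this
    exact hij (Nat.pow_right_injective le_rfl this)
  have h1 : x ^ ((-2 : ℤ) ^ i - (-2) ^ j) = 1 := by
    rw [zpow_sub₀ (h0 x hx), he, div_self (zpow_ne_zero _ (h0 x hx))]
  refine ⟨((-2 : ℤ) ^ i - (-2) ^ j).natAbs, Int.natAbs_pos.2 hne, ?_⟩
  rw [← zpow_natCast, Int.natCast_natAbs]
  rcases abs_choice ((-2 : ℤ) ^ i - (-2) ^ j) with h2 | h2 <;> rw [h2]
  · exact h1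
  · rw [zpow_neg, h1, inv_one]

variable {B : (Fin 5 → ℂ) → (Fin 5 → ℂ) → (Fin 5 → ℂ) → ℂ}

lemma injective_of_preserves (hB : SymTrilinear B) (hs : NonSing B)
    {f : Module.End ℂ (Fin 5 → ℂ)} (h : ∀ u v w, B (f u) (f v) (f w) = B u v w) :
    Function.Injective f := by
  rw [injective_iff_map_eq_zero]
  intro v hv
  by_contra hne
  obtain ⟨u, hu⟩ := hs v hne
  apply hu
  rw [← h, hv]
  simpa using hB.smul 0 0 0 (f u)

/-- If `f v = x v`, the nonzero linear form `B v v ·` vanishes on the range of `f - x⁻²`. Hence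
`x⁻²` is an eigenvalue, too. -/
lemma eigenvalue_closed (hB : SymTrilinear B) (hs : NonSing B)
    {f : Module.End ℂ (Fin 5 → ℂ)} (h : ∀ u v w, B (f u) (f v) (f w) = B u v w)
    {x : ℂ} (hx : f.HasEigenvalue x) : x ≠ 0 ∧ f.HasEigenvalue (x ^ 2)⁻¹ := by
  have hinj := injective_of_preserves hB hs h
  obtain ⟨v, hv⟩ := hx.exists_hasEigenvector
  have hfv := hv.apply_eq_smul
  have hx0 : x ≠ 0 := by
    rintro rfl
    rw [zero_smul] at hfv
    exact hv.2 (hinj (by rw [hfv, map_zero]))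
  refine ⟨hx0, ?_⟩
  obtain ⟨u, hu⟩ := hs v hv.2
  -- the linear form `B v v ·` kills the range of `f - x⁻²`
  have hker : ∀ w, B v v ((f - algebraMap ℂ _ (x ^ 2)⁻¹) w) = 0 := by
    intro w
    have h1 := h v v w
    rw [hfv, hB.smul, hB.smul₂] at h1
    have h2 := (hB.lin₃ v v).map_sub (f w) ((x ^ 2)⁻¹ • w)
    change B v v (f w - (x ^ 2)⁻¹ • w) = B v v (f w) - B v v ((x ^ 2)⁻¹ • w) at h2
    rw [LinearMap.sub_apply, Module.algebraMap_end_apply, h2, hB.smul₃, ← h1]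
    field_simp
    ring
  rw [Module.End.hasEigenvalue_iff, Module.End.eigenspace_def]
  intro hbot
  rw [LinearMap.ker_eq_bot, LinearMap.injective_iff_surjective] at hbot
  obtain ⟨w, hw⟩ := hbot u
  exact hu (hw ▸ hker w)

/-- The eigenvalues of `f` are roots of unity, so some power of `f` is unipotent. -/
lemma exists_pow_sub_one_nilpotent (hB : SymTrilinear B) (hs : NonSing B)
    {f : Module.End ℂ (Fin 5 → ℂ)} (h : ∀ u v w, B (f u) (f v) (f w) = B u v w) :
    ∃ m : ℕ, 0 < m ∧ IsNilpotent (f ^ m - 1) := by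
  have hfin : Set.Finite {x | f.HasEigenvalue x} := f.finite_hasEigenvalue
  have hroot := fun x (hx : x ∈ {x | f.HasEigenvalue x}) =>
    exists_pow_eq_one_of_closed hfin (fun y hy => (eigenvalue_closed hB hs h hy).1)
      (fun y hy => (eigenvalue_closed hB hs h hy).2) hx
  choose! m hm0 hm using hroot
  refine ⟨∏ x ∈ hfin.toFinset, m x, Finset.prod_pos fun x hx => hm0 x (by simpa using hx), ?_⟩
  set M := ∏ x ∈ hfin.toFinset, m x
  have hM : ∀ x, f.HasEigenvalue x → x ^ M = 1 := fun x hx => by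
    obtain ⟨c, hc⟩ := Finset.dvd_prod_of_mem m (hfin.mem_toFinset.2 hx)
    change x ^ (∏ x ∈ hfin.toFinset, m x) = 1
    rw [hc, pow_mul, hm x hx, one_pow]
  refine ⟨Module.finrank ℂ (Fin 5 → ℂ), ?_⟩
  rw [← LinearMap.ker_eq_top, eq_top_iff, ← Module.End.iSup_maxGenEigenspace_eq_top f]
  refine iSup_le fun x => ?_
  by_cases hx : f.HasEigenvalue x
  · intro v hv
    rw [Module.End.maxGenEigenspace_eq_genEigenspace_finrank, Module.End.mem_genEigenspace_nat,
      LinearMap.mem_ker] at hv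
    obtain ⟨g, hg⟩ : ∃ g, f ^ M - 1 = g * (f - x • 1) ∧ Commute g (f - x • 1) := by
      have hc : Commute f (x • 1 : Module.End ℂ (Fin 5 → ℂ)) :=
        (Commute.one_right f).smul_right x
      have h1 := hc.mul_geom_sum₂ M
      have h2 : (x • 1 : Module.End ℂ (Fin 5 → ℂ)) ^ M = 1 := by
        rw [smul_pow, one_pow, hM x hx, one_smul]
      rw [h2] at h1
      have h3 : Commute (∑ i ∈ Finset.range M,
          f ^ i * (x • 1 : Module.End ℂ (Fin 5 → ℂ)) ^ (M - 1 - i)) (f - x • 1) := by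
        refine Commute.sub_right ?_ ?_
        · exact Commute.sum_left _ _ _ fun i _ =>
            ((Commute.refl f).pow_left i).mul_left (hc.symm.pow_left _)
        · exact Commute.sum_left _ _ _ fun i _ =>
            (hc.pow_left i).mul_left ((Commute.refl _).pow_left _)
      exact ⟨_, by rw [h3.eq, h1], h3⟩
    rw [LinearMap.mem_ker, hg.1, hg.2.mul_pow, Module.End.mul_apply, hv, map_zero]
  · have : f.maxGenEigenspace x = ⊥ := by
      by_contra hne
      apply hx
      rw [Module.End.maxGenEigenspace_eq_genEigenspace_finrank] at hne
      exact Module.End.hasEigenvalue_of_hasGenEigenvalue (k := Module.finrank ℂ (Fin 5 → ℂ)) hne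
    rw [this]; exact bot_le

lemma tendsto_choose_div_pow {i k : ℕ} (hik : i ≤ k) :
    Tendsto (fun n : ℕ => (n.choose i : ℂ) / (n : ℂ) ^ k) atTop
      (𝓝 (if i = k then (k.factorial : ℂ)⁻¹ else 0)) := by
  have h1 : Tendsto (fun n : ℕ => (n.choose i : ℝ) / (n : ℝ) ^ i) atTop
      (𝓝 (i.factorial : ℝ)⁻¹) := by
    have h := (isEquivalent_choose i)
    rw [Asymptotics.isEquivalent_iff_tendsto_one] at h
    · have h2 := h.mul_const ((i.factorial : ℝ)⁻¹)
      rw [one_mul] at h2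
      refine h2.congr' ?_
      filter_upwards [eventually_gt_atTop 0] with n hn
      have : (i.factorial : ℝ) ≠ 0 := by positivity
      have hn' : (n : ℝ) ≠ 0 := by positivity
      simp only [Pi.div_apply]
      field_simp
    · filter_upwards [eventually_gt_atTop 0] with n hn
      positivity
  have h2 : Tendsto (fun n : ℕ => (n.choose i : ℝ) / (n : ℝ) ^ k) atTop
      (𝓝 (if i = k then (k.factorial : ℝ)⁻¹ else 0)) := by
    split_ifs with hk
    · subst hk; exact h1
    · have h3 : Tendsto (fun n : ℕ => ((n : ℝ) ^ (k - i))⁻¹) atTop (𝓝 0) :=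
        (((tendsto_pow_atTop (by omega)).comp tendsto_natCast_atTop_atTop)).inv_tendsto_atTop
      have h4 := h1.mul h3
      rw [mul_zero] at h4
      refine h4.congr' ?_
      filter_upwards with n
      rw [div_mul_eq_mul_div, ← div_eq_mul_inv, div_div, ← pow_add]
      congr 2; omega
  have h3 := (Complex.continuous_ofReal.tendsto _).comp h2
  refine (h3.congr fun n => by simp).trans_eq ?_
  split_ifs <;> simp

/-- The leading term of the polynomial `n ↦ (1 + N)ⁿ w`. -/
lemma tendsto_unipotent {N : Module.End ℂ (Fin 5 → ℂ)} {k : ℕ} (hN : N ^ (k + 1) = 0)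
    (w : Fin 5 → ℂ) :
    Tendsto (fun n : ℕ => ((n : ℂ) ^ k)⁻¹ • ((1 + N) ^ n) w) atTop
      (𝓝 ((k.factorial : ℂ)⁻¹ • (N ^ k) w)) := by
  have hexp : ∀ n : ℕ, ((1 + N) ^ n) w =
      ∑ i ∈ Finset.range (k + 1), (n.choose i : ℂ) • (N ^ i) w := by
    intro n
    have h0 : ∀ i, k + 1 ≤ i → (N ^ i) w = 0 := fun i hi => by
      rw [pow_eq_zero_of_le hi hN]; rfl
    rw [add_comm 1 N, (Commute.one_right N).add_pow, LinearMap.sum_apply]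
    have h1 : ∀ i, (N ^ i * 1 ^ (n - i) * (n.choose i : Module.End ℂ (Fin 5 → ℂ))) w =
        (n.choose i : ℂ) • (N ^ i) w := fun i => by
      rw [one_pow, mul_one, (Nat.cast_commute (n.choose i) (N ^ i)).symm.eq, Module.End.mul_apply,
        Nat.cast_smul_eq_nsmul]
      simp
    simp only [h1]
    rcases le_total (n + 1) (k + 1) with hnk | hnk
    · refine Finset.sum_subset (by simpa using hnk) fun i _ hi => ?_
      rw [Nat.choose_eq_zero_of_lt (by simpa using hi)]; simp
    · symm
      refine Finset.sum_subset (by simpa using hnk) fun i _ hi => ?_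
      rw [h0 i (by simpa using hi), smul_zero]
  have hlim := tendsto_finsetSum (Finset.range (k + 1)) fun i hi =>
    (tendsto_choose_div_pow (i := i) (k := k) (by simpa [Nat.lt_succ_iff] using hi)).smul_const
      ((N ^ i) w)
  have heq : ∑ i ∈ Finset.range (k + 1), (if i = k then (k.factorial : ℂ)⁻¹ else 0) • (N ^ i) w =
      (k.factorial : ℂ)⁻¹ • (N ^ k) w := by
    rw [Finset.sum_eq_single k] <;> simp +contextual
  rw [heq] at hlim
  refine hlim.congr fun n => ?_
  rw [hexp, Finset.smul_sum]
  exact Finset.sum_congr rfl fun i _ => by rw [smul_smul, div_eq_mul_inv, mul_comm]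

lemma SymTrilinear.continuous_diag (hB : SymTrilinear B) (u : Fin 5 → ℂ) :
    Continuous fun v => B v v u := by
  simp_rw [fun v => hB.expand v v u]
  fun_prop

lemma SymTrilinear.continuous_lin (hB : SymTrilinear B) (u v : Fin 5 → ℂ) :
    Continuous fun w => B u v w := by
  simp_rw [fun w => hB.expand u v w]
  fun_prop

/-- A unipotent map preserving a nonsingular cubic form is trivial: if `N ^ k ≠ 0 = N ^ (k + 1)`
with `k ≥ 1`, then `B ((1 + N)ⁿ w) ((1 + N)ⁿ w) u` grows like `n²ᵏ`, unless `v = Nᵏ w` satisfies `B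
v v u = 0`; but it equals `B w w ((1 + N)⁻ⁿ u)`, which is at most of order `nᵏ`. -/
lemma eq_one_of_unipotent (hB : SymTrilinear B) (hs : NonSing B)
    {f : Module.End ℂ (Fin 5 → ℂ)} (h : ∀ u v w, B (f u) (f v) (f w) = B u v w)
    (hf : IsNilpotent (f - 1)) : f = 1 := by
  by_contra hne
  set N := f - 1 with hNdef
  have hN0 : N ≠ 0 := sub_ne_zero.2 hne
  obtain ⟨k, hk, hk'⟩ : ∃ k, N ^ (k + 1) = 0 ∧ N ^ k ≠ 0 := by
    have hc : nilpotencyClass N ≠ 0 := by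
      intro h0
      have := pow_nilpotencyClass hf
      rw [h0, pow_zero] at this
      exact one_ne_zero this
    obtain ⟨k, hk⟩ := Nat.exists_eq_succ_of_ne_zero hc
    refine ⟨k, ?_, ?_⟩
    · rw [← Nat.succ_eq_add_one, ← hk]; exact pow_nilpotencyClass hf
    · exact pow_pred_nilpotencyClass hf |> fun h => by rwa [hk] at h
  have hk1 : 1 ≤ k := by
    rcases Nat.eq_zero_or_pos k with rfl | h1
    · rw [zero_add, pow_one] at hk; exact absurd hk hN0
    · exact h1
  have hf1 : f = 1 + N := by rw [hNdef]; abel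
  obtain ⟨w, hw⟩ : ∃ w, (N ^ k) w ≠ 0 := by
    by_contra hall
    push Not at hall
    exact hk' (LinearMap.ext hall)
  obtain ⟨u, hu⟩ := hs _ hw
  -- the inverse of `f` is again unipotent
  obtain ⟨g, hg, hgN⟩ : ∃ g : Module.End ℂ (Fin 5 → ℂ), f * g = 1 ∧ (g - 1) ^ (k + 1) = 0 := by
    have hunit : IsUnit f := by rw [hf1]; exact hf.isUnit_one_add
    obtain ⟨a, rfl⟩ := hunit
    refine ⟨↑a⁻¹, by simp, ?_⟩
    have h1 : (↑a⁻¹ - 1 : Module.End ℂ (Fin 5 → ℂ)) = -(↑a⁻¹ * N) := by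
      rw [hNdef, mul_sub]; simp
    have hcomm : Commute (↑a⁻¹ : Module.End ℂ (Fin 5 → ℂ)) N := by
      rw [hNdef]
      refine Commute.sub_right ?_ (Commute.one_right _)
      rw [commute_iff_eq, Units.inv_mul, Units.mul_inv]
    have h2 : (↑a⁻¹ * N : Module.End ℂ (Fin 5 → ℂ)) ^ (k + 1) = 0 := by
      rw [hcomm.mul_pow, hk, mul_zero]
    rw [h1]
    exact (neg_pow (↑a⁻¹ * N : Module.End ℂ (Fin 5 → ℂ)) (k + 1)).trans (by rw [h2, mul_zero])
  have hinv : ∀ n, B ((f ^ n) w) ((f ^ n) w) u = B w w ((g ^ n) u) := by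
    intro n
    have hpow : ∀ n x y z, B ((f ^ n) x) ((f ^ n) y) ((f ^ n) z) = B x y z := by
      intro n
      induction n with
      | zero => simp
      | succ n ih => intro x y z; simp only [pow_succ', Module.End.mul_apply, h, ih]
    have hfg : ∀ n, f ^ n * g ^ n = 1 := by
      intro n
      induction n with
      | zero => simp
      | succ n ih => rw [pow_succ, pow_succ', mul_assoc, ← mul_assoc f, hg, one_mul, ih]
    have h2 : (f ^ n) ((g ^ n) u) = u := by
      rw [← Module.End.mul_apply, hfg]; rfl
    conv_lhs => rw [← h2]
    rw [hpow]
  have hl := (hB.continuous_diag u).continuousAt.tendsto.comp (tendsto_unipotent hk w)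
  have hr := (hB.continuous_lin w w).continuousAt.tendsto.comp (tendsto_unipotent hgN u)
  have hz : Tendsto (fun n : ℕ => ((n : ℂ) ^ k)⁻¹) atTop (𝓝 0) := by
    have h3 : Tendsto (fun n : ℕ => ((n : ℝ) ^ k)⁻¹) atTop (𝓝 0) :=
      (((tendsto_pow_atTop (by omega)).comp tendsto_natCast_atTop_atTop)).inv_tendsto_atTop
    have h4 := (Complex.continuous_ofReal.tendsto _).comp h3
    rw [Complex.ofReal_zero] at h4
    exact h4.congr fun n => by simp
  have hr' := hz.mul hr
  rw [zero_mul] at hr'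
  have hfg1 : g = 1 + (g - 1) := by abel
  have heq := tendsto_nhds_unique (hl.congr fun n => ?_) hr'
  · rw [hB.smul, hB.smul₂] at heq
    have hk0 : (k.factorial : ℂ)⁻¹ ≠ 0 := inv_ne_zero (by exact_mod_cast k.factorial_ne_zero)
    rcases mul_eq_zero.1 heq with h0 | h0
    · exact hk0 h0
    rcases mul_eq_zero.1 h0 with h0 | h0
    · exact hk0 h0
    · exact hu h0
  · simp only [Function.comp]
    rw [← hf1, ← hfg1, hB.smul, hB.smul₂, hB.smul₃, hinv]

/-- An endomorphism preserving a nonsingular cubic form has finite order. This makes lifts of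
automorphisms diagonalizable, without using that the automorphism group of `X` is finite. -/
theorem exists_pow_eq_one (hB : SymTrilinear B) (hs : NonSing B)
    {f : Module.End ℂ (Fin 5 → ℂ)} (h : ∀ u v w, B (f u) (f v) (f w) = B u v w) :
    ∃ m : ℕ, 0 < m ∧ f ^ m = 1 := by
  obtain ⟨m, hm, hnil⟩ := exists_pow_sub_one_nilpotent hB hs h
  refine ⟨m, hm, eq_one_of_unipotent hB hs ?_ hnil⟩
  clear hnil hm
  induction m with
  | zero => simp
  | succ n ih => intro x y z; simp only [pow_succ', Module.End.mul_apply, h, ih]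

end FiniteOrder

/-! ### Lifting an abelian subgroup of `Aut(X)` and diagonalizing it -/

lemma eval_smul {n : ℕ} {F : MvPolynomial (Fin n) ℂ} {d : ℕ} (hF : F.IsHomogeneous d) (a : ℂ)
    (v : Fin n → ℂ) : eval (a • v) F = a ^ d * eval v F := by
  rw [eval_eq, eval_eq, Finset.mul_sum]
  refine Finset.sum_congr rfl fun m hm => ?_
  have hd : ∑ i ∈ m.support, m i = d := by
    have := hF (mem_support_iff.1 hm)
    rw [Finsupp.weight_apply] at this
    simpa [Finsupp.sum] using this
  simp only [Pi.smul_apply, smul_eq_mul, mul_pow, Finset.prod_mul_distrib]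
  rw [Finset.prod_pow_eq_pow_sum, hd]
  ring

lemma mk_mem_projZeros {n : ℕ} {S : Set (MvPolynomial (Fin n) ℂ)}
    (hS : ∀ f ∈ S, ∃ d, f.IsHomogeneous d) {v : Fin n → ℂ} (hv : v ≠ 0) :
    Projectivization.mk ℂ v hv ∈ projZeros S ↔ ∀ f ∈ S, eval v f = 0 := by
  simp only [projZeros, Set.mem_ofPred_eq, Projectivization.submodule_mk]
  refine ⟨fun h f hf => h f hf v (Submodule.mem_span_singleton_self v), fun h f hf w hw => ?_⟩
  obtain ⟨a, rfl⟩ := Submodule.mem_span_singleton.1 hw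
  obtain ⟨d, hd⟩ := hS f hf
  rw [eval_smul hd, h f hf, mul_zero]

lemma mk_mem_hypersurface {F : MvPolynomial (Fin 5) ℂ} (hF : F.IsHomogeneous 3) {v : Fin 5 → ℂ}
    (hv : v ≠ 0) : Projectivization.mk ℂ v hv ∈ hypersurface F ↔ eval v F = 0 := by
  rw [hypersurface, mk_mem_projZeros (by rintro f rfl; exact ⟨3, hF⟩)]
  simp

lemma eval_mulVec_eq_zero_iff {F : MvPolynomial (Fin 5) ℂ} (hF : F.IsHomogeneous 3)
    {A : GL (Fin 5) ℂ} (hA : Matrix.ProjGenLinGroup.mk A ∈ aut F) (v : Fin 5 → ℂ) :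
    eval (A.val.mulVec v) F = 0 ↔ eval v F = 0 := by
  by_cases hv : v = 0
  · simp [hv]
  have hAv : A • v ≠ 0 := (smul_ne_zero_iff_ne A).2 hv
  have h1 : A • v = A.val.mulVec v := rfl
  rw [← mk_mem_hypersurface hF hv]
  have h2 := mk_mem_hypersurface hF hAv
  rw [← Projectivization.PGL.mk_smul_mk] at h2
  rw [← h1, ← h2]
  conv_lhs => rw [← MulAction.mem_stabilizer_iff.1 hA]
  exact Set.smul_mem_smul_set_iff

/-- By the Nullstellensatz, as `F` is irreducible and `A(F)` vanishes on `X`. -/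
lemma dvd_subst {F : MvPolynomial (Fin 5) ℂ} (hF : IsSmoothCubic F)
    {A : GL (Fin 5) ℂ} (hA : Matrix.ProjGenLinGroup.mk A ∈ aut F) : F ∣ subst A F := by
  have hp : (Ideal.span {F}).IsPrime :=
    (Ideal.span_singleton_prime hF.irreducible.ne_zero).2 hF.irreducible.prime
  rw [← Ideal.mem_span_singleton,
    ← MvPolynomial.IsPrime.vanishingIdeal_zeroLocus (K := ℂ) (Ideal.span {F}),
    mem_vanishingIdeal_iff]
  intro x hx
  have h1 := hx F (Ideal.mem_span_singleton_self F)
  change eval x F = 0 at h1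
  change eval x _ = 0
  rw [eval_subst, eval_mulVec_eq_zero_iff hF.homogeneous hA]
  exact h1

lemma subst_subst (A C : GL (Fin 5) ℂ) (F : MvPolynomial (Fin 5) ℂ) :
    subst A (subst C F) = subst (C * A) F := by
  apply MvPolynomial.funext
  intro v
  simp [eval_subst]

lemma subst_one (F : MvPolynomial (Fin 5) ℂ) : subst 1 F = F := by
  apply MvPolynomial.funext
  intro v
  simp [eval_subst]

lemma exists_eval_ne_zero {F : MvPolynomial (Fin 5) ℂ} (hF : F ≠ 0) : ∃ v, eval v F ≠ 0 := by
  by_contra! h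
  exact hF (MvPolynomial.funext fun v => by simp [h])

lemma subst_dvd_subst (A : GL (Fin 5) ℂ) {F G : MvPolynomial (Fin 5) ℂ} (h : F ∣ G) :
    subst A F ∣ subst A G := map_dvd (bind₁ _) h

/-- Every automorphism of `X` lifts to a matrix preserving `F`. -/
lemma exists_lift {F : MvPolynomial (Fin 5) ℂ} (hF : IsSmoothCubic F) {g : PGL(5, ℂ)}
    (hg : g ∈ aut F) : ∃ A : GL (Fin 5) ℂ, Matrix.ProjGenLinGroup.mk A = g ∧ subst A F = F := by
  obtain ⟨A, rfl⟩ := Matrix.ProjGenLinGroup.mk_surjective g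
  obtain ⟨Q, hQ⟩ := dvd_subst hF hg
  have hg' : Matrix.ProjGenLinGroup.mk A⁻¹ ∈ aut F := by
    rw [map_inv]; exact inv_mem hg
  have h2 := subst_dvd_subst A (dvd_subst hF hg')
  rw [subst_subst, inv_mul_cancel, subst_one] at h2
  have hunit : IsUnit Q := by
    rw [hQ] at h2
    have : F * Q ∣ F * 1 := by rwa [mul_one]
    exact isUnit_of_dvd_one ((mul_dvd_mul_iff_left hF.irreducible.ne_zero).1 this)
  obtain ⟨c, hc, rfl⟩ := isUnit_iff_eq_C_of_isReduced.1 hunit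
  -- now `A(F) = c F`, and the multiple `a A` with `a³ = c⁻¹` preserves `F`
  obtain ⟨a, ha⟩ := IsAlgClosed.exists_pow_nat_eq (c⁻¹) (n := 3) (by norm_num)
  have ha0 : a ≠ 0 := by
    rintro rfl
    exact inv_ne_zero hc.ne_zero (by rw [← ha]; norm_num)
  refine ⟨A * Matrix.GeneralLinearGroup.scalar (Fin 5) (Units.mk0 a ha0), ?_, ?_⟩
  · rw [map_mul, Matrix.ProjGenLinGroup.mk_scalar, mul_one]
  · rw [subst_eq_iff]
    intro v
    have h3 := congrArg (eval v) hQ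
    rw [eval_subst] at h3
    have h4 : (A * Matrix.GeneralLinearGroup.scalar (Fin 5) (Units.mk0 a ha0)).val.mulVec v =
        a • A.val.mulVec v := by
      simp [Matrix.scalar_apply, ← Matrix.smul_one_eq_diagonal, Matrix.smul_mulVec]
    rw [h4, eval_smul hF.homogeneous, h3, ha]
    have := hc.ne_zero
    simp
    field_simp

/-- The group of all lifts to `GL₅` of elements of `G` which preserve `F`. -/
def liftGroup (F : MvPolynomial (Fin 5) ℂ) (G : Subgroup PGL(5, ℂ)) : Subgroup (GL (Fin 5) ℂ) where
  carrier := {A | Matrix.ProjGenLinGroup.mk A ∈ G ∧ subst A F = F}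
  one_mem' := ⟨by simp, subst_one F⟩
  mul_mem' {A C} hA hC := ⟨by rw [map_mul]; exact mul_mem hA.1 hC.1, by
    rw [← subst_subst, hA.2, hC.2]⟩
  inv_mem' {A} hA := ⟨by rw [map_inv]; exact inv_mem hA.1, by
    conv_lhs => rw [← hA.2]
    rw [subst_subst, mul_inv_cancel, subst_one]⟩

lemma mem_liftGroup {F : MvPolynomial (Fin 5) ℂ} {G : Subgroup PGL(5, ℂ)} {A : GL (Fin 5) ℂ} :
    A ∈ liftGroup F G ↔ Matrix.ProjGenLinGroup.mk A ∈ G ∧ subst A F = F := Iff.rfl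

/-- The commutator of two lifts is a scalar `u` with `u³ = 1`, because `F` is preserved, and `u⁵ =
1`, because its determinant is `1`. -/
lemma liftGroup_comm {F : MvPolynomial (Fin 5) ℂ} (hF : IsSmoothCubic F) {G : Subgroup PGL(5, ℂ)}
    (hcomm : ∀ g ∈ G, ∀ h ∈ G, g * h = h * g) {A C : GL (Fin 5) ℂ} (hA : A ∈ liftGroup F G)
    (hC : C ∈ liftGroup F G) : A * C = C * A := by
  have h := hcomm _ hA.1 _ hC.1
  rw [← map_mul, ← map_mul, Matrix.ProjGenLinGroup.mk_eq_mk_iff] at h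
  obtain ⟨u, hu⟩ := h
  have hdet : u ^ 5 = 1 := by
    have := congrArg Matrix.GeneralLinearGroup.det hu
    rw [map_mul, map_mul, map_mul, mul_comm (Matrix.GeneralLinearGroup.det C), mul_eq_left] at this
    have h2 := congrArg Units.val this
    simp at h2
    exact Units.ext (by simpa using h2)
  have hcube : u ^ 3 = 1 := by
    have hAC := mem_liftGroup.1 (mul_mem hA hC)
    have hCA := mem_liftGroup.1 (mul_mem hC hA)
    obtain ⟨v, hv⟩ := exists_eval_ne_zero hF.irreducible.ne_zero
    have h1 := (subst_eq_iff _ _ _).1 hCA.2 v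
    have h2 := (subst_eq_iff _ _ _).1 hAC.2 v
    have h4 : (A * C * Matrix.GeneralLinearGroup.scalar (Fin 5) u).val.mulVec v =
        (u : ℂ) • (A * C).val.mulVec v := by
      simp [Matrix.scalar_apply, ← Matrix.smul_one_eq_diagonal, Matrix.smul_mulVec]
    rw [← hu, h4, eval_smul hF.homogeneous, h2] at h1
    exact Units.ext (by simpa [hv] using h1)
  have hu1 : u = 1 := by
    calc u = (u ^ 3) ^ 2 * (u ^ 5)⁻¹ := by
          rw [← pow_mul, ← zpow_natCast, ← zpow_natCast, ← zpow_neg, ← zpow_add]; norm_num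
      _ = 1 := by rw [hcube, hdet]; simp
  rw [← hu, hu1, map_one, mul_one]

lemma polar_mulVec {F : MvPolynomial (Fin 5) ℂ} (hF : F.IsHomogeneous 3) {A : GL (Fin 5) ℂ}
    (hA : subst A F = F) (u v w : Fin 5 → ℂ) :
    polar F (A.val.mulVec u) (A.val.mulVec v) (A.val.mulVec w) = polar F u v w := by
  refine (polar_symTrilinear F).eq_of_diag A.val.mulVecLin (fun v => ?_) u v w
  rw [polar_diag hF, polar_diag hF]
  exact (subst_eq_iff _ _ _).1 hA v

lemma maxGenEigenspace_eq_of_pow_eq_one {f : Module.End ℂ (Fin 5 → ℂ)} {m : ℕ} (hm : 0 < m)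
    (hf : f ^ m = 1) (x : ℂ) : f.maxGenEigenspace x = f.eigenspace x := by
  have hsep : (Polynomial.X ^ m - 1 : Polynomial ℂ).Separable :=
    Polynomial.X_pow_sub_one_separable_iff.2 (by exact_mod_cast hm.ne')
  have hss : f.IsSemisimple :=
    Module.End.isSemisimple_of_squarefree_aeval_eq_zero hsep.squarefree (by simp [hf])
  exact hss.isFinitelySemisimple.maxGenEigenspace_eq_eigenspace x

/-- The diagonal matrices with nonzero entries, as a homomorphism. -/
def diagHom : (Fin 5 → ℂˣ) →* GL (Fin 5) ℂ where
  toFun := diag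
  map_one' := by ext i j; simp [diag, Matrix.one_apply]
  map_mul' d e := by
    ext i j
    by_cases h : i = j <;> simp [diag, h]

lemma diag_mulVec (d : Fin 5 → ℂˣ) (v : Fin 5 → ℂ) :
    (diag d).val.mulVec v = fun i => (d i : ℂ) * v i := by
  ext i
  simp [diag, Matrix.mulVec_diagonal]

/-- The lifts commute and have finite order, so they are simultaneously diagonalizable; the columns
of `P` form a basis of common eigenvectors. -/
theorem exists_diagonalization {F : MvPolynomial (Fin 5) ℂ} (hF : IsSmoothCubic F)
    {G : Subgroup PGL(5, ℂ)} (hcomm : ∀ g ∈ G, ∀ h ∈ G, g * h = h * g) :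
    ∃ P : GL (Fin 5) ℂ, ∀ A ∈ liftGroup F G, ∃ d, A = P * diag d * P⁻¹ := by
  set f : liftGroup F G → Module.End ℂ (Fin 5 → ℂ) := fun A => A.1.val.mulVecLin with hf
  have hfin : ∀ A, ∃ m : ℕ, 0 < m ∧ f A ^ m = 1 := fun A =>
    exists_pow_eq_one (polar_symTrilinear F) hF.nonSing
      (fun u v w => polar_mulVec hF.homogeneous A.2.2 u v w)
  have heig : ∀ A x, (f A).maxGenEigenspace x = (f A).eigenspace x := fun A x => by
    obtain ⟨m, hm, h⟩ := hfin A
    exact maxGenEigenspace_eq_of_pow_eq_one hm h x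
  have htop := Module.End.iSup_iInf_maxGenEigenspace_eq_top_of_iSup_maxGenEigenspace_eq_top_of_commute
    f (fun A C _ => by
      have := congrArg (fun M : GL (Fin 5) ℂ => M.val.mulVecLin) (liftGroup_comm hF hcomm A.2 C.2)
      simpa [commute_iff_eq, hf, Matrix.mulVecLin_mul, Module.End.mul_eq_comp] using this)
    (fun A => Module.End.iSup_maxGenEigenspace_eq_top (f A))
  simp only [heig] at htop
  -- the common eigenvectors span, so there is a basis consisting of them
  set s : Set (Fin 5 → ℂ) := {v | ∀ A, ∃ c : ℂ, f A v = c • v} with hs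
  have hspan : ⊤ ≤ Submodule.span ℂ s := by
    rw [← htop]
    refine iSup_le fun χ v hv => Submodule.subset_span fun A => ⟨χ A, ?_⟩
    rw [Submodule.mem_iInf] at hv
    exact Module.End.mem_eigenspace_iff.1 (hv A)
  set b0 := Module.Basis.ofSpan hspan
  have hcard : Nat.card ((linearIndepOn_empty ℂ id).extend (Set.empty_subset s)) = 5 := by
    rw [← Module.finrank_eq_nat_card_basis b0]; simp
  have : Finite ((linearIndepOn_empty ℂ id).extend (Set.empty_subset s)) :=
    Nat.finite_of_card_ne_zero (by rw [hcard]; norm_num)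
  set b := b0.reindex (Finite.equivFinOfCardEq hcard)
  have hb : ∀ i, b i ∈ s := fun i => by
    apply Module.Basis.ofSpan_subset hspan
    rw [Module.Basis.reindex_apply]
    exact Set.mem_range_self _
  set Q : Matrix (Fin 5) (Fin 5) ℂ := (Pi.basisFun ℂ (Fin 5)).toMatrix b
  have hQ : ∀ i j, Q i j = b j i := fun i j => rfl
  have hQinv : IsUnit Q := by
    have := (Pi.basisFun ℂ (Fin 5)).invertibleToMatrix b
    exact isUnit_of_invertible _
  obtain ⟨P, hP⟩ := hQinv
  refine ⟨P, fun A hA => ?_⟩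
  choose c hc using fun i => hb i ⟨A, hA⟩
  have hc0 : ∀ i, c i ≠ 0 := fun i h0 => by
    have h1 := hc i
    rw [h0, zero_smul] at h1
    have hinj : Function.Injective (f ⟨A, hA⟩) :=
      injective_of_preserves (polar_symTrilinear F) hF.nonSing
        (fun u v w => polar_mulVec hF.homogeneous hA.2 u v w)
    exact b.ne_zero i (hinj (by rw [h1, map_zero]))
  refine ⟨fun i => Units.mk0 (c i) (hc0 i), ?_⟩
  rw [eq_mul_inv_iff_mul_eq]
  apply Units.ext
  rw [Units.val_mul, Units.val_mul, hP]
  ext i j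
  have h1 := congrFun (hc j) i
  rw [diag, Matrix.mul_diagonal, hQ, Units.val_mk0, Matrix.mul_apply]
  simp only [hf, Matrix.mulVecLin_apply, Matrix.mulVec, dotProduct, Pi.smul_apply,
    smul_eq_mul] at h1
  simp only [hQ]
  rw [h1, mul_comm]

/-- The diagonal lifts of `G` in the coordinates given by `P`. -/
def diagLifts (F : MvPolynomial (Fin 5) ℂ) (G : Subgroup PGL(5, ℂ)) (P : GL (Fin 5) ℂ) :
    Subgroup (Fin 5 → ℂˣ) :=
  (liftGroup F G).comap ((MulAut.conj P).toMonoidHom.comp diagHom)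

lemma mem_diagLifts {F : MvPolynomial (Fin 5) ℂ} {G : Subgroup PGL(5, ℂ)} {P : GL (Fin 5) ℂ}
    {d : Fin 5 → ℂˣ} : d ∈ diagLifts F G P ↔ P * diag d * P⁻¹ ∈ liftGroup F G := Iff.rfl

/-! ### The monomials of a nonsingular cubic form -/

section Smoothness

lemma exists_binary_zero (a b c : ℂ) :
    ∃ s t : ℂ, (s ≠ 0 ∨ t ≠ 0) ∧ a * s ^ 2 + b * s * t + c * t ^ 2 = 0 := by
  by_cases ha : a = 0
  · exact ⟨1, 0, Or.inl one_ne_zero, by simp [ha]⟩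
  · obtain ⟨r, hr⟩ := IsAlgClosed.exists_pow_nat_eq (b ^ 2 - 4 * a * c) (n := 2) (by norm_num)
    refine ⟨(-b + r) / (2 * a), 1, Or.inr one_ne_zero, ?_⟩
    field_simp
    linear_combination hr

open Matrix in
/-- Two conics in the projective plane meet: some member of the pencil spanned by them is singular
and hence contains a line, which meets the other conic. -/
lemma exists_common_zero (M₁ M₂ : Matrix (Fin 3) (Fin 3) ℂ) (h₁ : M₁.IsSymm) (h₂ : M₂.IsSymm) :
    ∃ v : Fin 3 → ℂ, v ≠ 0 ∧ v ⬝ᵥ M₁ *ᵥ v = 0 ∧ v ⬝ᵥ M₂ *ᵥ v = 0 := by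
  obtain ⟨s, t, v, hst, hv, hNv⟩ : ∃ s t : ℂ, ∃ v : Fin 3 → ℂ, (s ≠ 0 ∨ t ≠ 0) ∧ v ≠ 0 ∧
      (s • M₁ + t • M₂) *ᵥ v = 0 := by
    by_cases hdet : M₂.det = 0
    · obtain ⟨v, hv, h⟩ := Matrix.exists_mulVec_eq_zero_iff.2 hdet
      exact ⟨0, 1, v, Or.inr one_ne_zero, hv, by simpa using h⟩
    · obtain ⟨x, hx⟩ := Module.End.exists_eigenvalue (M₂⁻¹ * M₁).mulVecLin
      obtain ⟨v, hv⟩ := hx.exists_hasEigenvector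
      have h := congrArg (M₂ *ᵥ ·) hv.apply_eq_smul
      have hu : IsUnit M₂.det := isUnit_iff_ne_zero.2 hdet
      simp only [mulVecLin_apply, mulVec_mulVec, ← mul_assoc, mul_nonsing_inv _ hu, one_mul,
        mulVec_smul] at h
      exact ⟨1, -x, v, Or.inl one_ne_zero, hv.2, by
        rw [add_mulVec, smul_mulVec, smul_mulVec, h]; simp⟩
  set N := s • M₁ + t • M₂ with hN
  have hNs : N.IsSymm := (h₁.smul s).add (h₂.smul t)
  have hsymm : ∀ M : Matrix (Fin 3) (Fin 3) ℂ, M.IsSymm → ∀ x y, x ⬝ᵥ M *ᵥ y = y ⬝ᵥ M *ᵥ x := by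
    intro M hM x y
    rw [dotProduct_mulVec, ← mulVec_transpose, hM.eq, dotProduct_comm]
  have hquad : ∀ M : Matrix (Fin 3) (Fin 3) ℂ, M.IsSymm → ∀ (x y : Fin 3 → ℂ),
      ∃ a b : ℂ, (a ≠ 0 ∨ b ≠ 0) ∧ (a • x + b • y) ⬝ᵥ M *ᵥ (a • x + b • y) = 0 := by
    intro M hM x y
    obtain ⟨a, b, hab, h⟩ := exists_binary_zero (x ⬝ᵥ M *ᵥ x) (2 * (x ⬝ᵥ M *ᵥ y)) (y ⬝ᵥ M *ᵥ y)
    refine ⟨a, b, hab, ?_⟩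
    simp only [mulVec_add, mulVec_smul, dotProduct_add, add_dotProduct, dotProduct_smul,
      smul_dotProduct, smul_eq_mul]
    rw [hsymm M hM y x, ← h]; ring
  obtain ⟨i, hi⟩ := Function.ne_iff.1 hv
  obtain ⟨a, b, hab, hw⟩ := hquad N hNs (Pi.single (i + 1) 1) (Pi.single (i + 2) 1)
  set w : Fin 3 → ℂ := a • Pi.single (i + 1) 1 + b • Pi.single (i + 2) 1 with hwdef
  have hi1 : i ≠ i + 1 := by fin_cases i <;> decide
  have hi2 : i ≠ i + 2 := by fin_cases i <;> decide
  have hi3 : i + 1 ≠ i + 2 := by fin_cases i <;> decide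
  have hwi : w i = 0 := by simp [hwdef, hi1, hi2]
  have hw0 : w ≠ 0 := by
    intro h0
    have ha := congrFun h0 (i + 1)
    have hb := congrFun h0 (i + 2)
    simp [hwdef, hi3] at ha
    simp [hwdef, hi3.symm] at hb
    simp [ha, hb] at hab
  have hline : ∀ c d : ℂ, (c ≠ 0 ∨ d ≠ 0) → c • v + d • w ≠ 0 := by
    intro c d hcd h0
    have h1 := congrFun h0 i
    simp [hwi] at h1
    have hc : c = 0 := h1.resolve_right hi
    rw [hc, zero_smul, zero_add] at h0
    exact (hcd.resolve_left (not_not.2 hc)) ((smul_eq_zero.1 h0).resolve_right hw0)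
  have hNline : ∀ c d : ℂ, (c • v + d • w) ⬝ᵥ N *ᵥ (c • v + d • w) = 0 := by
    intro c d
    have h1 : ∀ x, v ⬝ᵥ N *ᵥ x = 0 := fun x => by rw [hsymm N hNs, hNv, dotProduct_zero]
    simp [mulVec_add, mulVec_smul, hNv, add_dotProduct, smul_dotProduct, h1, hw]
  have hNe : ∀ x : Fin 3 → ℂ, x ⬝ᵥ N *ᵥ x = s * (x ⬝ᵥ M₁ *ᵥ x) + t * (x ⬝ᵥ M₂ *ᵥ x) := fun x => by
    simp [hN, add_mulVec, smul_mulVec]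
  rcases hst with hs | ht
  · obtain ⟨c, d, hcd, h⟩ := hquad M₂ h₂ v w
    refine ⟨_, hline c d hcd, ?_, h⟩
    have h3 := hNline c d
    rw [hNe, h, mul_zero, add_zero] at h3
    exact (mul_eq_zero.1 h3).resolve_left hs
  · obtain ⟨c, d, hcd, h⟩ := hquad M₁ h₁ v w
    refine ⟨_, hline c d hcd, h, ?_⟩
    have h3 := hNline c d
    rw [hNe, h, mul_zero, zero_add] at h3
    exact (mul_eq_zero.1 h3).resolve_left ht

/-- A combinatorial smoothness criterion for the set `S` of monomials `xᵢxⱼxₖ` of a cubic form: for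
each coordinate subspace `V_I` of dimension at most `3`, either a monomial is supported in `I`, or
at least `|I|` of the partial derivatives do not vanish identically on `V_I`. -/
def Good (S : Fin 5 → Fin 5 → Fin 5 → Prop) : Prop :=
  ∀ I : Finset (Fin 5), I.Nonempty → I.card ≤ 3 → (∃ i ∈ I, ∃ j ∈ I, ∃ k ∈ I, S i j k) ∨
    ∃ J : Finset (Fin 5), I.card ≤ J.card ∧ ∀ j ∈ J, j ∉ I ∧ ∃ a ∈ I, ∃ b ∈ I, S a b j

lemma Good.mono {S T : Fin 5 → Fin 5 → Fin 5 → Prop} (h : Good S)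
    (hST : ∀ i j k, S i j k → T i j k) : Good T := by
  intro I hI hI3
  rcases h I hI hI3 with ⟨i, hi, j, hj, k, hk, h1⟩ | ⟨J, hJ, h1⟩
  · exact Or.inl ⟨i, hi, j, hj, k, hk, hST _ _ _ h1⟩
  · refine Or.inr ⟨J, hJ, fun j hj => ⟨(h1 j hj).1, ?_⟩⟩
    obtain ⟨a, ha, b, hb, h2⟩ := (h1 j hj).2
    exact ⟨a, ha, b, hb, hST _ _ _ h2⟩

variable {B : (Fin 5 → ℂ) → (Fin 5 → ℂ) → (Fin 5 → ℂ) → ℂ}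

lemma SymTrilinear.pair_zero (hB : SymTrilinear B) (x y u : Fin 5 → ℂ) :
    ∃ s t : ℂ, (s ≠ 0 ∨ t ≠ 0) ∧ B (s • x + t • y) (s • x + t • y) u = 0 := by
  obtain ⟨s, t, hst, h⟩ := exists_binary_zero (B x x u) (2 * B x y u) (B y y u)
  refine ⟨s, t, hst, ?_⟩
  simp only [hB.add, hB.add₂, hB.smul, hB.smul₂]
  rw [hB.swap₁₂ y x, ← h]; ring

lemma SymTrilinear.triple_zero (hB : SymTrilinear B) (x : Fin 3 → Fin 5 → ℂ) (u u' : Fin 5 → ℂ) :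
    ∃ c : Fin 3 → ℂ, c ≠ 0 ∧ B (∑ a, c a • x a) (∑ a, c a • x a) u = 0 ∧
      B (∑ a, c a • x a) (∑ a, c a • x a) u' = 0 := by
  obtain ⟨c, hc, h1, h2⟩ := exists_common_zero (Matrix.of fun a b => B (x a) (x b) u)
    (Matrix.of fun a b => B (x a) (x b) u') (by ext a b; simp [hB.swap₁₂ (x a) (x b)])
    (by ext a b; simp [hB.swap₁₂ (x a) (x b)])
  have key : ∀ u, B (∑ a, c a • x a) (∑ a, c a • x a) u =
      dotProduct c ((Matrix.of fun a b => B (x a) (x b) u).mulVec c) := by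
    intro u
    simp only [hB.sum₁, hB.sum₂, hB.smul, hB.smul₂, dotProduct, Matrix.mulVec, Matrix.of_apply,
      Finset.mul_sum]
    rw [Finset.sum_comm]
    exact Finset.sum_congr rfl fun a _ => Finset.sum_congr rfl fun b _ => by
      rw [hB.swap₁₂]; ring
  exact ⟨c, hc, by rw [key, h1], by rw [key, h2]⟩

lemma card_two_cover {J : Finset (Fin 5)} (hJ : J.card ≤ 2) : ∃ a b, ∀ j ∈ J, j = a ∨ j = b := by
  interval_cases h : J.card
  · exact ⟨0, 0, by simp [Finset.card_eq_zero.1 h]⟩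
  · obtain ⟨a, rfl⟩ := Finset.card_eq_one.1 h
    exact ⟨a, a, by simp⟩
  · obtain ⟨a, b, -, rfl⟩ := Finset.card_eq_two.1 h
    exact ⟨a, b, by simp⟩

/-- Fewer than `|I| ≤ 3` of the quadratic forms `B v v e_j` have a common zero `v ≠ 0` in the
coordinate subspace `V_I`: for `|I| = 3` these are two conics in a plane. -/
lemma exists_common_zero_on (hB : SymTrilinear B) {I J : Finset (Fin 5)} (hI3 : I.card ≤ 3)
    (hJ : J.card < I.card) : ∃ v : Fin 5 → ℂ, v ≠ 0 ∧ (∀ i, i ∉ I → v i = 0) ∧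
      ∀ j ∈ J, B v v (Pi.single j 1) = 0 := by
  interval_cases h : I.card
  · omega
  · obtain ⟨a, rfl⟩ := Finset.card_eq_one.1 h
    have : J = ∅ := Finset.card_eq_zero.1 (by omega)
    refine ⟨Pi.single a 1, by simp, fun i hi => ?_, by simp [this]⟩
    simp at hi
    simp [hi]
  · obtain ⟨a, b, hab, rfl⟩ := Finset.card_eq_two.1 h
    obtain ⟨j₁, hj⟩ : ∃ j₁, ∀ j ∈ J, j = j₁ := by
      have hJ' : J.card ≤ 1 := by omega
      rw [Finset.card_le_one_iff_subset_singleton] at hJ'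
      obtain ⟨x, hx⟩ := hJ'
      exact ⟨x, fun j hj => by simpa using hx hj⟩
    obtain ⟨s, t, hst, h0⟩ := hB.pair_zero (Pi.single a 1) (Pi.single b 1) (Pi.single j₁ 1)
    refine ⟨_, ?_, fun i hi => ?_, fun j hj' => by rw [hj j hj']; exact h0⟩
    · intro hz
      have ha := congrFun hz a
      have hb := congrFun hz b
      simp [hab] at ha
      simp [hab.symm] at hb
      simp [ha, hb] at hst
    · simp only [Finset.mem_insert, Finset.mem_singleton, not_or] at hi
      simp [hi.1, hi.2]
  · obtain ⟨a, b, c, hab, hac, hbc, rfl⟩ := Finset.card_eq_three.1 h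
    obtain ⟨j₁, j₂, hj⟩ := card_two_cover (J := J) (by omega)
    obtain ⟨r, hr, h1, h2⟩ := hB.triple_zero ![Pi.single a 1, Pi.single b 1, Pi.single c 1]
      (Pi.single j₁ 1) (Pi.single j₂ 1)
    simp only [Fin.sum_univ_three, Matrix.cons_val_zero, Matrix.cons_val_one,
      Matrix.cons_val] at h1 h2
    refine ⟨r 0 • Pi.single a 1 + r 1 • Pi.single b 1 + r 2 • Pi.single c 1, ?_, fun i hi => ?_,
      fun j hj' => ?_⟩
    rotate_left 2
    · rcases hj j hj' with rfl | rfl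
      · exact h1
      · exact h2
    · intro hz
      have ha := congrFun hz a
      have hb := congrFun hz b
      have hc := congrFun hz c
      simp [hab, hac] at ha
      simp [hab.symm, hbc] at hb
      simp [hac.symm, hbc.symm] at hc
      apply hr
      ext i
      fin_cases i <;> simp [ha, hb, hc]
    · simp only [Finset.mem_insert, Finset.mem_singleton, not_or] at hi
      simp [hi.1, hi.2]

/-- If no monomial is supported in `I` and fewer than `|I|` partial derivatives are nonzero on
`V_I`, a common zero of the latter in `V_I` is a singular point. -/
theorem NonSing.good (hB : SymTrilinear B) (hs : NonSing B) :
    Good fun i j k => B (Pi.single i 1) (Pi.single j 1) (Pi.single k 1) ≠ 0 := by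
  classical
  intro I hI hI3
  by_contra hcon
  push Not at hcon
  obtain ⟨h1, h2⟩ := hcon
  set J := Finset.univ.filter fun j => j ∉ I ∧
    ∃ a ∈ I, ∃ b ∈ I, B (Pi.single a 1) (Pi.single b 1) (Pi.single j 1) ≠ 0 with hJdef
  have hJ : J.card < I.card := by
    by_contra hle
    obtain ⟨j, hj, hj'⟩ := h2 J (not_lt.1 hle)
    simp only [hJdef, Finset.mem_filter, Finset.mem_univ, true_and] at hj
    obtain ⟨a, ha, b, hb, h⟩ := hj.2
    exact h (hj' hj.1 a ha b hb)
  obtain ⟨v, hv, hvI, hvJ⟩ := exists_common_zero_on hB hI3 hJ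
  obtain ⟨u, hu⟩ := hs v hv
  apply hu
  rw [hB.expand₃]
  refine Finset.sum_eq_zero fun k _ => ?_
  by_cases hkJ : k ∈ J
  · rw [hvJ k hkJ, mul_zero]
  · rw [hB.expand, Finset.sum_eq_zero, mul_zero]
    refine fun a _ => Finset.sum_eq_zero fun b _ => Finset.sum_eq_zero fun l _ => ?_
    by_cases ha : a ∈ I
    swap
    · simp [hvI a ha]
    by_cases hb : b ∈ I
    swap
    · simp [hvI b hb]
    by_cases hl : l = k
    swap
    · simp [hl]
    subst hl
    have : B (Pi.single a 1) (Pi.single b 1) (Pi.single l 1) = 0 := by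
      by_cases hk : l ∈ I
      · exact h1 a ha b hb l hk
      · by_contra hne
        exact hkJ (by simp only [hJdef, Finset.mem_filter, Finset.mem_univ, true_and]
                      exact ⟨hk, a, ha, b, hb, hne⟩)
    rw [this, mul_zero]

end Smoothness

/-! ### Computable exponent vectors and the finite checks -/

section Computation

/-- Entry `i` of an exponent vector. In the finite checks, exponent vectors are lists of natural
numbers and all tests are Boolean, so that the kernel evaluates them fast. -/
def entry (l : List ℕ) (i : ℕ) : ℕ := l.getD i 0

/-- The 35 monomials `xᵢxⱼxₖ`, `i ≤ j ≤ k`. -/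
def monomials : List (ℕ × ℕ × ℕ) :=
  [(0, 0, 0), (0, 0, 1), (0, 0, 2), (0, 0, 3), (0, 0, 4), (0, 1, 1), (0, 1, 2), (0, 1, 3),
   (0, 1, 4), (0, 2, 2), (0, 2, 3), (0, 2, 4), (0, 3, 3), (0, 3, 4), (0, 4, 4), (1, 1, 1),
   (1, 1, 2), (1, 1, 3), (1, 1, 4), (1, 2, 2), (1, 2, 3), (1, 2, 4), (1, 3, 3), (1, 3, 4),
   (1, 4, 4), (2, 2, 2), (2, 2, 3), (2, 2, 4), (2, 3, 3), (2, 3, 4), (2, 4, 4), (3, 3, 3),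
   (3, 3, 4), (3, 4, 4), (4, 4, 4)]

/-- The monomial `t` is invariant under the diagonal matrix with entries `ξ n ^ gᵢ`. -/
def invariantb (n : ℕ) (g : List ℕ) (t : ℕ × ℕ × ℕ) : Bool :=
  Nat.beq ((entry g t.1 + entry g t.2.1 + entry g t.2.2) % n) 0

/-- The subsets of `{0, …, 4}` with at most three elements, as bit masks, with their cardinalities.
-/
def masks : List (ℕ × ℕ) :=
  [(1, 1), (2, 1), (4, 1), (8, 1), (16, 1), (3, 2), (5, 2), (9, 2), (17, 2), (6, 2), (10, 2),
   (18, 2), (12, 2), (20, 2), (24, 2), (7, 3), (11, 3), (19, 3), (13, 3), (21, 3), (25, 3),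
   (14, 3), (22, 3), (26, 3), (28, 3)]

/-- Some monomial of `M` is supported in the mask `m`. -/
def supportedb (m : ℕ) (M : List (ℕ × ℕ × ℕ)) : Bool :=
  M.any fun t => m.testBit t.1 && m.testBit t.2.1 && m.testBit t.2.2

/-- Some monomial of `M` is `x_j` times a quadratic monomial supported in the mask `m`. -/
def linearb (m : ℕ) (M : List (ℕ × ℕ × ℕ)) (j : ℕ) : Bool :=
  M.any fun t => (Nat.beq t.1 j && m.testBit t.2.1 && m.testBit t.2.2) ||
    (Nat.beq t.2.1 j && m.testBit t.1 && m.testBit t.2.2) ||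
    (Nat.beq t.2.2 j && m.testBit t.1 && m.testBit t.2.1)

/-- Boolean version of `Good`. -/
def goodb (M : List (ℕ × ℕ × ℕ)) : Bool :=
  masks.all fun ms => supportedb ms.1 M ||
    Nat.ble ms.2 (([0, 1, 2, 3, 4].filter fun j => !ms.1.testBit j && linearb ms.1 M j).length)

/-- All insertions of `x` into a list. -/
def insertions (x : ℕ) : List ℕ → List (List ℕ)
  | [] => [[x]]
  | y :: l => (x :: y :: l) :: (insertions x l).map (y :: ·)

/-- All permutations of a list. -/
def permutationsOf : List ℕ → List (List ℕ)
  | [] => [[]]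
  | x :: l => (permutationsOf l).flatMap (insertions x)

/-- The permutations of `{0, …, 4}`. -/
def perms : List (List ℕ) := permutationsOf [0, 1, 2, 3, 4]

/-- Exponent vectors modulo `n`: addition of a multiple. -/
def addMul (n c : ℕ) (a b : List ℕ) : List ℕ := List.zipWith (fun x y => (x + c * y) % n) a b

/-- Elements of the group generated by exponent vectors modulo `n`, each vector being used with
coefficients below the number attached to it. -/
def spanList (n : ℕ) : List (ℕ × List ℕ) → List (List ℕ)
  | [] => [[0, 0, 0, 0, 0]]
  | g :: gs => (List.range g.1).flatMap fun j => (spanList n gs).map fun a => addMul n j a g.2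

/-- Base-`n` code of a vector. -/
def code (n : ℕ) (l : List ℕ) : ℕ := l.foldl (fun acc x => acc * n + x) 0

/-- A set of vectors as a bit mask. -/
def bitset (n : ℕ) (L : List (List ℕ)) : ℕ := L.foldl (fun acc x => acc ||| (1 <<< code n x)) 0

/-- The vector `i ↦ g (p i)`. -/
def permute (p g : List ℕ) : List ℕ := p.map (entry g)

/-- All vectors with five entries below `n`, the first of which is `0`. -/
def residues₀ (n : ℕ) : List (List ℕ) :=
  (List.range n).flatMap fun b => (List.range n).flatMap fun c =>
    (List.range n).flatMap fun d => (List.range n).map fun e => [0, b, c, d, e]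

/-- All vectors with five entries below `n`. -/
def residues (n : ℕ) : List (List ℕ) :=
  (List.range n).flatMap fun a => (residues₀ n).map fun l => a :: l.tail

/-- The first nonzero entry, if any, and its position. -/
def pivot : List ℕ → ℕ
  | [] => 0
  | 0 :: l => pivot l + 1
  | _ :: _ => 0

/-- Reduction of `w` modulo `3` by vectors in reduced echelon form. -/
def reduce (r : List (List ℕ)) (w : List ℕ) : List ℕ :=
  r.foldl (fun w g => addMul 3 (2 * entry w (pivot g)) w g) w

/-- `w` vanishes at the pivots of `r` and its first nonzero entry is `1`. -/
def reducedb (r : List (List ℕ)) (w : List ℕ) : Bool :=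
  (r.all fun g => Nat.beq (entry w (pivot g)) 0) && Nat.beq (entry w (pivot w)) 1

/-- All entries vanish. -/
def isZero (w : List ℕ) : Bool := w.all (Nat.beq 0)

/-- Every vector with first entry `0` is, up to sign and modulo the span of `r`, zero or reduced. -/
def reduceCheck (r : List (List ℕ)) : Bool :=
  (residues₀ 3).all fun w => isZero (reduce r w) || reducedb r (reduce r w) ||
    reducedb r (addMul 3 2 [0, 0, 0, 0, 0] (reduce r w))

/-- The exponents of the scalar matrix `ξ n`. -/
def ones : List ℕ := [1, 1, 1, 1, 1]

/-- Some `r' ∈ R` with more than `len` vectors has a permutation by some `p ∈ stab` inside the set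
`sp`. -/
def findb (stab : List (List ℕ)) (R : List (List (List ℕ))) (len sp : ℕ) : Bool :=
  R.any fun r' => Nat.blt len r'.length &&
    stab.any fun p => r'.all fun g => sp.testBit (code 3 (permute p g))

/-- Every reduced vector `w` which leaves a good set of those monomials in `M` which it preserves,
generates, together with `r` and the scalars, a group with more than `|r|` generators from the list
`R`, up to a permutation in `stab`. -/
def extendb (stab : List (List ℕ)) (R : List (List (List ℕ))) (r : List (List ℕ))
    (M : List (ℕ × ℕ × ℕ)) : Bool :=
  ((residues₀ 3).filter (reducedb r)).all fun w => !goodb (M.filter (invariantb 3 w)) ||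
    findb stab R r.length (bitset 3 (spanList 3 ((3, w) :: (3, ones) :: r.map ((3, ·)))))

/-- The permutations which map the vectors `k` into the set `K`. -/
def stabilizer (k : List (List ℕ)) (K : List (List ℕ)) : List (List ℕ) :=
  perms.filter fun p => k.all fun g => (K.map (code 16)).any (Nat.beq (code 16 (permute p g)))

/-- The induction step for `3`-groups which commute with the `2`-group generated by `k`. -/
def threeCheck (k : List (ℕ × List ℕ)) (R : List (List (List ℕ))) : Bool :=
  R.all fun r => reduceCheck r &&
    extendb (stabilizer (k.map Prod.snd) (spanList 16 k)) R r
      ((monomials.filter fun t => k.all fun g => invariantb 16 g.2 t).filter fun t =>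
        r.all fun g => invariantb 3 g t)

/-- Generators of `2`-groups, with their orders, as exponents of `ξ 16`; for each of them, the
possible generators of the `3`-group of exponent three, up to scalars, as exponents of `ξ 3`. The
lists result from a search for all subgroups with a good set of invariant monomials, up to
permutations. -/
def groups : List (List (ℕ × List ℕ) × List (List (List ℕ))) :=
  [([], [[], [[0,0,0,1,0]], [[0,0,0,1,1]], [[0,0,0,1,2]], [[0,0,1,1,2]],
    [[0,1,0,0,0],[0,0,1,0,0]], [[0,1,0,0,0],[0,0,1,0,1]], [[0,1,0,0,0],[0,0,1,0,2]],
    [[0,1,0,0,1],[0,0,1,0,1]], [[0,1,0,0,1],[0,0,1,2,2]], [[0,1,0,0,2],[0,0,1,0,2]],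
    [[0,1,0,0,2],[0,0,1,2,2]], [[0,1,0,0,0],[0,0,1,0,0],[0,0,0,1,0]],
    [[0,1,0,0,0],[0,0,1,0,0],[0,0,0,1,2]], [[0,1,0,0,0],[0,0,1,0,1],[0,0,0,1,1]],
    [[0,1,0,0,1],[0,0,1,0,1],[0,0,0,1,1]],
    [[0,1,0,0,0],[0,0,1,0,0],[0,0,0,1,0],[0,0,0,0,1]]]),
   ([(2, [8,0,0,0,0])], [[], [[0,0,1,0,0]], [[0,0,1,0,1]], [[0,0,1,0,2]], [[0,0,1,1,1]],
    [[0,0,1,1,2]], [[0,0,1,0,0],[0,0,0,1,0]], [[0,0,1,0,0],[0,0,0,1,1]],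
    [[0,0,1,0,0],[0,0,0,1,2]], [[0,0,1,0,1],[0,0,0,1,1]], [[0,0,1,0,2],[0,0,0,1,2]],
    [[0,0,1,0,0],[0,0,0,1,0],[0,0,0,0,1]]]),
   ([(2, [8,0,8,0,0])], [[], [[0,0,0,1,0]], [[0,0,1,1,0]], [[0,0,1,1,2]],
    [[0,0,0,0,1],[0,0,1,1,0]]]),
   ([(4, [4,8,0,0,0])], [[], [[0,0,0,1,0]], [[0,0,0,1,1]], [[0,0,0,1,2]],
    [[0,0,0,1,0],[0,0,0,0,1]]]),
   ([(4, [4,8,0,0,8])], [[], [[0,0,0,1,1]]]),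
   ([(4, [4,8,0,0,12])], [[], [[0,0,0,1,0]]]),
   ([(2, [8,0,0,0,0]), (2, [0,0,8,0,0])], [[], [[0,0,1,1,0]], [[0,0,1,1,2]], [[0,0,0,1,0]],
    [[0,0,1,1,0],[0,0,0,0,1]]]),
   ([(2, [8,0,0,0,8]), (2, [0,0,8,0,8])], [[], [[0,0,0,1,0]]]),
   ([(8, [2,12,8,0,0])], [[], [[0,0,0,0,1]]]),
   ([(8, [2,12,8,0,4])], [[]]),
   ([(4, [4,8,0,0,0]), (2, [0,0,0,8,0])], [[], [[0,0,0,1,1]]]),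
   ([(16, [1,14,4,8,0])], [[]])]

/-- All sums of subsets of the vectors of `k`. -/
def subsetSums : List (ℕ × List ℕ) → List (List ℕ)
  | [] => [[0, 0, 0, 0, 0]]
  | g :: gs => subsetSums gs ++ (subsetSums gs).map fun a => List.zipWith (· + ·) a g.2

/-- Representatives, modulo the group `K` generated by `k`, of the vectors `h` modulo `16` with `2h`
in `K`. -/
def halves (k : List (ℕ × List ℕ)) : List (List ℕ) :=
  ((subsetSums k).filter fun v => v.all fun x => Nat.beq (x % 2) 0).flatMap fun v =>
    (residues 2).map fun w => List.zipWith (fun x y => (x / 2 + 8 * y) % 16) v w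

/-- The order of the `2`-group with the given generators. -/
def order (k : List (ℕ × List ℕ)) : ℕ := (k.map Prod.fst).prod

/-- The induction step for `2`-groups: for a listed group `K` and a vector `h` with `2h` in `K`,
either the monomials preserved by `K` and `h` do not form a good set, or `h` lies in `K`, or the
group generated by `K` and `h` contains a larger listed group up to a permutation. -/
def twoCheck : Bool :=
  groups.all fun kR => (halves kR.1).all fun h =>
    !goodb ((monomials.filter fun t => kR.1.all fun g => invariantb 16 g.2 t).filter
      (invariantb 16 h)) ||
    ((spanList 16 kR.1).map (code 16)).any (Nat.beq (code 16 h)) ||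
    groups.any fun kR' => Nat.blt (order kR.1) (order kR'.1) &&
      perms.any fun p => kR'.1.all fun g =>
        ((spanList 16 ((2, h) :: kR.1)).map (code 16)).any (Nat.beq (code 16 (permute p g.2)))

end Computation

theorem twoCheck_eq_true : twoCheck = true := by decide +kernel

theorem threeCheck_eq_true : (groups.all fun kR => threeCheck kR.1 kR.2) = true := by
  decide +kernel

/-! ### Roots of unity and exponent vectors -/

lemma ξ_primitive {n : ℕ} (hn : n ≠ 0) : IsPrimitiveRoot (ξ n) n :=
  IsPrimitiveRoot.coe_units_iff.1 (by simpa [ξ] using Complex.isPrimitiveRoot_exp n hn)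

lemma ξ_zpow_eq_one {n : ℕ} (hn : n ≠ 0) (k : ℤ) : ξ n ^ k = 1 ↔ (n : ℤ) ∣ k :=
  (ξ_primitive hn).zpow_eq_one_iff_dvd k

lemma exists_ξ_zpow {n : ℕ} (hn : n ≠ 0) {x : ℂˣ} (hx : x ^ n = 1) : ∃ k : ℤ, ξ n ^ k = x := by
  have h0 : NeZero n := ⟨hn⟩
  obtain ⟨i, -, hi⟩ := (IsPrimitiveRoot.coe_units_iff.2 (ξ_primitive hn)).eq_pow_of_pow_eq_one
    (ξ := (x : ℂ)) (by rw [← Units.val_pow_eq_pow_val, hx, Units.val_one])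
  exact ⟨i, Units.ext (by simpa using hi)⟩

/-- The diagonal entries `ξ n ^ eᵢ`. -/
def expVec (n : ℕ) (e : Fin 5 → ℤ) : Fin 5 → ℂˣ := fun i => ξ n ^ e i

lemma expVec_add (n : ℕ) (e f : Fin 5 → ℤ) : expVec n (e + f) = expVec n e * expVec n f := by
  funext i; simp [expVec, zpow_add]

lemma expVec_smul (n : ℕ) (c : ℤ) (e : Fin 5 → ℤ) : expVec n (c • e) = expVec n e ^ c := by
  funext i; simp [expVec, zpow_mul']

lemma expVec_self {n : ℕ} (hn : n ≠ 0) (z : Fin 5 → ℤ) : expVec n ((n : ℤ) • z) = 1 := by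
  funext i
  simp only [expVec, Pi.smul_apply, smul_eq_mul, Pi.one_apply]
  rw [ξ_zpow_eq_one hn]; exact dvd_mul_right _ _

lemma exists_expVec {n : ℕ} (hn : n ≠ 0) {d : Fin 5 → ℂˣ} (hd : d ^ n = 1) :
    ∃ e, expVec n e = d := by
  choose e he using fun i => exists_ξ_zpow hn (x := d i) (congrFun hd i)
  exact ⟨e, funext he⟩

/-- The lattice of exponents `e` with `(ξ n ^ eᵢ)ᵢ ∈ Γ`. -/
def expLattice (n : ℕ) (Γ : Subgroup (Fin 5 → ℂˣ)) : AddSubgroup (Fin 5 → ℤ) where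
  carrier := {e | expVec n e ∈ Γ}
  zero_mem' := by
    have : expVec n 0 = 1 := by funext i; simp [expVec]
    simp only [Set.mem_ofPred_eq, this, one_mem]
  add_mem' {e f} he hf := by
    simp only [Set.mem_ofPred_eq, expVec_add] at *
    exact mul_mem he hf
  neg_mem' {e} he := by
    have : expVec n (-e) = (expVec n e)⁻¹ := by funext i; simp [expVec]
    simp only [Set.mem_ofPred_eq, this] at *
    exact inv_mem he

lemma mem_expLattice {n : ℕ} {Γ : Subgroup (Fin 5 → ℂˣ)} {e : Fin 5 → ℤ} :
    e ∈ expLattice n Γ ↔ expVec n e ∈ Γ := Iff.rfl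

lemma self_smul_mem_expLattice {n : ℕ} (hn : n ≠ 0) (Γ : Subgroup (Fin 5 → ℂˣ)) (z : Fin 5 → ℤ) :
    (n : ℤ) • z ∈ expLattice n Γ := by
  rw [mem_expLattice, expVec_self hn]; exact one_mem Γ

/-! ### Permutations of the coordinates and invariant monomials -/

/-- Permutation of the coordinates. -/
def permHom (σ : Equiv.Perm (Fin 5)) : (Fin 5 → ℂˣ) →* (Fin 5 → ℂˣ) where
  toFun d := d ∘ σ
  map_one' := rfl
  map_mul' _ _ := rfl

/-- The group of all `d` with `d ∘ σ ∈ Γ`. -/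
def permGroup (σ : Equiv.Perm (Fin 5)) (Γ : Subgroup (Fin 5 → ℂˣ)) : Subgroup (Fin 5 → ℂˣ) :=
  Γ.comap (permHom σ)

lemma mem_permGroup {σ : Equiv.Perm (Fin 5)} {Γ : Subgroup (Fin 5 → ℂˣ)} {d : Fin 5 → ℂˣ} :
    d ∈ permGroup σ Γ ↔ d ∘ σ ∈ Γ := Iff.rfl

lemma permGroup_permGroup (σ τ : Equiv.Perm (Fin 5)) (Γ : Subgroup (Fin 5 → ℂˣ)) :
    permGroup τ (permGroup σ Γ) = permGroup (τ * σ) Γ := rfl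

lemma mem_expLattice_permGroup {n : ℕ} {σ : Equiv.Perm (Fin 5)} {Γ : Subgroup (Fin 5 → ℂˣ)}
    {e : Fin 5 → ℤ} : e ∈ expLattice n (permGroup σ Γ) ↔ e ∘ σ ∈ expLattice n Γ := Iff.rfl

/-- The monomial `xᵢxⱼxₖ` is invariant under the group `Γ` of diagonal matrices. -/
def Inv (Γ : Subgroup (Fin 5 → ℂˣ)) (i j k : Fin 5) : Prop := ∀ d ∈ Γ, d i * d j * d k = 1

lemma Inv.dvd {Γ : Subgroup (Fin 5 → ℂˣ)} {i j k : Fin 5} (h : Inv Γ i j k) {n : ℕ} (hn : n ≠ 0)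
    {e : Fin 5 → ℤ} (he : e ∈ expLattice n Γ) : (n : ℤ) ∣ e i + e j + e k := by
  have := h _ (mem_expLattice.1 he)
  simp only [expVec] at this
  rwa [← zpow_add, ← zpow_add, ξ_zpow_eq_one hn] at this

lemma Good.permGroup {Γ : Subgroup (Fin 5 → ℂˣ)} (h : Good (Inv Γ)) (σ : Equiv.Perm (Fin 5)) :
    Good (Inv (permGroup σ Γ)) := by
  have hinv : ∀ {i j k}, Inv Γ i j k → Inv (CubicThreefold.permGroup σ Γ) (σ i) (σ j) (σ k) :=
    fun h d hd => h _ hd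
  intro I hI hI3
  rcases h (I.map σ.symm.toEmbedding) (hI.map) (by simpa using hI3) with
    ⟨i, hi, j, hj, k, hk, h1⟩ | ⟨J, hJ, h1⟩
  · simp only [Finset.mem_map_equiv, Equiv.symm_symm] at hi hj hk
    exact Or.inl ⟨_, hi, _, hj, _, hk, hinv h1⟩
  · refine Or.inr ⟨J.map σ.toEmbedding, by simpa using hJ, fun j hj => ?_⟩
    obtain ⟨j, hj', rfl⟩ := Finset.mem_map.1 hj
    obtain ⟨h2, a, ha, b, hb, h3⟩ := h1 j hj'
    simp only [Finset.mem_map_equiv, Equiv.symm_symm] at h2 ha hb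
    exact ⟨h2, _, ha, _, hb, hinv h3⟩

/-! ### Soundness of the finite checks -/

/-- The integral vector with the given list of entries. -/
def vec (l : List ℕ) : Fin 5 → ℤ := fun i => (entry l i : ℤ)

/-- The subgroup generated by the vectors of a list and `nℤ⁵`. -/
def spanZ (n : ℕ) : List (List ℕ) → AddSubgroup (Fin 5 → ℤ)
  | [] => (zsmulAddGroupHom (n : ℤ)).range
  | g :: gs => AddSubgroup.zmultiples (vec g) ⊔ spanZ n gs

lemma mem_spanZ_cons {n : ℕ} {g : List ℕ} {gs : List (List ℕ)} {e : Fin 5 → ℤ} :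
    e ∈ spanZ n (g :: gs) ↔ ∃ c : ℤ, ∃ f ∈ spanZ n gs, e = c • vec g + f := by
  simp only [spanZ, AddSubgroup.mem_sup, AddSubgroup.mem_zmultiples_iff]
  constructor
  · rintro ⟨_, ⟨c, rfl⟩, f, hf, rfl⟩; exact ⟨c, f, hf, rfl⟩
  · rintro ⟨c, f, hf, rfl⟩; exact ⟨_, ⟨c, rfl⟩, f, hf, rfl⟩

lemma self_smul_mem_spanZ (n : ℕ) (gs : List (List ℕ)) (z : Fin 5 → ℤ) :
    (n : ℤ) • z ∈ spanZ n gs := by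
  induction gs with
  | nil => exact ⟨z, rfl⟩
  | cons g gs ih => exact AddSubgroup.mem_sup_right ih

lemma vec_mem_spanZ {n : ℕ} {gs : List (List ℕ)} {g : List ℕ} (hg : g ∈ gs) :
    vec g ∈ spanZ n gs := by
  induction gs with
  | nil => simp at hg
  | cons g' gs ih =>
    rcases List.mem_cons.1 hg with rfl | hg
    · exact AddSubgroup.mem_sup_left (AddSubgroup.mem_zmultiples _)
    · exact AddSubgroup.mem_sup_right (ih hg)

lemma spanZ_le {n : ℕ} {gs : List (List ℕ)} {Λ : AddSubgroup (Fin 5 → ℤ)}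
    (hg : ∀ g ∈ gs, vec g ∈ Λ) (hn : ∀ z, (n : ℤ) • z ∈ Λ) : spanZ n gs ≤ Λ := by
  induction gs with
  | nil => rintro _ ⟨z, rfl⟩; exact hn z
  | cons g gs ih =>
    refine sup_le ?_ (ih fun g' hg' => hg g' (List.mem_cons_of_mem _ hg'))
    rw [AddSubgroup.zmultiples_le]
    exact hg g List.mem_cons_self

/-- Two integral vectors are congruent modulo `n`. -/
def Cong (n : ℕ) (e f : Fin 5 → ℤ) : Prop := ∃ z : Fin 5 → ℤ, e = f + (n : ℤ) • z

lemma Cong.mem {n : ℕ} {e f : Fin 5 → ℤ} (h : Cong n e f) {Λ : AddSubgroup (Fin 5 → ℤ)}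
    (hn : ∀ z, (n : ℤ) • z ∈ Λ) : e ∈ Λ ↔ f ∈ Λ := by
  obtain ⟨z, rfl⟩ := h
  exact AddSubgroup.add_mem_cancel_right Λ (hn z)

lemma cong_of_dvd {n : ℕ} {e f : Fin 5 → ℤ} (h : ∀ i, (n : ℤ) ∣ e i - f i) : Cong n e f := by
  choose z hz using h
  refine ⟨z, funext fun i => ?_⟩
  have := hz i
  simp only [Pi.add_apply, Pi.smul_apply, smul_eq_mul]
  linarith

lemma length_five {l : List ℕ} (h : l.length = 5) : ∃ a b c d e, l = [a, b, c, d, e] := by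
  match l, h with
  | [a, b, c, d, e], _ => exact ⟨a, b, c, d, e, rfl⟩

lemma cong_addMul (n c : ℕ) {a b : List ℕ} (ha : a.length = 5) (hb : b.length = 5) :
    Cong n (vec (addMul n c a b)) (vec a + (c : ℤ) • vec b) := by
  obtain ⟨a₀, a₁, a₂, a₃, a₄, rfl⟩ := length_five ha
  obtain ⟨b₀, b₁, b₂, b₃, b₄, rfl⟩ := length_five hb
  refine cong_of_dvd fun i => ?_
  have key : ∀ x y : ℕ, (n : ℤ) ∣ (((x + c * y) % n : ℕ) : ℤ) - ((x : ℤ) + c * y) := fun x y => by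
    push_cast
    rw [← dvd_neg, neg_sub]
    exact Int.dvd_self_sub_emod
  fin_cases i <;> simp only [vec, entry, addMul, List.zipWith, Pi.add_apply, Pi.smul_apply,
    smul_eq_mul] <;> exact key _ _

lemma length_addMul (n c : ℕ) {a b : List ℕ} (ha : a.length = 5) (hb : b.length = 5) :
    (addMul n c a b).length = 5 := by
  simp [addMul, ha, hb]

lemma vec_zipWith_add {a b : List ℕ} (ha : a.length = 5) (hb : b.length = 5) :
    vec (List.zipWith (· + ·) a b) = vec a + vec b := by
  obtain ⟨a₀, a₁, a₂, a₃, a₄, rfl⟩ := length_five ha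
  obtain ⟨b₀, b₁, b₂, b₃, b₄, rfl⟩ := length_five hb
  funext i
  fin_cases i <;> simp [vec, entry]

lemma spanList_mem {n : ℕ} {gs : List (ℕ × List ℕ)} (hl : ∀ g ∈ gs, g.2.length = 5)
    {Λ : AddSubgroup (Fin 5 → ℤ)} (hg : ∀ g ∈ gs, vec g.2 ∈ Λ) (hn : ∀ z, (n : ℤ) • z ∈ Λ)
    {l : List ℕ} (h : l ∈ spanList n gs) : l.length = 5 ∧ vec l ∈ Λ := by
  induction gs generalizing l with
  | nil =>
    simp only [spanList, List.mem_singleton] at h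
    subst h
    refine ⟨rfl, ?_⟩
    have : vec [0, 0, 0, 0, 0] = 0 := by funext i; fin_cases i <;> rfl
    rw [this]; exact zero_mem _
  | cons g gs ih =>
    simp only [spanList, List.mem_flatMap, List.mem_map] at h
    obtain ⟨j, -, a, ha, rfl⟩ := h
    obtain ⟨h5, hm⟩ := ih (fun g' h' => hl g' (List.mem_cons_of_mem _ h'))
      (fun g' h' => hg g' (List.mem_cons_of_mem _ h')) ha
    have hg5 := hl g List.mem_cons_self
    refine ⟨length_addMul _ _ h5 hg5, ?_⟩
    rw [(cong_addMul n j h5 hg5).mem hn]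
    exact add_mem hm (zsmul_mem (hg g List.mem_cons_self) _)

/-- All entries are below `n`, and there are five of them. -/
def Bounded (n : ℕ) (l : List ℕ) : Prop := l.length = 5 ∧ ∀ x ∈ l, x < n

lemma spanList_bounded {n : ℕ} (hn : 0 < n) {gs : List (ℕ × List ℕ)}
    (hl : ∀ g ∈ gs, g.2.length = 5) {l : List ℕ} (h : l ∈ spanList n gs) : Bounded n l := by
  induction gs generalizing l with
  | nil =>
    simp only [spanList, List.mem_singleton] at h
    subst h
    exact ⟨rfl, by simpa using hn⟩
  | cons g gs ih =>
    simp only [spanList, List.mem_flatMap, List.mem_map] at h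
    obtain ⟨j, -, a, ha, rfl⟩ := h
    obtain ⟨h5, -⟩ := ih (fun g' h' => hl g' (List.mem_cons_of_mem _ h')) ha
    refine ⟨length_addMul _ _ h5 (hl g List.mem_cons_self), ?_⟩
    intro x hx
    obtain ⟨i, hi, rfl⟩ := List.mem_iff_getElem.1 hx
    simp only [addMul, List.getElem_zipWith]
    exact Nat.mod_lt _ hn

lemma code_injective {n : ℕ} {a b : List ℕ} (ha : Bounded n a) (hb : Bounded n b)
    (h : code n a = code n b) : a = b := by
  obtain ⟨ha5, ha⟩ := ha
  obtain ⟨hb5, hb⟩ := hb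
  obtain ⟨a₀, a₁, a₂, a₃, a₄, rfl⟩ := length_five ha5
  obtain ⟨b₀, b₁, b₂, b₃, b₄, rfl⟩ := length_five hb5
  simp only [List.mem_cons, List.not_mem_nil, or_false, forall_eq_or_imp, forall_eq] at ha hb
  simp only [code, List.foldl] at h
  have key : ∀ {p q x y : ℕ}, x < n → y < n → p * n + x = q * n + y → p = q ∧ x = y := by
    intro p q x y hx hy hpq
    have hx' : (p * n + x) % n = x := by rw [Nat.mul_add_mod_self_right, Nat.mod_eq_of_lt hx]
    have hy' : (q * n + y) % n = y := by rw [Nat.mul_add_mod_self_right, Nat.mod_eq_of_lt hy]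
    have hxy : x = y := by rw [← hx', hpq, hy']
    subst hxy
    exact ⟨Nat.eq_of_mul_eq_mul_right (by omega) (Nat.add_right_cancel hpq), rfl⟩
  obtain ⟨h, h4⟩ := key ha.2.2.2.2 hb.2.2.2.2 h
  obtain ⟨h, h3⟩ := key ha.2.2.2.1 hb.2.2.2.1 h
  obtain ⟨h, h2⟩ := key ha.2.2.1 hb.2.2.1 h
  obtain ⟨h, h1⟩ := key ha.2.1 hb.2.1 h
  obtain ⟨h, h0⟩ := key ha.1 hb.1 h
  rw [h0, h1, h2, h3, h4]

lemma testBit_bitset {n : ℕ} {L : List (List ℕ)} {i : ℕ} (h : (bitset n L).testBit i = true) :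
    ∃ l ∈ L, code n l = i := by
  have key : ∀ (L : List (List ℕ)) (m : ℕ),
      (L.foldl (fun acc x => acc ||| (1 <<< code n x)) m).testBit i = true →
        m.testBit i = true ∨ ∃ l ∈ L, code n l = i := by
    intro L
    induction L with
    | nil => intro m hm; exact Or.inl hm
    | cons x L ih =>
      intro m hm
      rcases ih _ hm with h1 | ⟨l, hl, h1⟩
      · rw [Nat.testBit_or, Bool.or_eq_true, Nat.one_shiftLeft, Nat.testBit_two_pow] at h1
        rcases h1 with h1 | h1
        · exact Or.inl h1
        · exact Or.inr ⟨x, List.mem_cons_self, by simpa using h1⟩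
      · exact Or.inr ⟨l, List.mem_cons_of_mem _ hl, h1⟩
  rcases key L 0 h with h1 | h1
  · simp at h1
  · exact h1

lemma perms_spec : ∀ p ∈ perms, p.length = 5 ∧ (∀ i : Fin 5, entry p i < 5) ∧
    ∀ i j : Fin 5, entry p i = entry p j → i = j := by
  decide +kernel

lemma exists_perm {p : List ℕ} (hp : p ∈ perms) : ∃ σ : Equiv.Perm (Fin 5),
    ∀ g : List ℕ, vec (permute p g) = vec g ∘ σ := by
  obtain ⟨h5, hlt, hinj⟩ := perms_spec p hp
  have hi : Function.Injective fun i : Fin 5 => (⟨entry p i, hlt i⟩ : Fin 5) := by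
    intro i j hij
    exact hinj i j (by simpa using hij)
  refine ⟨Equiv.ofBijective _ (Finite.injective_iff_bijective.1 hi), fun g => ?_⟩
  obtain ⟨a, b, c, d, e, rfl⟩ := length_five h5
  funext i
  simp only [vec, Function.comp, Equiv.ofBijective_apply]
  fin_cases i <;> rfl

lemma permute_bounded {n : ℕ} {p g : List ℕ} (hp : p ∈ perms) (hg : Bounded n g) :
    Bounded n (permute p g) := by
  obtain ⟨h5, hlt, -⟩ := perms_spec p hp
  obtain ⟨a, b, c, d, e, rfl⟩ := length_five h5
  obtain ⟨hg5, hg⟩ := hg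
  refine ⟨by simp [permute], fun x hx => ?_⟩
  simp only [permute, List.mem_map] at hx
  obtain ⟨i, hi, rfl⟩ := hx
  have hi5 : i < 5 := by
    obtain ⟨m, hm, rfl⟩ := List.mem_iff_getElem.1 hi
    have := hlt ⟨m, by simpa using hm⟩
    rwa [entry, List.getD_eq_getElem _ _ hm] at this
  apply hg
  rw [entry, List.getD_eq_getElem _ _ (by omega)]
  exact List.getElem_mem _

/-- `t` is the triple `(i, j, k)` up to order. -/
def IsTriple (t : ℕ × ℕ × ℕ) (i j k : Fin 5) : Prop :=
  t = (↑i, ↑j, ↑k) ∨ t = (↑i, ↑k, ↑j) ∨ t = (↑j, ↑i, ↑k) ∨ t = (↑j, ↑k, ↑i) ∨ t = (↑k, ↑i, ↑j) ∨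
    t = (↑k, ↑j, ↑i)

instance (t : ℕ × ℕ × ℕ) (i j k : Fin 5) : Decidable (IsTriple t i j k) := by
  unfold IsTriple; infer_instance

lemma exists_isTriple : ∀ i j k : Fin 5, ∃ t ∈ monomials, IsTriple t i j k := by decide +kernel

lemma IsTriple.entry_sum {t : ℕ × ℕ × ℕ} {i j k : Fin 5} (h : IsTriple t i j k) (g : List ℕ) :
    entry g t.1 + entry g t.2.1 + entry g t.2.2 = entry g i + entry g j + entry g k := by
  rcases h with rfl | rfl | rfl | rfl | rfl | rfl <;> simp only <;> omega

lemma masks_spec : ∀ ms ∈ masks, (Finset.univ.filter fun i : Fin 5 => ms.1.testBit i).card = ms.2 ∧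
    0 < ms.2 ∧ ms.2 ≤ 3 := by
  decide +kernel

lemma length_filter_five (p : ℕ → Bool) :
    ([0, 1, 2, 3, 4].filter p).length = (Finset.univ.filter fun i : Fin 5 => p i).card := by
  rw [Finset.card_filter, Fin.sum_univ_five]
  by_cases h0 : p 0 <;> by_cases h1 : p 1 <;> by_cases h2 : p 2 <;> by_cases h3 : p 3 <;>
    by_cases h4 : p 4 <;> simp [h0, h1, h2, h3, h4]

lemma Good.goodb_eq_true {S : Fin 5 → Fin 5 → Fin 5 → Prop} (hS : Good S)
    {M : List (ℕ × ℕ × ℕ)} (hM : ∀ i j k, S i j k → ∃ t ∈ M, IsTriple t i j k) :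
    goodb M = true := by
  rw [goodb, List.all_eq_true]
  rintro ⟨m, s⟩ hms
  obtain ⟨hcard, h0, h3⟩ := masks_spec _ hms
  simp only at hcard h0 h3 ⊢
  rw [Bool.or_eq_true]
  rcases hS (Finset.univ.filter fun i : Fin 5 => m.testBit i)
    (Finset.card_pos.1 (by omega)) (by omega) with ⟨i, hi, j, hj, k, hk, h⟩ | ⟨J, hJ, h⟩
  · left
    simp only [Finset.mem_filter, Finset.mem_univ, true_and] at hi hj hk
    obtain ⟨t, ht, htr⟩ := hM i j k h
    rw [supportedb, List.any_eq_true]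
    refine ⟨t, ht, ?_⟩
    rcases htr with rfl | rfl | rfl | rfl | rfl | rfl <;> simp [hi, hj, hk]
  · right
    rw [Nat.ble_eq, length_filter_five, ← hcard]
    refine hJ.trans (Finset.card_le_card fun j hj => ?_)
    obtain ⟨h1, a, ha, b, hb, h2⟩ := h j hj
    simp only [Finset.mem_filter, Finset.mem_univ, true_and] at h1 ha hb ⊢
    obtain ⟨t, ht, htr⟩ := hM a b j h2
    rw [Bool.and_eq_true]
    refine ⟨by simpa using h1, ?_⟩
    rw [linearb, List.any_eq_true]
    refine ⟨t, ht, ?_⟩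
    rcases htr with rfl | rfl | rfl | rfl | rfl | rfl <;> simp [ha, hb, Nat.beq_refl]

lemma Inv.invariantb {Γ : Subgroup (Fin 5 → ℂˣ)} {i j k : Fin 5} (h : Inv Γ i j k) {n : ℕ}
    (hn : n ≠ 0) {g : List ℕ} (hg : vec g ∈ expLattice n Γ) {t : ℕ × ℕ × ℕ}
    (ht : IsTriple t i j k) : invariantb n g t = true := by
  have h1 := h.dvd hn hg
  rw [CubicThreefold.invariantb, Nat.beq_eq, ht.entry_sum]
  simp only [vec] at h1
  exact Nat.mod_eq_zero_of_dvd (by exact_mod_cast h1)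

/-- The monomials which are invariant under all given exponent vectors form a good set. -/
lemma goodb_filter {Γ : Subgroup (Fin 5 → ℂˣ)} (hΓ : Good (Inv Γ)) (p : ℕ × ℕ × ℕ → Bool)
    (hp : ∀ i j k t, Inv Γ i j k → IsTriple t i j k → p t = true) :
    goodb (monomials.filter p) = true := by
  refine hΓ.goodb_eq_true fun i j k h => ?_
  obtain ⟨t, ht, htr⟩ := exists_isTriple i j k
  exact ⟨t, List.mem_filter.2 ⟨ht, hp i j k t h htr⟩, htr⟩

lemma mem_residues₀ {n : ℕ} {l : List ℕ} : l ∈ residues₀ n ↔ Bounded n l ∧ entry l 0 = 0 := by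
  simp only [residues₀, List.mem_flatMap, List.mem_map, List.mem_range, Bounded]
  constructor
  · rintro ⟨b, hb, c, hc, d, hd, e, he, rfl⟩
    refine ⟨⟨rfl, ?_⟩, rfl⟩
    simp only [List.mem_cons, List.not_mem_nil, or_false, forall_eq_or_imp, forall_eq]
    exact ⟨by omega, hb, hc, hd, he⟩
  · rintro ⟨⟨h5, h⟩, h0⟩
    obtain ⟨a, b, c, d, e, rfl⟩ := length_five h5
    simp only [List.mem_cons, List.not_mem_nil, or_false, forall_eq_or_imp, forall_eq] at h
    have ha : a = 0 := h0
    subst ha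
    exact ⟨b, h.2.1, c, h.2.2.1, d, h.2.2.2.1, e, h.2.2.2.2, rfl⟩

lemma mem_residues {n : ℕ} {l : List ℕ} : l ∈ residues n ↔ Bounded n l := by
  simp only [residues, List.mem_flatMap, List.mem_map, List.mem_range, mem_residues₀]
  constructor
  · rintro ⟨a, ha, l, ⟨⟨h5, h⟩, -⟩, rfl⟩
    obtain ⟨a', b, c, d, e, rfl⟩ := length_five h5
    refine ⟨rfl, fun x hx => ?_⟩
    rcases List.mem_cons.1 hx with rfl | hx
    · exact ha
    · exact h x (List.mem_cons_of_mem _ hx)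
  · rintro ⟨h5, h⟩
    obtain ⟨a, b, c, d, e, rfl⟩ := length_five h5
    have ha := h a List.mem_cons_self
    refine ⟨a, ha, [0, b, c, d, e], ⟨⟨rfl, fun x hx => ?_⟩, rfl⟩, rfl⟩
    rcases List.mem_cons.1 hx with rfl | hx
    · omega
    · exact h x (List.mem_cons_of_mem _ hx)

lemma cong_emod {n : ℕ} (hn : 0 < n) (e : Fin 5 → ℤ) :
    Cong n e (vec [(e 0 % n).toNat, (e 1 % n).toNat, (e 2 % n).toNat, (e 3 % n).toNat,
      (e 4 % n).toNat]) ∧ ∀ i, (e i % n).toNat < n := by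
  have hn' : (0 : ℤ) < n := by exact_mod_cast hn
  have key : ∀ x : ℤ, (n : ℤ) ∣ x - ((x % n).toNat : ℕ) := fun x => by
    rw [Int.toNat_of_nonneg (Int.emod_nonneg x hn'.ne')]
    exact Int.dvd_self_sub_emod
  refine ⟨cong_of_dvd fun i => ?_, fun i => ?_⟩
  · fin_cases i <;> exact key _
  · have := Int.emod_lt_of_pos (e i) hn'
    have := Int.emod_nonneg (e i) hn'.ne'
    omega

lemma exists_residue {n : ℕ} (hn : 0 < n) (e : Fin 5 → ℤ) :
    ∃ w ∈ residues n, Cong n e (vec w) := by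
  obtain ⟨h, hlt⟩ := cong_emod hn e
  refine ⟨_, mem_residues.2 ⟨rfl, ?_⟩, h⟩
  simp only [List.mem_cons, List.not_mem_nil, or_false, forall_eq_or_imp, forall_eq]
  exact ⟨hlt 0, hlt 1, hlt 2, hlt 3, hlt 4⟩

/-! ### The `2`-part -/

lemma groups_spec : ∀ kR ∈ groups, (∀ g ∈ kR.1, Bounded 16 g.2) ∧ order kR.1 ≤ 16 ∧
    ∀ r ∈ kR.2, r.length ≤ 4 ∧ ∀ g ∈ r, Bounded 3 g ∧ entry g 0 = 0 := by
  unfold Bounded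
  decide +kernel

/-- The span is covered by the subset sums of the generators, modulo its double. -/
lemma exists_subsetSum {k : List (ℕ × List ℕ)} (hk : ∀ g ∈ k, g.2.length = 5) {e : Fin 5 → ℤ}
    (he : e ∈ spanZ 16 (k.map Prod.snd)) : ∃ v ∈ subsetSums k, v.length = 5 ∧
      ∃ q ∈ spanZ 16 (k.map Prod.snd), ∃ z : Fin 5 → ℤ, e = vec v + (2 : ℤ) • q + (16 : ℤ) • z := by
  induction k generalizing e with
  | nil =>
    obtain ⟨z, rfl⟩ := he
    refine ⟨_, List.mem_singleton_self _, rfl, 0, zero_mem _, z, ?_⟩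
    funext i
    fin_cases i <;> simp [vec, entry]
  | cons g k ih =>
    rw [List.map_cons] at he ⊢
    obtain ⟨c, f, hf, rfl⟩ := mem_spanZ_cons.1 he
    obtain ⟨v, hv, hv5, q, hq, z, rfl⟩ := ih (fun g' h' => hk g' (List.mem_cons_of_mem _ h')) hf
    have hg5 := hk g List.mem_cons_self
    rcases Int.emod_two_eq_zero_or_one c with hc | hc
    · refine ⟨v, List.mem_append_left _ hv, hv5, (c / 2) • vec g.2 + q,
        mem_spanZ_cons.2 ⟨_, q, hq, rfl⟩, z, ?_⟩
      have : c = 2 * (c / 2) := by omega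
      conv_lhs => rw [this]
      module
    · refine ⟨List.zipWith (· + ·) v g.2, List.mem_append_right _ (List.mem_map.2 ⟨v, hv, rfl⟩),
        by simp [hv5, hg5], (c / 2) • vec g.2 + q, mem_spanZ_cons.2 ⟨_, q, hq, rfl⟩, z, ?_⟩
      rw [vec_zipWith_add hv5 hg5]
      have : c = 2 * (c / 2) + 1 := by omega
      conv_lhs => rw [this]
      module

/-- `halves` contains representatives of all `h` with `2h` in the span. -/
lemma exists_half {k : List (ℕ × List ℕ)} (hk : ∀ g ∈ k, g.2.length = 5) {h : Fin 5 → ℤ}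
    (h2 : (2 : ℤ) • h ∈ spanZ 16 (k.map Prod.snd)) :
    ∃ c ∈ halves k, Bounded 16 c ∧ h - vec c ∈ spanZ 16 (k.map Prod.snd) := by
  obtain ⟨v, hv, hv5, q, hq, z, he⟩ := exists_subsetSum hk h2
  obtain ⟨w, hw, z', hz⟩ := exists_residue (n := 2) (by norm_num) z
  have hwb := mem_residues.1 hw
  have heven : ∀ i : Fin 5, entry v i % 2 = 0 := fun i => by
    have := congrFun he i
    simp only [Pi.add_apply, Pi.smul_apply, smul_eq_mul, vec] at this
    omega
  have hval : h = q + (fun i : Fin 5 => ((entry v i / 2 : ℕ) : ℤ) + 8 * z i) := by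
    funext i
    have h1 := congrFun he i
    have h3 := heven i
    simp only [Pi.add_apply, Pi.smul_apply, smul_eq_mul, vec] at h1 ⊢
    push_cast
    omega
  refine ⟨List.zipWith (fun x y => (x / 2 + 8 * y) % 16) v w, ?_, ?_, ?_⟩
  · refine List.mem_flatMap.2 ⟨v, List.mem_filter.2 ⟨hv, ?_⟩, List.mem_map.2 ⟨w, hw, rfl⟩⟩
    obtain ⟨a₀, a₁, a₂, a₃, a₄, rfl⟩ := length_five hv5
    have h0 := heven 0
    have h1 := heven 1
    have h2 := heven 2
    have h3 := heven 3
    have h4 := heven 4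
    simp [entry] at h0 h1 h2 h3 h4
    simp [List.all_cons, h0, h1, h2, h3, h4]
  · refine ⟨by simp [hv5, hwb.1], fun x hx => ?_⟩
    obtain ⟨i, hi, rfl⟩ := List.mem_iff_getElem.1 hx
    simp only [List.getElem_zipWith]
    exact Nat.mod_lt _ (by norm_num)
  · rw [hval]
    have : q + (fun i : Fin 5 => ((entry v i / 2 : ℕ) : ℤ) + 8 * z i) -
        vec (List.zipWith (fun x y => (x / 2 + 8 * y) % 16) v w) = q +
        ((fun i : Fin 5 => ((entry v i / 2 : ℕ) : ℤ) + 8 * z i) -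
        vec (List.zipWith (fun x y => (x / 2 + 8 * y) % 16) v w)) := by abel
    rw [this]
    refine add_mem hq ?_
    have hc : Cong 16 (fun i : Fin 5 => ((entry v i / 2 : ℕ) : ℤ) + 8 * z i)
        (vec (List.zipWith (fun x y => (x / 2 + 8 * y) % 16) v w)) := by
      refine cong_of_dvd fun i => ?_
      obtain ⟨a₀, a₁, a₂, a₃, a₄, rfl⟩ := length_five hv5
      obtain ⟨b₀, b₁, b₂, b₃, b₄, rfl⟩ := length_five hwb.1
      have hzi := congrFun hz i
      fin_cases i <;> simp [vec, entry] at hzi ⊢ <;> rw [hzi] <;> omega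
    obtain ⟨y, hy⟩ := hc
    rw [hy, add_sub_cancel_left]
    exact self_smul_mem_spanZ 16 _ y

lemma any_code_mem {L : List (List ℕ)} (hL : ∀ l ∈ L, Bounded 16 l) {a : List ℕ} (ha : Bounded 16 a)
    (h : (L.map (code 16)).any (Nat.beq (code 16 a)) = true) : a ∈ L := by
  rw [List.any_eq_true] at h
  obtain ⟨c, hc, h⟩ := h
  obtain ⟨l, hl, rfl⟩ := List.mem_map.1 hc
  rw [code_injective ha (hL l hl) (Nat.eq_of_beq_eq_true h)]
  exact hl

/-- A `2`-group inside `Γ` which is not the whole `2`-part can be enlarged, by the check `twoCheck`.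
-/
lemma two_step {Γ : Subgroup (Fin 5 → ℂˣ)} (hΓ : Good (Inv Γ))
    {kR : List (ℕ × List ℕ) × List (List (List ℕ))} (hkR : kR ∈ groups)
    (hk : ∀ g ∈ kR.1, vec g.2 ∈ expLattice 16 Γ) {h : Fin 5 → ℤ} (hh : h ∈ expLattice 16 Γ)
    (h2 : (2 : ℤ) • h ∈ spanZ 16 (kR.1.map Prod.snd)) (hn : h ∉ spanZ 16 (kR.1.map Prod.snd)) :
    ∃ kR' ∈ groups, order kR.1 < order kR'.1 ∧ ∃ σ : Equiv.Perm (Fin 5),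
      ∀ g ∈ kR'.1, vec g.2 ∘ σ ∈ expLattice 16 Γ := by
  have hkb := (groups_spec _ hkR).1
  have hk5 : ∀ g ∈ kR.1, g.2.length = 5 := fun g hg => (hkb g hg).1
  have h16 := self_smul_mem_expLattice (n := 16) (by norm_num) Γ
  have hle : spanZ 16 (kR.1.map Prod.snd) ≤ expLattice 16 Γ := by
    refine spanZ_le (fun g hg => ?_) h16
    obtain ⟨g', hg', rfl⟩ := List.mem_map.1 hg
    exact hk g' hg'
  obtain ⟨c, hc, hcb, hd⟩ := exists_half hk5 h2
  have hcΓ : vec c ∈ expLattice 16 Γ := by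
    have := sub_mem hh (hle hd)
    rwa [sub_sub_cancel] at this
  have hcn : vec c ∉ spanZ 16 (kR.1.map Prod.snd) := fun hcm => hn (by
    have := add_mem hd hcm
    rwa [sub_add_cancel] at this)
  have hcheck := twoCheck_eq_true
  rw [twoCheck, List.all_eq_true] at hcheck
  have hcheck := List.all_eq_true.1 (hcheck kR hkR) c hc
  rw [Bool.or_eq_true, Bool.or_eq_true] at hcheck
  rcases hcheck with (h1 | h1) | h1
  · exfalso
    rw [List.filter_filter, goodb_filter hΓ] at h1
    · simp at h1
    · intro i j k t hi ht
      rw [Bool.and_eq_true, List.all_eq_true]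
      exact ⟨hi.invariantb (by norm_num) hcΓ ht,
        fun g hg => hi.invariantb (by norm_num) (hk g hg) ht⟩
  · exfalso
    have hm := any_code_mem (fun l hl => spanList_bounded (by norm_num) hk5 hl) hcb h1
    exact hcn (spanList_mem hk5 (fun g hg => vec_mem_spanZ (List.mem_map.2 ⟨g, hg, rfl⟩))
      (self_smul_mem_spanZ 16 _) hm).2
  · rw [List.any_eq_true] at h1
    obtain ⟨kR', hkR', h1⟩ := h1
    rw [Bool.and_eq_true, List.any_eq_true] at h1
    obtain ⟨hlt, p, hp, h1⟩ := h1
    rw [List.all_eq_true] at h1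
    obtain ⟨σ, hσ⟩ := exists_perm hp
    refine ⟨kR', hkR', by simpa using hlt, σ, fun g hg => ?_⟩
    rw [← hσ]
    have hb5 : ∀ g ∈ (2, c) :: kR.1, g.2.length = 5 := by
      intro g hg
      rcases List.mem_cons.1 hg with rfl | hg
      · exact hcb.1
      · exact hk5 g hg
    have hm := any_code_mem (fun l hl => spanList_bounded (by norm_num) hb5 hl)
      (permute_bounded hp ((groups_spec _ hkR').1 g hg)) (h1 g hg)
    refine (spanList_mem hb5 (fun g hg => ?_) h16 hm).2
    rcases List.mem_cons.1 hg with rfl | hg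
    · exact hcΓ
    · exact hk g hg

/-- Up to a permutation of the coordinates, the `2`-part of `Γ` is one of the listed groups. -/
theorem exists_two_part {Γ : Subgroup (Fin 5 → ℂˣ)} (hΓ : Good (Inv Γ)) :
    ∃ σ : Equiv.Perm (Fin 5), ∃ kR ∈ groups,
      expLattice 16 (permGroup σ Γ) = spanZ 16 (kR.1.map Prod.snd) := by
  suffices H : ∀ m : ℕ, ∀ Γ : Subgroup (Fin 5 → ℂˣ), Good (Inv Γ) → ∀ kR ∈ groups,
      (∀ g ∈ kR.1, vec g.2 ∈ expLattice 16 Γ) → 17 ≤ order kR.1 + m →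
      ∃ σ : Equiv.Perm (Fin 5), ∃ kR ∈ groups,
        expLattice 16 (permGroup σ Γ) = spanZ 16 (kR.1.map Prod.snd) by
    -- all listed orders are at most `16`, so that the enlargement stops
    refine H 17 Γ hΓ ([], _) List.mem_cons_self (by simp) (by omega)
  intro m
  induction m with
  | zero =>
    intro Γ _ kR hkR _ hle
    have := (groups_spec _ hkR).2.1
    omega
  | succ m ih =>
    intro Γ hΓ kR hkR hk hm
    have h16 := self_smul_mem_expLattice (n := 16) (by norm_num) Γ
    have hle : spanZ 16 (kR.1.map Prod.snd) ≤ expLattice 16 Γ := by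
      refine spanZ_le (fun g hg => ?_) h16
      obtain ⟨g', hg', rfl⟩ := List.mem_map.1 hg
      exact hk g' hg'
    by_cases hge : expLattice 16 Γ ≤ spanZ 16 (kR.1.map Prod.snd)
    · exact ⟨1, kR, hkR, le_antisymm hge hle⟩
    · obtain ⟨h, hh, hn⟩ := SetLike.not_le_iff_exists.1 hge
      -- pass to a multiple of `h` whose double lies in the span
      obtain ⟨h, hh, hn, h2⟩ : ∃ h ∈ expLattice 16 Γ, h ∉ spanZ 16 (kR.1.map Prod.snd) ∧
          (2 : ℤ) • h ∈ spanZ 16 (kR.1.map Prod.snd) := by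
        by_contra! hcon
        have : ∀ j : ℕ, (2 ^ j : ℤ) • h ∉ spanZ 16 (kR.1.map Prod.snd) := by
          intro j
          induction j with
          | zero => simpa using hn
          | succ j ihj =>
            rw [pow_succ', mul_smul]
            exact hcon _ (zsmul_mem hh _) ihj
        exact this 4 (self_smul_mem_spanZ 16 _ h)
      obtain ⟨kR', hkR', hlt, σ, hσ⟩ := two_step hΓ hkR hk hh h2 hn
      obtain ⟨τ, kR'', hkR'', heq⟩ := ih (permGroup σ Γ) (hΓ.permGroup σ) kR' hkR'
        (fun g hg => hσ g hg) (by omega)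
      exact ⟨τ * σ, kR'', hkR'', heq⟩

/-! ### The `3`-part -/

lemma entry_addMul_zero {n c : ℕ} {a b : List ℕ} (ha : a.length = 5) (hb : b.length = 5) :
    entry (addMul n c a b) 0 = (entry a 0 + c * entry b 0) % n := by
  obtain ⟨a₀, a₁, a₂, a₃, a₄, rfl⟩ := length_five ha
  obtain ⟨b₀, b₁, b₂, b₃, b₄, rfl⟩ := length_five hb
  rfl

lemma addMul_bounded {n : ℕ} (hn : 0 < n) (c : ℕ) {a b : List ℕ} (ha : a.length = 5)
    (hb : b.length = 5) : Bounded n (addMul n c a b) := by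
  refine ⟨length_addMul _ _ ha hb, fun x hx => ?_⟩
  obtain ⟨i, hi, rfl⟩ := List.mem_iff_getElem.1 hx
  simp only [addMul, List.getElem_zipWith]
  exact Nat.mod_lt _ hn

lemma reduce_spec {r : List (List ℕ)} (hr : ∀ g ∈ r, Bounded 3 g ∧ entry g 0 = 0)
    {Λ : AddSubgroup (Fin 5 → ℤ)} (hg : ∀ g ∈ r, vec g ∈ Λ) (hn : ∀ z, (3 : ℕ) • z ∈ Λ)
    {w : List ℕ} (hw : w ∈ residues₀ 3) :
    reduce r w ∈ residues₀ 3 ∧ vec (reduce r w) - vec w ∈ Λ := by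
  induction r generalizing w with
  | nil => exact ⟨hw, by simp [reduce]⟩
  | cons g r ih =>
    obtain ⟨hwb, hw0⟩ := mem_residues₀.1 hw
    obtain ⟨hgb, hg0⟩ := hr g List.mem_cons_self
    obtain ⟨h1, h2⟩ := ih (fun g' h' => hr g' (List.mem_cons_of_mem _ h'))
      (fun g' h' => hg g' (List.mem_cons_of_mem _ h'))
      (w := addMul 3 (2 * entry w (pivot g)) w g)
      (mem_residues₀.2 ⟨addMul_bounded (by norm_num) _ hwb.1 hgb.1, by
        rw [entry_addMul_zero hwb.1 hgb.1, hw0, hg0]; simp⟩)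
    refine ⟨h1, ?_⟩
    obtain ⟨z, hz⟩ := cong_addMul 3 (2 * entry w (pivot g)) hwb.1 hgb.1
    have h3 := add_mem h2 (add_mem (zsmul_mem (hg g List.mem_cons_self)
      ((2 * entry w (pivot g) : ℕ) : ℤ)) (hn z))
    rw [hz] at h3
    convert h3 using 1
    simp only [reduce, List.foldl_cons]
    module

lemma vec_eq_zero_of_isZero {v : List ℕ} (hv : v.length = 5) (h : isZero v = true) : vec v = 0 := by
  obtain ⟨a₀, a₁, a₂, a₃, a₄, rfl⟩ := length_five hv
  simp only [isZero, List.all_cons, List.all_nil, Bool.and_true, Bool.and_eq_true, Nat.beq_eq] at h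
  obtain ⟨rfl, rfl, rfl, rfl, rfl⟩ := h
  funext i
  fin_cases i <;> rfl

lemma entry_ones : ∀ i : Fin 5, entry ones i = 1 := by decide

lemma expVec_ones (n : ℕ) : expVec n (vec ones) = fun _ => ξ n := by
  funext i
  simp [expVec, vec, entry_ones]

lemma ones_mem_permGroup {Γ : Subgroup (Fin 5 → ℂˣ)} (hω : vec ones ∈ expLattice 3 Γ)
    (σ : Equiv.Perm (Fin 5)) : vec ones ∈ expLattice 3 (permGroup σ Γ) := by
  have : vec ones ∘ σ = vec ones := by
    funext i
    simp only [vec, Function.comp, entry_ones]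
  rwa [mem_expLattice_permGroup, this]

/-- A group of exponent three inside `Γ` which is not the whole `3`-torsion can be enlarged, by the
check `threeCheck`, after a permutation which preserves the `2`-part. -/
lemma three_step {Γ : Subgroup (Fin 5 → ℂˣ)} (hΓ : Good (Inv Γ))
    {kR : List (ℕ × List ℕ) × List (List (List ℕ))} (hkR : kR ∈ groups)
    (hk : ∀ g ∈ kR.1, vec g.2 ∈ expLattice 16 Γ) (hω : vec ones ∈ expLattice 3 Γ)
    {r : List (List ℕ)} (hr : r ∈ kR.2) (hrΓ : ∀ g ∈ r, vec g ∈ expLattice 3 Γ)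
    {h : Fin 5 → ℤ} (hh : h ∈ expLattice 3 Γ) (hn : h ∉ spanZ 3 (ones :: r)) :
    ∃ r' ∈ kR.2, r.length < r'.length ∧ ∃ σ : Equiv.Perm (Fin 5),
      (∀ g ∈ kR.1, vec g.2 ∘ σ ∈ spanZ 16 (kR.1.map Prod.snd)) ∧
      ∀ g ∈ r', vec g ∘ σ ∈ expLattice 3 Γ := by
  have hkb := (groups_spec _ hkR).1
  have hk5 : ∀ g ∈ kR.1, g.2.length = 5 := fun g hg => (hkb g hg).1
  have hrb := ((groups_spec _ hkR).2.2 r hr).2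
  have h3 := self_smul_mem_expLattice (n := 3) (by norm_num) Γ
  have hspan := self_smul_mem_spanZ 3 (ones :: r)
  have hle : spanZ 3 (ones :: r) ≤ expLattice 3 Γ :=
    spanZ_le (fun g hg => (List.mem_cons.1 hg).elim (fun h => h ▸ hω) (hrΓ g)) h3
  have hcheck := threeCheck_eq_true
  rw [List.all_eq_true] at hcheck
  have hcheck := List.all_eq_true.1 (hcheck kR hkR) r hr
  rw [Bool.and_eq_true] at hcheck
  obtain ⟨hred, hext⟩ := hcheck
  -- a representative of `h` with vanishing first entry, reduced by `r`
  obtain ⟨w, hw, hhw⟩ := exists_residue (n := 3) (by norm_num) h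
  have hwb := mem_residues.1 hw
  set w' := addMul 3 (2 * entry w 0) w ones with hw'
  have hw'0 : w' ∈ residues₀ 3 := mem_residues₀.2
    ⟨addMul_bounded (by norm_num) _ hwb.1 rfl, by
      rw [hw', entry_addMul_zero hwb.1 rfl]; simp only [ones, entry, List.getD_cons_zero]; omega⟩
  obtain ⟨hv, hvw⟩ := reduce_spec hrb (Λ := spanZ 3 (ones :: r))
    (fun g hg => vec_mem_spanZ (List.mem_cons_of_mem _ hg))
    (fun z => by simpa using hspan z) hw'0
  set v := reduce r w' with hv_def
  have hvb := (mem_residues₀.1 hv).1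
  have hvh : vec v - h ∈ spanZ 3 (ones :: r) := by
    obtain ⟨z, hz⟩ := hhw
    obtain ⟨z', hz'⟩ := cong_addMul 3 (2 * entry w 0) hwb.1 (b := ones) rfl
    rw [← hw'] at hz'
    have := add_mem hvw (add_mem (zsmul_mem (vec_mem_spanZ (n := 3) (gs := ones :: r)
      List.mem_cons_self) ((2 * entry w 0 : ℕ) : ℤ)) (hspan (z' - z)))
    convert this using 1
    rw [hz, hz']
    module
  have hvΓ : vec v ∈ expLattice 3 Γ := by
    have := add_mem (hle hvh) hh
    rwa [sub_add_cancel] at this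
  -- up to sign it is reduced
  obtain ⟨u, hu, huΓ, hured⟩ : ∃ u ∈ residues₀ 3, vec u ∈ expLattice 3 Γ ∧ reducedb r u = true := by
    have := List.all_eq_true.1 hred w' hw'0
    rw [Bool.or_eq_true, Bool.or_eq_true, ← hv_def] at this
    rcases this with (h1 | h1) | h1
    · exfalso
      rw [vec_eq_zero_of_isZero hvb.1 h1, zero_sub] at hvh
      exact hn (neg_mem_iff.1 hvh)
    · exact ⟨v, hv, hvΓ, h1⟩
    · refine ⟨_, mem_residues₀.2 ⟨addMul_bounded (by norm_num) 2 rfl hvb.1, ?_⟩, ?_, h1⟩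
      · rw [entry_addMul_zero rfl hvb.1, (mem_residues₀.1 hv).2]; rfl
      · rw [(cong_addMul 3 2 rfl hvb.1).mem h3]
        have : vec [0, 0, 0, 0, 0] = 0 := vec_eq_zero_of_isZero rfl rfl
        rw [this, zero_add]
        exact zsmul_mem hvΓ _
  have hub := (mem_residues₀.1 hu).1
  have hcheck := List.all_eq_true.1 hext u (List.mem_filter.2 ⟨hu, hured⟩)
  rw [Bool.or_eq_true] at hcheck
  rcases hcheck with h1 | h1
  · exfalso
    rw [List.filter_filter, List.filter_filter, goodb_filter hΓ] at h1
    · simp at h1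
    · intro i j k t hi ht
      simp only [Bool.and_eq_true, List.all_eq_true]
      exact ⟨⟨hi.invariantb (by norm_num) huΓ ht,
        fun g hg => hi.invariantb (by norm_num) (hrΓ g hg) ht⟩,
        fun g hg => hi.invariantb (by norm_num) (hk g hg) ht⟩
  · obtain ⟨r', hr', h1⟩ := List.any_eq_true.1 h1
    rw [Bool.and_eq_true] at h1
    obtain ⟨hlt, h1⟩ := h1
    obtain ⟨p, hp, h1⟩ := List.any_eq_true.1 h1
    obtain ⟨hp, hstab⟩ := List.mem_filter.1 hp
    rw [List.all_eq_true] at h1 hstab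
    obtain ⟨σ, hσ⟩ := exists_perm hp
    have hr'b := ((groups_spec _ hkR).2.2 r' hr').2
    refine ⟨r', hr', by simpa using hlt, σ, fun g hg => ?_, fun g hg => ?_⟩
    · rw [← hσ]
      have hm := any_code_mem (fun l hl => spanList_bounded (by norm_num) hk5 hl)
        (permute_bounded hp (hkb g hg)) (hstab g.2 (List.mem_map.2 ⟨g, hg, rfl⟩))
      exact (spanList_mem hk5 (fun g hg => vec_mem_spanZ (List.mem_map.2 ⟨g, hg, rfl⟩))
        (self_smul_mem_spanZ 16 _) hm).2
    · rw [← hσ]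
      have hb : ∀ g ∈ (3, u) :: (3, ones) :: r.map ((3, ·)), g.2.length = 5 ∧
          vec g.2 ∈ expLattice 3 Γ := by
        intro g hg
        rcases List.mem_cons.1 hg with rfl | hg
        · exact ⟨hub.1, huΓ⟩
        rcases List.mem_cons.1 hg with rfl | hg
        · exact ⟨rfl, hω⟩
        obtain ⟨g', hg', rfl⟩ := List.mem_map.1 hg
        exact ⟨(hrb g' hg').1.1, hrΓ g' hg'⟩
      obtain ⟨l, hl, hc⟩ := testBit_bitset (h1 g hg)
      have := code_injective (spanList_bounded (by norm_num) (fun g hg => (hb g hg).1) hl)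
        (permute_bounded hp (hr'b g hg).1) hc
      rw [← this]
      exact (spanList_mem (fun g hg => (hb g hg).1) (fun g hg => (hb g hg).2) h3 hl).2

/-- A permutation which maps the lattice of the `2`-part into itself preserves it. -/
lemma expLattice_permGroup_eq {Γ : Subgroup (Fin 5 → ℂˣ)} {n : ℕ} {k : List (List ℕ)}
    (h : expLattice n Γ = spanZ n k) {σ : Equiv.Perm (Fin 5)}
    (hσ : ∀ g ∈ k, vec g ∘ σ ∈ spanZ n k) : expLattice n (permGroup σ Γ) = spanZ n k := by
  have hstep : ∀ e ∈ spanZ n k, e ∘ σ ∈ spanZ n k := by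
    let f : (Fin 5 → ℤ) →+ (Fin 5 → ℤ) :=
      { toFun := fun e => e ∘ σ, map_zero' := rfl, map_add' := fun _ _ => rfl }
    have : spanZ n k ≤ (spanZ n k).comap f :=
      spanZ_le hσ (fun z => self_smul_mem_spanZ n k (z ∘ σ))
    exact this
  ext e
  rw [mem_expLattice_permGroup, h]
  refine ⟨fun he => ?_, hstep e⟩
  -- `σ` has finite order
  have hj : ∀ j : ℕ, e ∘ (σ ^ (j + 1) : Equiv.Perm (Fin 5)) ∈ spanZ n k := by
    intro j
    induction j with
    | zero => simpa using he
    | succ j ih =>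
      have := hstep _ ih
      rwa [Function.comp_assoc, ← Equiv.Perm.coe_mul, ← pow_succ] at this
  have := hj (orderOf σ - 1)
  rw [Nat.sub_add_cancel (orderOf_pos σ), pow_orderOf_eq_one] at this
  simpa using this

/-- Up to a permutation of the coordinates, the `2`-part and the elements of exponent three of `Γ`
are among the listed groups. -/
theorem exists_normal_form {Γ : Subgroup (Fin 5 → ℂˣ)} (hΓ : Good (Inv Γ))
    (hω : vec ones ∈ expLattice 3 Γ) :
    ∃ σ : Equiv.Perm (Fin 5), ∃ kR ∈ groups, ∃ r ∈ kR.2,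
      expLattice 16 (permGroup σ Γ) = spanZ 16 (kR.1.map Prod.snd) ∧
      expLattice 3 (permGroup σ Γ) = spanZ 3 (ones :: r) := by
  suffices H : ∀ m : ℕ, ∀ Γ : Subgroup (Fin 5 → ℂˣ), Good (Inv Γ) → vec ones ∈ expLattice 3 Γ →
      ∀ kR ∈ groups, expLattice 16 Γ = spanZ 16 (kR.1.map Prod.snd) →
      ∀ r ∈ kR.2, (∀ g ∈ r, vec g ∈ expLattice 3 Γ) → 5 ≤ r.length + m →
      ∃ σ : Equiv.Perm (Fin 5), ∃ r ∈ kR.2,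
        expLattice 16 (permGroup σ Γ) = spanZ 16 (kR.1.map Prod.snd) ∧
        expLattice 3 (permGroup σ Γ) = spanZ 3 (ones :: r) by
    obtain ⟨σ, kR, hkR, h⟩ := exists_two_part hΓ
    have hnil : [] ∈ kR.2 := by
      have : ∀ kR ∈ groups, [] ∈ kR.2 := by decide +kernel
      exact this kR hkR
    obtain ⟨τ, r, hr, h2, h3⟩ := H 5 (permGroup σ Γ) (hΓ.permGroup σ) (ones_mem_permGroup hω σ)
      kR hkR h [] hnil (by simp) (by simp)
    exact ⟨τ * σ, kR, hkR, r, hr, h2, h3⟩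
  intro m
  induction m with
  | zero =>
    intro Γ _ _ kR hkR _ r hr _ hm
    have := ((groups_spec _ hkR).2.2 r hr).1
    omega
  | succ m ih =>
    intro Γ hΓ hω kR hkR hk r hr hrΓ hm
    by_cases hge : expLattice 3 Γ ≤ spanZ 3 (ones :: r)
    · refine ⟨1, r, hr, hk, le_antisymm hge (spanZ_le (fun g hg => ?_)
        (self_smul_mem_expLattice (by norm_num) Γ))⟩
      exact (List.mem_cons.1 hg).elim (fun h => h ▸ hω) (hrΓ g)
    · obtain ⟨h, hh, hn⟩ := SetLike.not_le_iff_exists.1 hge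
      obtain ⟨r', hr', hlt, σ, hσk, hσr⟩ := three_step hΓ hkR
        (fun g hg => hk ▸ vec_mem_spanZ (List.mem_map.2 ⟨g, hg, rfl⟩)) hω hr hrΓ hh hn
      obtain ⟨τ, r'', hr'', h2, h3⟩ := ih (permGroup σ Γ) (hΓ.permGroup σ)
        (ones_mem_permGroup hω σ) kR hkR (expLattice_permGroup_eq hk (fun g hg => by
          obtain ⟨g', hg', rfl⟩ := List.mem_map.1 hg
          exact hσk g' hg')) r' hr' hσr (by omega)
      exact ⟨τ * σ, r'', hr'', h2, h3⟩

/-! ### The orders of the diagonal entries -/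

lemma ξ_zpow_eq_zpow {m n : ℕ} (hm : m ≠ 0) (hn : n ≠ 0) {a b : ℤ} (h : a * n = m * b) :
    ξ m ^ a = ξ n ^ b := by
  have hm' : (m : ℂ) ≠ 0 := by exact_mod_cast hm
  have hn' : (n : ℂ) ≠ 0 := by exact_mod_cast hn
  have h' : (a : ℂ) * n = m * b := by exact_mod_cast h
  ext
  simp only [Units.val_zpow_eq_zpow_val, ξ, Units.val_mk0, ← Complex.exp_int_mul]
  congr 1
  field_simp
  linear_combination h'

/-- In a good set, every variable `xᵢ` has a monomial `xᵢ²xⱼ`: this is the condition for `I = {i}`.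
-/
lemma Good.exists_next {S : Fin 5 → Fin 5 → Fin 5 → Prop} (hS : Good S) (i : Fin 5) :
    ∃ j, S i i j := by
  rcases hS {i} (Finset.singleton_nonempty i) (by simp) with
    ⟨a, ha, b, hb, c, hc, h⟩ | ⟨J, hJ, h⟩
  · rw [Finset.mem_singleton] at ha hb hc
    subst ha hb hc
    exact ⟨_, h⟩
  · obtain ⟨j, hj⟩ := Finset.card_pos.1
      ((Finset.card_pos.2 (Finset.singleton_nonempty i)).trans_le hJ)
    obtain ⟨-, a, ha, b, hb, h1⟩ := h j hj
    rw [Finset.mem_singleton] at ha hb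
    subst ha hb
    exact ⟨j, by assumption⟩

lemma Inv.eq_zpow {Γ : Subgroup (Fin 5 → ℂˣ)} {i j : Fin 5} (h : Inv Γ i i j) {d : Fin 5 → ℂˣ}
    (hd : d ∈ Γ) : d j = d i ^ (-2 : ℤ) := by
  have := h d hd
  rw [zpow_neg, eq_inv_iff_mul_eq_one, mul_comm, ← this]
  norm_cast
  rw [sq]

lemma iterate_eq_zpow {Γ : Subgroup (Fin 5 → ℂˣ)} {f : Fin 5 → Fin 5} (hf : ∀ i, Inv Γ i i (f i))
    {d : Fin 5 → ℂˣ} (hd : d ∈ Γ) (i : Fin 5) (k : ℕ) : d (f^[k] i) = d i ^ ((-2 : ℤ) ^ k) := by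
  induction k with
  | zero => simp
  | succ k ih =>
    rw [Function.iterate_succ_apply', (hf _).eq_zpow hd, ih, ← zpow_mul, pow_succ]

/-- Following the monomials `xᵢ²xⱼ` one has to return after at most five steps, and
`(-2)ᵃ - (-2)ᵇ` divides `7920 = 16 ⬝ 9 ⬝ 5 ⬝ 11` for `0 ≤ a < b ≤ 5`. -/
lemma Good.pow_eq_one {Γ : Subgroup (Fin 5 → ℂˣ)} (hΓ : Good (Inv Γ)) {d : Fin 5 → ℂˣ}
    (hd : d ∈ Γ) : d ^ 7920 = 1 := by
  choose f hf using hΓ.exists_next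
  funext i
  obtain ⟨a, b, hab, h⟩ := Fintype.exists_ne_map_eq_of_card_lt
    (fun k : Fin 6 => f^[k] i) (by simp)
  have key : ∀ a b : Fin 6, a ≠ b → ((-2 : ℤ) ^ (a : ℕ) - (-2) ^ (b : ℕ)) ∣ 7920 := by decide
  obtain ⟨c, hc⟩ := key a b hab
  have h1 : d i ^ ((-2 : ℤ) ^ (a : ℕ) - (-2) ^ (b : ℕ)) = 1 := by
    rw [zpow_sub, ← iterate_eq_zpow hf hd, ← iterate_eq_zpow hf hd]
    rw [show f^[(a : ℕ)] i = f^[(b : ℕ)] i from h, mul_inv_cancel]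
  have h2 : d i ^ (7920 : ℤ) = 1 := by rw [hc, zpow_mul, h1, one_zpow]
  exact_mod_cast h2

/-! ### Model groups -/

/-- The diagonal entries encoded by an order `n` and exponents of `ξ n`. -/
def toVec (g : ℕ × List ℕ) : Fin 5 → ℂˣ := expVec g.1 (vec g.2)

/-- The group generated by the encoded diagonal matrices and by the scalars of order three. -/
def modelGroup (row : List (ℕ × List ℕ)) : Subgroup (Fin 5 → ℂˣ) :=
  Subgroup.closure {d | d = expVec 3 (vec ones) ∨ ∃ g ∈ row, d = toVec g}

lemma toVec_mem_modelGroup {row : List (ℕ × List ℕ)} {g : ℕ × List ℕ} (hg : g ∈ row) :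
    toVec g ∈ modelGroup row := Subgroup.subset_closure (Or.inr ⟨g, hg, rfl⟩)

lemma ones_mem_modelGroup (row : List (ℕ × List ℕ)) : vec ones ∈ expLattice 3 (modelGroup row) :=
  Subgroup.subset_closure (Or.inl rfl)

lemma modelGroup_le {row : List (ℕ × List ℕ)} {Γ : Subgroup (Fin 5 → ℂˣ)}
    (hω : vec ones ∈ expLattice 3 Γ) (h : ∀ g ∈ row, toVec g ∈ Γ) : modelGroup row ≤ Γ := by
  rw [modelGroup, Subgroup.closure_le]
  rintro d (rfl | ⟨g, hg, rfl⟩)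
  · exact hω
  · exact h g hg

/-- The row with all vectors permuted. -/
def permuteRow (p : List ℕ) (row : List (ℕ × List ℕ)) : List (ℕ × List ℕ) :=
  row.map fun g => (g.1, permute p g.2)

lemma permGroup_modelGroup {p : List ℕ} {σ : Equiv.Perm (Fin 5)}
    (hσ : ∀ g : List ℕ, vec (permute p g) = vec g ∘ σ) (row : List (ℕ × List ℕ)) :
    permGroup σ⁻¹ (modelGroup row) = modelGroup (permuteRow p row) := by
  have hv : ∀ g : ℕ × List ℕ, toVec (g.1, permute p g.2) = toVec g ∘ σ := fun g => by
    funext i; simp only [toVec, expVec, hσ, Function.comp]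
  refine le_antisymm (fun d hd => ?_) (modelGroup_le ?_ fun g hg => ?_)
  · have h2 : modelGroup row ≤ permGroup σ (modelGroup (permuteRow p row)) := by
      refine modelGroup_le (ones_mem_permGroup (ones_mem_modelGroup _) σ) fun g hg => ?_
      rw [mem_permGroup, ← hv]
      exact toVec_mem_modelGroup (List.mem_map.2 ⟨g, hg, rfl⟩)
    have := h2 (mem_permGroup.1 hd)
    rw [mem_permGroup, Function.comp_assoc, ← Equiv.Perm.coe_mul, inv_mul_cancel] at this
    simpa using this
  · exact ones_mem_permGroup (ones_mem_modelGroup _) σ⁻¹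
  · obtain ⟨g', hg', rfl⟩ := List.mem_map.1 hg
    rw [hv, mem_permGroup, Function.comp_assoc, ← Equiv.Perm.coe_mul, mul_inv_cancel]
    exact toVec_mem_modelGroup hg'

/-- A generator of a `2`-group as exponents of the root of unity of its own order. -/
def genOf (g : ℕ × List ℕ) : ℕ × List ℕ := (g.1, g.2.map (· / (16 / g.1)))

/-- All generators of a `2`-group and a `3`-group. -/
def rowOf (k : List (ℕ × List ℕ)) (r : List (List ℕ)) : List (ℕ × List ℕ) :=
  k.map genOf ++ r.map ((3, ·))

lemma genOf_spec : ∀ kR ∈ groups, ∀ g ∈ kR.1, g.1 ≠ 0 ∧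
    ∀ i : Fin 5, entry g.2 i * g.1 = 16 * entry (genOf g).2 i := by decide +kernel

lemma toVec_genOf {kR : List (ℕ × List ℕ) × List (List (List ℕ))} (hkR : kR ∈ groups)
    {g : ℕ × List ℕ} (hg : g ∈ kR.1) : toVec (genOf g) = expVec 16 (vec g.2) := by
  obtain ⟨h0, h⟩ := genOf_spec kR hkR g hg
  funext i
  refine (ξ_zpow_eq_zpow (by norm_num) h0 ?_).symm
  simp only [vec]
  exact_mod_cast h i

/-- If the exponent of `Γ` divides `48`, then `Γ` is determined by its elements of exponents `16`
and `3`. -/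
theorem exists_eq_modelGroup_of_pow {Γ : Subgroup (Fin 5 → ℂˣ)} (hΓ : Good (Inv Γ))
    (hω : vec ones ∈ expLattice 3 Γ) (h48 : ∀ d ∈ Γ, d ^ 48 = 1) :
    ∃ σ : Equiv.Perm (Fin 5), ∃ kR ∈ groups, ∃ r ∈ kR.2,
      permGroup σ Γ = modelGroup (rowOf kR.1 r) := by
  obtain ⟨σ, kR, hkR, r, hr, h2, h3⟩ := exists_normal_form hΓ hω
  refine ⟨σ, kR, hkR, r, hr, le_antisymm (fun d hd => ?_) (modelGroup_le
    (ones_mem_permGroup hω σ) fun g hg => ?_)⟩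
  · have hd48 : d ^ 48 = 1 := by
      have := h48 _ (mem_permGroup.1 hd)
      funext i
      simpa using congrFun this (σ.symm i)
    obtain ⟨e, he⟩ := exists_expVec (n := 3) (d := d ^ 16) (by norm_num) (by
      rw [← pow_mul, hd48])
    obtain ⟨e', he'⟩ := exists_expVec (n := 16) (d := d ^ 3) (by norm_num) (by
      rw [← pow_mul, hd48])
    have h1 : e ∈ spanZ 3 (ones :: r) := by
      rw [← h3, mem_expLattice, he]; exact pow_mem hd _
    have h1' : e' ∈ spanZ 16 (kR.1.map Prod.snd) := by
      rw [← h2, mem_expLattice, he']; exact pow_mem hd _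
    have hle : spanZ 3 (ones :: r) ≤ expLattice 3 (modelGroup (rowOf kR.1 r)) := by
      refine spanZ_le (fun g hg => ?_) (self_smul_mem_expLattice (by norm_num) _)
      rcases List.mem_cons.1 hg with rfl | hg
      · exact ones_mem_modelGroup _
      · have hm : (3, g) ∈ rowOf kR.1 r := List.mem_append_right _ (List.mem_map.2 ⟨g, hg, rfl⟩)
        have := toVec_mem_modelGroup hm
        exact this
    have hle' : spanZ 16 (kR.1.map Prod.snd) ≤ expLattice 16 (modelGroup (rowOf kR.1 r)) := by
      refine spanZ_le (fun g hg => ?_) (self_smul_mem_expLattice (by norm_num) _)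
      obtain ⟨g', hg', rfl⟩ := List.mem_map.1 hg
      rw [mem_expLattice, ← toVec_genOf hkR hg']
      have hm : genOf g' ∈ rowOf kR.1 r := List.mem_append_left _ (List.mem_map.2 ⟨g', hg', rfl⟩)
      exact toVec_mem_modelGroup hm
    have h5 : expVec 3 e ∈ modelGroup (rowOf kR.1 r) := hle h1
    have h6 : expVec 16 e' ∈ modelGroup (rowOf kR.1 r) := hle' h1'
    rw [he] at h5
    rw [he'] at h6
    -- `d = d¹⁶ (d³)⁻⁵`
    have h4 := mul_mem h5 (inv_mem (pow_mem h6 5))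
    rw [← pow_mul] at h4
    have : d ^ 16 * (d ^ (3 * 5))⁻¹ = d := by
      rw [mul_inv_eq_iff_eq_mul, ← pow_succ']
    rwa [this] at h4
  · rcases List.mem_append.1 hg with hg | hg
    · obtain ⟨g', hg', rfl⟩ := List.mem_map.1 hg
      rw [toVec_genOf hkR hg', ← mem_expLattice, h2]
      exact vec_mem_spanZ (List.mem_map.2 ⟨g', hg', rfl⟩)
    · obtain ⟨g', hg', rfl⟩ := List.mem_map.1 hg
      have hm : vec g' ∈ expLattice 3 (permGroup σ Γ) := by
        rw [h3]
        exact vec_mem_spanZ (List.mem_cons_of_mem _ hg')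
      exact mem_expLattice.1 hm

/-- If `Γ` has no elements of order `11`, `5` or `9`, its exponent divides `48`. -/
lemma pow_eq_one_of_no_element {Γ : Subgroup (Fin 5 → ℂˣ)} (hΓ : Good (Inv Γ))
    (h11 : ∀ e ∈ expLattice 11 Γ, ∀ i, (11 : ℤ) ∣ e i)
    (h5 : ∀ e ∈ expLattice 5 Γ, ∀ i, (5 : ℤ) ∣ e i)
    (h9 : ∀ e ∈ expLattice 9 Γ, ∀ i, (3 : ℤ) ∣ e i) {d : Fin 5 → ℂˣ} (hd : d ∈ Γ) :
    d ^ 48 = 1 := by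
  have h0 := hΓ.pow_eq_one hd
  have h1 : d ^ 720 = 1 := by
    obtain ⟨e, he⟩ := exists_expVec (n := 11) (d := d ^ 720) (by norm_num) (by rw [← pow_mul, h0])
    have := h11 e (by rw [mem_expLattice, he]; exact pow_mem hd _)
    rw [← he]
    funext i
    exact (ξ_zpow_eq_one (by norm_num) _).2 (this i)
  have h2 : d ^ 144 = 1 := by
    obtain ⟨e, he⟩ := exists_expVec (n := 5) (d := d ^ 144) (by norm_num) (by rw [← pow_mul, h1])
    have := h5 e (by rw [mem_expLattice, he]; exact pow_mem hd _)
    rw [← he]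
    funext i
    exact (ξ_zpow_eq_one (by norm_num) _).2 (this i)
  obtain ⟨e, he⟩ := exists_expVec (n := 9) (d := d ^ 16) (by norm_num) (by rw [← pow_mul, h2])
  have := h9 e (by rw [mem_expLattice, he]; exact pow_mem hd _)
  rw [show 48 = 16 * 3 from rfl, pow_mul, ← he]
  funext i
  obtain ⟨c, hc⟩ := this i
  simp only [expVec, Pi.pow_apply, Pi.one_apply]
  rw [← zpow_natCast, ← zpow_mul, ξ_zpow_eq_one (by norm_num), hc]
  exact ⟨c, by push_cast; ring⟩

/-! ### Elements of order `11`, `5` and `9` -/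

/-- Let `e` be the exponents of an element of `Γ` whose order is exactly `n` in one coordinate.
Following the monomials `xᵢ²xⱼ` from that coordinate, the exponents are multiplied by `-2`; after a
permutation of the coordinates, the first ones are `1, -2, 4, …`. -/
lemma exists_chain {Γ : Subgroup (Fin 5 → ℂˣ)} (hΓ : Good (Inv Γ)) {n : ℕ} (hn : n ≠ 0) (L : ℕ)
    (hL : ∀ a b : Fin 5, (a : ℕ) < L → (b : ℕ) < L →
      (n : ℤ) ∣ (-2) ^ (a : ℕ) - (-2) ^ (b : ℕ) → a = b)
    {e : Fin 5 → ℤ} (he : e ∈ expLattice n Γ) {i : Fin 5} (hi : IsCoprime (e i) n) :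
    ∃ σ : Equiv.Perm (Fin 5), ∃ e' ∈ expLattice n (permGroup σ Γ),
      ∀ k : Fin 5, (k : ℕ) < L → e' k = (-2) ^ (k : ℕ) := by
  choose f hf using hΓ.exists_next
  have hiter : ∀ k : ℕ, (n : ℤ) ∣ e (f^[k] i) - (-2) ^ k * e i := by
    intro k
    induction k with
    | zero => simp
    | succ k ih =>
      rw [Function.iterate_succ_apply']
      obtain ⟨c, hc⟩ := dvd_sub ((hf (f^[k] i)).dvd hn he) (ih.mul_left 2)
      exact ⟨c, by linear_combination hc⟩
  have hinj : Function.Injective fun k : {k : Fin 5 // (k : ℕ) < L} => f^[(k : Fin 5)] i := by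
    intro a b hab
    refine Subtype.ext (hL _ _ a.2 b.2 ?_)
    obtain ⟨c, hc⟩ := dvd_sub (hiter b.1) (hiter a.1)
    rw [show f^[(a.1 : ℕ)] i = f^[(b.1 : ℕ)] i from hab] at hc
    exact hi.symm.dvd_of_dvd_mul_right ⟨c, by linear_combination hc⟩
  -- replace `e` by the multiple `u e`, the entry of which at `i` is `1` modulo `n`
  set σ := (Equiv.ofInjective _ hinj).extendSubtype with hσ_def
  have hσ : ∀ k : Fin 5, (k : ℕ) < L → σ k = f^[k] i := fun k hk => by
    exact Equiv.extendSubtype_apply_of_mem (Equiv.ofInjective _ hinj) k hk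
  obtain ⟨u, v, huv⟩ := hi
  refine ⟨σ⁻¹, fun k => if (k : ℕ) < L then (-2) ^ (k : ℕ) else u * e (σ k), ?_,
    fun k hk => if_pos hk⟩
  have hc : Cong n (fun k : Fin 5 => if (k : ℕ) < L then (-2) ^ (k : ℕ) else u * e (σ k))
      (u • e ∘ σ) := by
    refine cong_of_dvd fun k => ?_
    simp only [Pi.smul_apply, Function.comp, smul_eq_mul]
    split_ifs with hk
    · rw [hσ k hk]
      obtain ⟨c, hc⟩ :=
        dvd_sub (dvd_mul_left (n : ℤ) ((-2) ^ (k : ℕ) * v)) ((hiter k).mul_left u)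
      exact ⟨c, by linear_combination hc - (-2) ^ (k : ℕ) * huv⟩
    · simp
  rw [hc.mem (self_smul_mem_expLattice hn _), mem_expLattice_permGroup]
  have : (u • e ∘ σ) ∘ ⇑σ⁻¹ = u • e := by funext k; simp
  rw [this]
  exact zsmul_mem he u

lemma ξ_two : ξ 2 = -1 := Units.ext (by
  simpa using (IsPrimitiveRoot.coe_units_iff.2
    (ξ_primitive (n := 2) two_ne_zero)).eq_neg_one_of_two_right)

lemma ξ_zpow_congr {n : ℕ} (hn : n ≠ 0) {a b : ℤ} (h : (n : ℤ) ∣ a - b) : ξ n ^ a = ξ n ^ b := by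
  have := (ξ_zpow_eq_one hn _).2 h
  rwa [zpow_sub, mul_inv_eq_one] at this

lemma const_mem_modelGroup (row : List (ℕ × List ℕ)) {c : ℂˣ} (hc : c ^ 3 = 1) :
    (fun _ => c) ∈ modelGroup row := by
  obtain ⟨k, rfl⟩ := exists_ξ_zpow (by norm_num) hc
  have h := zpow_mem (mem_expLattice.1 (ones_mem_modelGroup row)) k
  rw [expVec_ones] at h
  exact h

lemma const_mem {Γ : Subgroup (Fin 5 → ℂˣ)} (hω : vec ones ∈ expLattice 3 Γ) {c : ℂˣ}
    (hc : c ^ 3 = 1) : (fun _ => c) ∈ Γ :=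
  modelGroup_le (row := []) hω (by simp) (const_mem_modelGroup [] hc)

lemma exists_pow_eq_ξ_three {z : ℂˣ} (hz : z ^ 3 = 1) (h1 : z ≠ 1) : ∃ k : ℤ, z ^ k = ξ 3 := by
  obtain ⟨m, rfl⟩ := exists_ξ_zpow (by norm_num) hz
  have h3 : ¬ (3 : ℤ) ∣ m := fun h => h1 ((ξ_zpow_eq_one (by norm_num) m).2 h)
  refine ⟨m, ?_⟩
  rw [← zpow_mul]
  conv_rhs => rw [← zpow_one (ξ 3)]
  refine ξ_zpow_congr (by norm_num) ?_
  have : m % 3 = 1 ∨ m % 3 = 2 := by omega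
  rcases this with h | h <;> obtain ⟨q, hq⟩ : ∃ q, m = 3 * q + m % 3 := ⟨m / 3, by omega⟩ <;>
    rw [h] at hq <;> subst hq
  · exact ⟨3 * q ^ 2 + 2 * q, by push_cast; ring⟩
  · exact ⟨3 * q ^ 2 + 4 * q + 1, by push_cast; ring⟩

lemma goodb_of_mem {Γ : Subgroup (Fin 5 → ℂˣ)} (hΓ : Good (Inv Γ)) {n : ℕ} (hn : n ≠ 0)
    {g : List ℕ} (hg : vec g ∈ expLattice n Γ) :
    goodb (monomials.filter (invariantb n g)) = true :=
  goodb_filter hΓ _ fun _ _ _ _ h ht => h.invariantb hn hg ht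

/-- The invariant monomials `xᵢ²xⱼ` determine the next coordinate from an exponent vector. -/
lemma next_eq {Γ : Subgroup (Fin 5 → ℂˣ)} (hΓ : Good (Inv Γ)) {n : ℕ} (hn : n ≠ 0)
    {g : List ℕ} (hg : vec g ∈ expLattice n Γ) (i j : Fin 5)
    (h : ∀ k : Fin 5, (n : ℤ) ∣ vec g i + vec g i + vec g k → k = j) : Inv Γ i i j := by
  obtain ⟨k, hk⟩ := hΓ.exists_next i
  rwa [← h k (hk.dvd hn hg)]

/-- The monomials `xᵢ²xⱼ` form a loop through all five variables, so a diagonal matrix in `Γ` is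
determined by its first entry, which satisfies `d₀ = d₀ ^ (-2)⁵`, that is `d₀³³ = 1`. -/
theorem exists_eleven {Γ : Subgroup (Fin 5 → ℂˣ)} (hΓ : Good (Inv Γ))
    (hω : vec ones ∈ expLattice 3 Γ) {e : Fin 5 → ℤ} (he : e ∈ expLattice 11 Γ) {i : Fin 5}
    (hi : ¬ (11 : ℤ) ∣ e i) :
    ∃ σ : Equiv.Perm (Fin 5), permGroup σ Γ = modelGroup [(11, [1, 9, 4, 3, 5])] := by
  have hcop : IsCoprime (e i) (11 : ℕ) :=
    (((Nat.prime_iff_prime_int.1 (by norm_num : Nat.Prime 11)).coprime_iff_not_dvd).2 hi).symm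
  obtain ⟨σ, e', he', hval⟩ := exists_chain hΓ (by norm_num) 5 (by decide) he hcop
  refine ⟨σ, ?_⟩
  replace hΓ := hΓ.permGroup σ
  replace hω := ones_mem_permGroup hω σ
  set Γ' := permGroup σ Γ
  have hg : vec [1, 9, 4, 3, 5] ∈ expLattice 11 Γ' := by
    refine (Cong.mem (cong_of_dvd fun k => ?_) (self_smul_mem_expLattice (by norm_num) _)).1 he'
    rw [hval k k.2]
    revert k
    decide
  have hg' : toVec (11, [1, 9, 4, 3, 5]) ∈ Γ' := hg
  refine le_antisymm (fun d hd => ?_) (modelGroup_le hω (by simpa using hg'))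
  have h01 := (next_eq hΓ (by norm_num) hg 0 1 (by decide)).eq_zpow hd
  have h12 := (next_eq hΓ (by norm_num) hg 1 2 (by decide)).eq_zpow hd
  have h23 := (next_eq hΓ (by norm_num) hg 2 3 (by decide)).eq_zpow hd
  have h34 := (next_eq hΓ (by norm_num) hg 3 4 (by decide)).eq_zpow hd
  have h40 := (next_eq hΓ (by norm_num) hg 4 0 (by decide)).eq_zpow hd
  rw [h01, ← zpow_mul] at h12
  rw [h12, ← zpow_mul] at h23
  rw [h23, ← zpow_mul] at h34
  rw [h34, ← zpow_mul] at h40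
  obtain ⟨m, hm⟩ := exists_ξ_zpow (n := 33) (x := d 0) (by norm_num) (by
    have h : d 0 ^ (1 : ℤ) = d 0 ^ (-2 * -2 * -2 * -2 * -2 : ℤ) := by rw [zpow_one]; exact h40
    have h2 : d 0 ^ (33 : ℤ) = 1 := by
      rw [show (33 : ℤ) = 1 - (-2 * -2 * -2 * -2 * -2) by norm_num, zpow_sub, ← h, mul_inv_cancel]
    exact_mod_cast h2)
  -- `ξ 33 = ξ 3⁻¹ (ξ 11)⁴`
  have hc : (fun _ => ξ 3 ^ (-m)) ∈ modelGroup [(11, [1, 9, 4, 3, 5])] :=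
    const_mem_modelGroup _ (by
      rw [← zpow_natCast, ← zpow_mul, ξ_zpow_eq_one (by norm_num)]; exact dvd_mul_left _ _)
  have ht := mul_mem hc (zpow_mem (toVec_mem_modelGroup
    (List.mem_singleton_self (11, [1, 9, 4, 3, 5]))) (4 * m))
  convert ht using 1
  have key : ∀ a b : ℤ, (33 : ℤ) ∣ a * m - (-m * 11 + 4 * m * 3 * b) →
      (ξ 33 ^ m) ^ a = ξ 3 ^ (-m) * (ξ 11 ^ b) ^ (4 * m) := by
    intro a b h
    rw [ξ_zpow_eq_zpow (m := 3) (n := 33) (b := -m * 11) (by norm_num) (by norm_num)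
      (by push_cast; ring), ← zpow_mul, ← zpow_mul, ξ_zpow_eq_zpow (m := 11) (n := 33)
      (b := 4 * m * 3 * b) (by norm_num) (by norm_num) (by push_cast; ring), ← zpow_add]
    exact ξ_zpow_congr (by norm_num) (by rw [mul_comm]; exact h)
  funext k
  fin_cases k
  · show d 0 = _
    rw [← hm]
    exact (zpow_one _).symm.trans (key 1 1 ⟨0, by ring⟩)
  · show d 1 = _
    rw [h01, ← hm]
    exact key _ 9 ⟨-3 * m, by ring⟩
  · show d 2 = _
    rw [h12, ← hm]
    exact key _ 4 ⟨-m, by ring⟩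
  · show d 3 = _
    rw [h23, ← hm]
    exact key _ 3 ⟨-m, by ring⟩
  · show d 4 = _
    rw [h34, ← hm]
    exact key _ 5 ⟨-m, by ring⟩

/-- The monomials `xᵢ²xⱼ` form a loop through four variables, which gives `d₀¹⁵ = 1`, and `x₄³` is
invariant. So `Γ` is generated by an element of order five, the scalars of order three and,
possibly, the matrices acting on `x₄` only. -/
theorem exists_five {Γ : Subgroup (Fin 5 → ℂˣ)} (hΓ : Good (Inv Γ))
    (hω : vec ones ∈ expLattice 3 Γ) {e : Fin 5 → ℤ} (he : e ∈ expLattice 5 Γ) {i : Fin 5}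
    (hi : ¬ (5 : ℤ) ∣ e i) :
    ∃ σ : Equiv.Perm (Fin 5), permGroup σ Γ = modelGroup [(5, [1, 3, 4, 2, 0])] ∨
      permGroup σ Γ = modelGroup [(5, [1, 3, 4, 2, 0]), (3, [0, 0, 0, 0, 1])] := by
  have hcop : IsCoprime (e i) (5 : ℕ) :=
    (((Nat.prime_iff_prime_int.1 (by norm_num : Nat.Prime 5)).coprime_iff_not_dvd).2 hi).symm
  obtain ⟨σ, e', he', hval⟩ := exists_chain hΓ (by norm_num) 4 (by decide) he hcop
  refine ⟨σ, ?_⟩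
  replace hΓ := hΓ.permGroup σ
  replace hω := ones_mem_permGroup hω σ
  set Γ' := permGroup σ Γ
  have hg : vec [1, 3, 4, 2, 0] ∈ expLattice 5 Γ' := by
    obtain ⟨hc, hlt⟩ := cong_emod (n := 5) (by norm_num) e'
    have h1 := (hc.mem (self_smul_mem_expLattice (by norm_num) _)).1 he'
    have h4 := hlt 4
    rw [hval 0 (by decide), hval 1 (by decide), hval 2 (by decide), hval 3 (by decide)] at h1
    generalize (e' 4 % (5 : ℕ)).toNat = c at h1 h4
    replace h1 : vec [1, 3, 4, 2, c] ∈ expLattice 5 Γ' := h1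
    have hcheck : ∀ c < 5, goodb (monomials.filter (invariantb 5 [1, 3, 4, 2, c])) = true →
        c = 0 := by
      decide +kernel
    rwa [hcheck c h4 (goodb_of_mem hΓ (by norm_num) h1)] at h1
  have hdec : ∀ d ∈ Γ', ∃ c : ℂˣ, c ^ 3 = 1 ∧ ∃ m : ℤ, ∃ z : ℂˣ, z ^ 3 = 1 ∧
      d = (fun _ => c) * toVec (5, [1, 3, 4, 2, 0]) ^ m * ![1, 1, 1, 1, z] := by
    intro d hd
    have h01 := (next_eq hΓ (by norm_num) hg 0 1 (by decide)).eq_zpow hd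
    have h12 := (next_eq hΓ (by norm_num) hg 1 2 (by decide)).eq_zpow hd
    have h23 := (next_eq hΓ (by norm_num) hg 2 3 (by decide)).eq_zpow hd
    have h30 := (next_eq hΓ (by norm_num) hg 3 0 (by decide)).eq_zpow hd
    have h44 := next_eq hΓ (by norm_num) hg 4 4 (by decide) d hd
    rw [h01, ← zpow_mul] at h12
    rw [h12, ← zpow_mul] at h23
    rw [h23, ← zpow_mul] at h30
    obtain ⟨m, hm⟩ := exists_ξ_zpow (n := 15) (x := d 0) (by norm_num) (by
      have h : d 0 ^ (1 : ℤ) = d 0 ^ (-2 * -2 * -2 * -2 : ℤ) := by rw [zpow_one]; exact h30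
      have h2 : d 0 ^ (15 : ℤ) = 1 := by
        rw [show (15 : ℤ) = (-2 * -2 * -2 * -2) - 1 by norm_num, zpow_sub, ← h, mul_inv_cancel]
      exact_mod_cast h2)
    -- `ξ 15 = (ξ 3)² (ξ 5)²`
    have hc3 : (ξ 3 ^ (2 * m)) ^ 3 = 1 := by
      rw [← zpow_natCast, ← zpow_mul, ξ_zpow_eq_one (by norm_num)]; exact dvd_mul_left _ _
    have key : ∀ a b : ℤ, (15 : ℤ) ∣ a * m - (2 * m * 5 + 2 * m * 3 * b) →
        (ξ 15 ^ m) ^ a = ξ 3 ^ (2 * m) * (ξ 5 ^ b) ^ (2 * m) := by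
      intro a b h
      rw [ξ_zpow_eq_zpow (m := 3) (n := 15) (b := 2 * m * 5) (by norm_num) (by norm_num)
        (by push_cast; ring), ← zpow_mul, ← zpow_mul, ξ_zpow_eq_zpow (m := 5) (n := 15)
        (b := 2 * m * 3 * b) (by norm_num) (by norm_num) (by push_cast; ring), ← zpow_add]
      exact ξ_zpow_congr (by norm_num) (by rw [mul_comm]; exact h)
    refine ⟨ξ 3 ^ (2 * m), hc3, 2 * m, (ξ 3 ^ (2 * m))⁻¹ * d 4, ?_, ?_⟩
    · rw [mul_pow, inv_pow, hc3, inv_one, one_mul, pow_succ, sq]; exact h44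
    · funext k
      fin_cases k
      · show d 0 = _ * 1
        rw [← hm, mul_one]
        exact (zpow_one _).symm.trans (key 1 1 ⟨-m, by ring⟩)
      · show d 1 = _ * 1
        rw [h01, ← hm, mul_one]
        exact key _ 3 ⟨-2 * m, by ring⟩
      · show d 2 = _ * 1
        rw [h12, ← hm, mul_one]
        exact key _ 4 ⟨-2 * m, by ring⟩
      · show d 3 = _ * 1
        rw [h23, ← hm, mul_one]
        exact key _ 2 ⟨-2 * m, by ring⟩
      · show d 4 = ξ 3 ^ (2 * m) * (ξ 5 ^ (0 : ℤ)) ^ (2 * m) * ((ξ 3 ^ (2 * m))⁻¹ * d 4)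
        simp
  have hg' : toVec (5, [1, 3, 4, 2, 0]) ∈ Γ' := hg
  by_cases hz : ∃ z : ℂˣ, z ^ 3 = 1 ∧ z ≠ 1 ∧ ![1, 1, 1, 1, z] ∈ Γ'
  · right
    obtain ⟨z, hz3, hz1, hz⟩ := hz
    obtain ⟨k, hk⟩ := exists_pow_eq_ξ_three hz3 hz1
    have hξ : ∀ j : ℤ, toVec (3, [0, 0, 0, 0, 1]) ^ j = ![1, 1, 1, 1, ξ 3 ^ j] := fun j => by
      funext i
      fin_cases i <;> simp [toVec, expVec, vec, entry]
    refine le_antisymm (fun d hd => ?_) (modelGroup_le hω ?_)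
    · obtain ⟨c, hc, m, y, hy, rfl⟩ := hdec d hd
      refine mul_mem (mul_mem (const_mem_modelGroup _ hc) (zpow_mem (toVec_mem_modelGroup
        (by simp)) _)) ?_
      obtain ⟨j, rfl⟩ := exists_ξ_zpow (by norm_num) hy
      rw [← hξ]
      exact zpow_mem (toVec_mem_modelGroup (by simp)) _
    · simp only [List.mem_cons, List.not_mem_nil, or_false, forall_eq_or_imp, forall_eq]
      refine ⟨hg', ?_⟩
      have h := zpow_mem hz k
      rw [← zpow_one (toVec _), hξ, zpow_one, ← hk]
      convert h using 1
      funext i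
      fin_cases i <;> simp
  · left
    push Not at hz
    refine le_antisymm (fun d hd => ?_) (modelGroup_le hω (by simpa using hg'))
    obtain ⟨c, hc, m, y, hy, hd'⟩ := hdec d hd
    have hy1 : y = 1 := by
      by_contra hy1
      refine hz y hy hy1 ?_
      have := mul_mem (inv_mem (mul_mem (const_mem hω hc) (zpow_mem hg' m))) hd
      rwa [hd', inv_mul_cancel_left] at this
    subst hy1
    rw [hd']
    refine mul_mem (mul_mem (const_mem_modelGroup _ hc) (zpow_mem (toVec_mem_modelGroup
        (by simp)) _)) ?_
    convert one_mem (modelGroup [(5, [1, 3, 4, 2, 0])]) using 1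
    funext i
    fin_cases i <;> rfl

/-- The diagonal matrix which only acts on the last two coordinates. -/
def tail (u v : ℂˣ) : Fin 5 → ℂˣ := ![1, 1, 1, u, v]

lemma tail_mul (u v u' v' : ℂˣ) : tail u v * tail u' v' = tail (u * u') (v * v') := by
  funext i; fin_cases i <;> simp [tail]

lemma tail_zpow (u v : ℂˣ) (k : ℤ) : tail u v ^ k = tail (u ^ k) (v ^ k) := by
  funext i; fin_cases i <;> simp [tail]

lemma tail_one : tail 1 1 = 1 := by
  funext i; fin_cases i <;> rfl

lemma tail_comp_swap (u v : ℂˣ) : tail u v ∘ Equiv.swap 3 4 = tail v u := by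
  funext i; fin_cases i <;> rfl

/-- The vector of order nine with last two entries `3a` and `3b`. -/
def nine (a b : ℕ) : ℕ × List ℕ := (9, [1, 7, 4, 3 * a, 3 * b])

lemma toVec_nine (a b : ℕ) :
    toVec (nine a b) = ![ξ 9, ξ 9 ^ 7, ξ 9 ^ 4, ξ 3 ^ a, ξ 3 ^ b] := by
  have h : ∀ a : ℕ, ξ 9 ^ (((3 * a : ℕ)) : ℤ) = ξ 3 ^ a := fun a => by
    rw [← zpow_natCast (ξ 3)]
    exact ξ_zpow_eq_zpow (by norm_num) (by norm_num) (by push_cast; ring)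
  funext i
  fin_cases i
  · simp [toVec, expVec, vec, entry, nine]
  · simp only [toVec, expVec, vec, entry, nine]; exact zpow_natCast (ξ 9) 7
  · simp only [toVec, expVec, vec, entry, nine]; exact zpow_natCast (ξ 9) 4
  · exact h a
  · exact h b

lemma toVec_nine_comp_swap (a b : ℕ) : toVec (nine a b) ∘ Equiv.swap 3 4 = toVec (nine b a) := by
  rw [toVec_nine, toVec_nine]; funext i; fin_cases i <;> rfl

lemma ξ_nine_pow_three : ξ 9 ^ 3 = ξ 3 := by
  have := ξ_zpow_eq_zpow (m := 9) (n := 3) (a := 3) (b := 1) (by norm_num) (by norm_num) (by norm_num)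
  rw [zpow_one] at this
  exact_mod_cast this

lemma ξ_three_pow_three : ξ 3 ^ 3 = 1 := (ξ_primitive (by norm_num)).pow_eq_one

/-- The cube of the element of order nine is `(ξ 3, ξ 3, ξ 3, 1, 1)`; it differs from a scalar by a
matrix acting on the last two coordinates. -/
lemma tail_self_mem {Γ : Subgroup (Fin 5 → ℂˣ)} (hω : vec ones ∈ expLattice 3 Γ) {a b : ℕ}
    (ht : toVec (nine a b) ∈ Γ) {v : ℂˣ} (hv : v ^ 3 = 1) : tail v v ∈ Γ := by
  have h3 : ∀ a, (ξ 3 ^ a) ^ 3 = 1 := fun a => by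
    rw [← pow_mul, mul_comm, pow_mul, ξ_three_pow_three, one_pow]
  have h : tail (ξ 3) (ξ 3) ∈ Γ := by
    have := mul_mem (const_mem hω ξ_three_pow_three) (inv_mem (pow_mem ht 3))
    convert this using 1
    rw [toVec_nine]
    have h9 : ξ 9 ^ 9 = 1 := (ξ_primitive (by norm_num)).pow_eq_one
    have h7 : (ξ 9 ^ 7) ^ 3 = ξ 3 := by
      rw [← pow_mul, show 7 * 3 = 9 + 9 + 3 from rfl, pow_add, pow_add, h9, ξ_nine_pow_three]; simp
    have h4 : (ξ 9 ^ 4) ^ 3 = ξ 3 := by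
      rw [← pow_mul, show 4 * 3 = 9 + 3 from rfl, pow_add, h9, ξ_nine_pow_three, one_mul]
    funext i
    fin_cases i
    · simp [tail, ξ_nine_pow_three]
    · simp [tail, h7]
    · simp [tail, h4]
    · simp [tail, h3]
    · simp [tail, h3]
  obtain ⟨k, rfl⟩ := exists_ξ_zpow (by norm_num) hv
  rw [← tail_zpow]
  exact zpow_mem h k

/-- The loop `x₀²x₁, x₁²x₂, x₂²x₀` gives `d₀⁹ = 1`, so the first three entries of `d` agree with
those of a power of the element of order nine. -/
lemma nine_decompose {Γ : Subgroup (Fin 5 → ℂˣ)} (hΓ : Good (Inv Γ)) {a b : ℕ}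
    (ht : toVec (nine a b) ∈ Γ) {d : Fin 5 → ℂˣ} (hd : d ∈ Γ) :
    ∃ m : ℤ, ∃ u v, tail u v ∈ Γ ∧ d = toVec (nine a b) ^ m * tail u v := by
  have hg : vec [1, 7, 4, 3 * a, 3 * b] ∈ expLattice 9 Γ := ht
  have h01 : d 1 = d 0 ^ (-2 : ℤ) := (next_eq hΓ (by norm_num) hg 0 1 (by
    intro k
    fin_cases k <;> simp [vec, entry] <;> omega)).eq_zpow hd
  have h12 : d 2 = d 1 ^ (-2 : ℤ) := (next_eq hΓ (by norm_num) hg 1 2 (by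
    intro k
    fin_cases k <;> simp [vec, entry] <;> omega)).eq_zpow hd
  have h20 : d 0 = d 2 ^ (-2 : ℤ) := (next_eq hΓ (by norm_num) hg 2 0 (by
    intro k
    fin_cases k <;> simp [vec, entry] <;> omega)).eq_zpow hd
  rw [h01, ← zpow_mul] at h12
  rw [h12, ← zpow_mul] at h20
  obtain ⟨m, hm⟩ := exists_ξ_zpow (n := 9) (x := d 0) (by norm_num) (by
    have h : d 0 ^ (1 : ℤ) = d 0 ^ (-2 * -2 * -2 : ℤ) := by rw [zpow_one]; exact h20
    have h2 : d 0 ^ (9 : ℤ) = 1 := by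
      rw [show (9 : ℤ) = 1 - (-2 * -2 * -2) by norm_num, zpow_sub, ← h, mul_inv_cancel]
    exact_mod_cast h2)
  have key : d = toVec (nine a b) ^ m * tail ((ξ 3 ^ a) ^ (-m) * d 3) ((ξ 3 ^ b) ^ (-m) * d 4) := by
    rw [toVec_nine]
    funext i
    fin_cases i
    · simp [tail, hm]
    · show d 1 = (ξ 9 ^ 7) ^ m * 1
      rw [h01, ← hm, mul_one, ← zpow_natCast, ← zpow_mul, ← zpow_mul]
      exact ξ_zpow_congr (by norm_num) ⟨-m, by push_cast; ring⟩
    · show d 2 = (ξ 9 ^ 4) ^ m * 1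
      rw [h12, ← hm, mul_one, ← zpow_natCast, ← zpow_mul, ← zpow_mul]
      exact ξ_zpow_congr (by norm_num) ⟨0, by push_cast; ring⟩
    · simp [tail]
    · simp [tail]
  refine ⟨m, _, _, ?_, key⟩
  have := mul_mem (inv_mem (zpow_mem ht m)) hd
  rwa [key, inv_mul_cancel_left] at this

lemma tail_mem_model_of_cube {row : List (ℕ × List ℕ)} {a b : ℕ} (hn : nine a b ∈ row) {v : ℂˣ}
    (hv : v ^ 3 = 1) : tail v v ∈ modelGroup row :=
  tail_self_mem (ones_mem_modelGroup row) (toVec_mem_modelGroup hn) hv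

/-- If `Γ` contains a matrix acting on the last two coordinates by `(u, v)` with `u³ ≠ 1`, the
invariant monomials in these are `x₃²x₄` and `x₄³`, and `Γ` contains the reflection in `x₃`. -/
lemma nine_two {Γ : Subgroup (Fin 5 → ℂˣ)} (hΓ : Good (Inv Γ)) (hω : vec ones ∈ expLattice 3 Γ)
    {a b : ℕ} (ha : a < 3) (hb : b < 3) (ht : toVec (nine a b) ∈ Γ) (h334 : Inv Γ 3 3 4)
    (h444 : Inv Γ 4 4 4) {u v : ℂˣ} (huv : tail u v ∈ Γ) (hu : u ^ 3 ≠ 1) :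
    ∃ a < 3, Γ = modelGroup [nine a a, (2, [0, 0, 0, 1, 0])] := by
  have hab : a = b := by
    have hg : vec [1, 7, 4, 3 * a, 3 * b] ∈ expLattice 9 Γ := ht
    have := h334.dvd (by norm_num) hg
    simp [vec, entry] at this
    omega
  subst hab
  have hrel : ∀ u v : ℂˣ, tail u v ∈ Γ → u * u * v = 1 ∧ v * v * v = 1 := fun u v h =>
    ⟨h334 _ h, h444 _ h⟩
  have hneg : toVec (2, [0, 0, 0, 1, 0]) = tail (-1) 1 := by
    funext i
    fin_cases i <;> simp [toVec, expVec, vec, entry, tail, ξ_two]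
  have hsq : ∀ s : ℂˣ, s * s = 1 → s = 1 ∨ s = -1 := fun s hs => by
    rcases mul_self_eq_one_iff.1 (show (s : ℂ) * s = 1 by rw [← Units.val_mul, hs, Units.val_one]) with h | h
    · exact Or.inl (Units.ext h)
    · exact Or.inr (Units.ext (by simpa using h))
  have hdec : ∀ u v : ℂˣ, tail u v ∈ Γ → v ^ 3 = 1 ∧ ∃ s : ℂˣ, (s = 1 ∨ s = -1) ∧ u = s * v := by
    intro u v h
    obtain ⟨h1, h2⟩ := hrel u v h
    refine ⟨by rw [pow_succ, sq, h2], u * v⁻¹, hsq _ ?_, by simp⟩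
    rw [mul_mul_mul_comm, eq_inv_of_mul_eq_one_left h1, ← mul_inv, ← mul_inv, ← mul_assoc, h2,
      inv_one]
  refine ⟨a, ha, le_antisymm (fun d hd => ?_) (modelGroup_le hω ?_)⟩
  · obtain ⟨m, u, v, huv, rfl⟩ := nine_decompose hΓ ht hd
    refine mul_mem (zpow_mem (toVec_mem_modelGroup (by simp)) m) ?_
    obtain ⟨hv, s, hs, rfl⟩ := hdec u v huv
    have h1 : tail s 1 ∈ modelGroup [nine a a, (2, [0, 0, 0, 1, 0])] := by
      rcases hs with rfl | rfl
      · rw [tail_one]; exact one_mem _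
      · rw [← hneg]; exact toVec_mem_modelGroup (by simp)
    have h2 := mul_mem h1 (tail_mem_model_of_cube (a := a) (b := a)
      (row := [nine a a, (2, [0, 0, 0, 1, 0])]) (by simp) hv)
    rwa [tail_mul, one_mul] at h2
  · simp only [List.mem_cons, List.not_mem_nil, or_false, forall_eq_or_imp, forall_eq]
    refine ⟨ht, ?_⟩
    rw [hneg]
    obtain ⟨hv, s, hs, rfl⟩ := hdec u v huv
    have hs1 : s = -1 := hs.resolve_left fun h => hu (by rw [h, one_mul, hv])
    have h2 := mul_mem huv (tail_self_mem hω ht (v := v⁻¹) (by rw [inv_pow, hv, inv_one]))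
    rw [tail_mul, mul_inv_cancel_right, mul_inv_cancel, hs1] at h2
    exact h2

/-- The case that all matrices in `Γ` acting on the last two coordinates only have exponent three.
-/
lemma nine_three {Γ : Subgroup (Fin 5 → ℂˣ)} (hΓ : Good (Inv Γ)) (hω : vec ones ∈ expLattice 3 Γ)
    {a b : ℕ} (ht : toVec (nine a b) ∈ Γ)
    (hcube : ∀ u v, tail u v ∈ Γ → u ^ 3 = 1 ∧ v ^ 3 = 1) :
    Γ = modelGroup [nine a b] ∨ Γ = modelGroup [nine 0 0, (3, [0, 0, 0, 1, 0])] := by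
  by_cases h : ∃ u v, tail u v ∈ Γ ∧ u ≠ v
  · right
    obtain ⟨u, v, huv, hne⟩ := h
    obtain ⟨hu, hv⟩ := hcube u v huv
    have hξ : toVec (3, [0, 0, 0, 1, 0]) = tail (ξ 3) 1 := by
      funext i
      fin_cases i <;> simp [toVec, expVec, vec, entry, tail]
    have h1 : tail (ξ 3) 1 ∈ Γ := by
      have h2 := mul_mem huv (tail_self_mem hω ht (v := v⁻¹) (by rw [inv_pow, hv, inv_one]))
      rw [tail_mul, mul_inv_cancel] at h2
      obtain ⟨k, hk⟩ := exists_pow_eq_ξ_three (z := u * v⁻¹) (by rw [mul_pow, inv_pow, hu, hv]; simp)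
        (fun h => hne (mul_inv_eq_one.1 h))
      have h3 := zpow_mem h2 k
      rwa [tail_zpow, hk, one_zpow] at h3
    have hall : ∀ Γ : Subgroup (Fin 5 → ℂˣ), vec ones ∈ expLattice 3 Γ → ∀ a b,
        toVec (nine a b) ∈ Γ → tail (ξ 3) 1 ∈ Γ → ∀ x y : ℂˣ, x ^ 3 = 1 → y ^ 3 = 1 →
        tail x y ∈ Γ := by
      intro Γ hω a b ht h1 x y hx hy
      obtain ⟨k, hk⟩ := exists_ξ_zpow (n := 3) (x := x * y⁻¹) (by norm_num)
        (by rw [mul_pow, inv_pow, hx, hy]; simp)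
      have h2 := mul_mem (zpow_mem h1 k) (tail_self_mem hω ht hy)
      rw [tail_zpow, tail_mul, hk] at h2
      simpa using h2
    have hpow : ∀ a : ℕ, ((ξ 3 ^ a)⁻¹) ^ 3 = 1 := fun a => by
      rw [inv_pow, ← pow_mul, mul_comm, pow_mul, ξ_three_pow_three]; simp
    have h00 : toVec (nine 0 0) ∈ Γ := by
      have := mul_mem ht (hall Γ hω a b ht h1 _ _ (hpow a) (hpow b))
      convert this using 1
      rw [toVec_nine, toVec_nine]
      funext i
      fin_cases i <;> simp [tail]
    refine le_antisymm (fun d hd => ?_) (modelGroup_le hω ?_)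
    · obtain ⟨m, x, y, hxy, rfl⟩ := nine_decompose hΓ h00 hd
      obtain ⟨hx, hy⟩ := hcube x y hxy
      refine mul_mem (zpow_mem (toVec_mem_modelGroup (by simp)) m) ?_
      refine hall _ (ones_mem_modelGroup _) 0 0 (toVec_mem_modelGroup (by simp)) ?_ x y hx hy
      rw [← hξ]
      exact toVec_mem_modelGroup (by simp)
    · simp only [List.mem_cons, List.not_mem_nil, or_false, forall_eq_or_imp, forall_eq]
      exact ⟨h00, hξ ▸ h1⟩
  · left
    push Not at h
    refine le_antisymm (fun d hd => ?_) (modelGroup_le hω (by simpa using ht))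
    obtain ⟨m, x, y, hxy, rfl⟩ := nine_decompose hΓ ht hd
    refine mul_mem (zpow_mem (toVec_mem_modelGroup (by simp)) m) ?_
    rw [h x y hxy]
    exact tail_mem_model_of_cube (a := a) (b := b) (by simp) (hcube x y hxy).2

/-- The normal forms of the groups with an element of order nine in one coordinate. -/
def nineRows : List (List (ℕ × List ℕ)) :=
  [[nine 0 0], [nine 0 1], [nine 0 2], [nine 1 1], [nine 1 2], [nine 2 2],
   [nine 0 0, (2, [0, 0, 0, 1, 0])], [nine 1 1, (2, [0, 0, 0, 1, 0])],
   [nine 2 2, (2, [0, 0, 0, 1, 0])], [nine 0 0, (3, [0, 0, 0, 1, 0])]]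

lemma exists_nine_of_mem {Γ : Subgroup (Fin 5 → ℂˣ)} (hΓ : Good (Inv Γ))
    (hω : vec ones ∈ expLattice 3 Γ) {a b : ℕ} (ha : a < 3) (hb : b < 3)
    (ht : toVec (nine a b) ∈ Γ) :
    ∃ σ : Equiv.Perm (Fin 5), ∃ row ∈ nineRows, permGroup σ Γ = modelGroup row := by
  have hΓ' := hΓ.permGroup (Equiv.swap 3 4)
  have hω' := ones_mem_permGroup hω (Equiv.swap 3 4)
  set Γ' := permGroup (Equiv.swap 3 4) Γ with hΓ'_def
  have ht' : toVec (nine b a) ∈ Γ' := by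
    rw [hΓ'_def, mem_permGroup, toVec_nine_comp_swap]; exact ht
  have htail : ∀ {u v}, tail v u ∈ Γ' ↔ tail u v ∈ Γ := fun {u v} => by
    rw [hΓ'_def, mem_permGroup, tail_comp_swap]
  have hg : vec [1, 7, 4, 3 * a, 3 * b] ∈ expLattice 9 Γ := ht
  have hinv : ∀ {i j k}, Inv Γ i j k → Inv Γ' (Equiv.swap 3 4 i) (Equiv.swap 3 4 j)
      (Equiv.swap 3 4 k) := fun h d hd => h _ hd
  obtain ⟨j, hj⟩ := hΓ.exists_next 3
  obtain ⟨k, hk⟩ := hΓ.exists_next 4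
  have hj34 : j = 3 ∨ j = 4 := by
    have h := hj.dvd (by norm_num) hg
    fin_cases j <;> simp [vec, entry] at h ⊢ <;> omega
  have hk34 : k = 3 ∨ k = 4 := by
    have h := hk.dvd (by norm_num) hg
    fin_cases k <;> simp [vec, entry] at h ⊢ <;> omega
  have hmem : ∀ a < 3, [nine a a, (2, [0, 0, 0, 1, 0])] ∈ nineRows := by decide
  by_cases hcube : ∀ u v, tail u v ∈ Γ → u ^ 3 = 1 ∧ v ^ 3 = 1
  · rcases le_total a b with hab | hab
    · have hmem' : ∀ a b : Fin 3, (a : ℕ) ≤ b → [nine a b] ∈ nineRows := by decide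
      rcases nine_three hΓ hω ht hcube with h | h
      · exact ⟨1, _, hmem' ⟨a, ha⟩ ⟨b, hb⟩ hab, h⟩
      · exact ⟨1, _, by decide, h⟩
    · have hmem' : ∀ a b : Fin 3, (b : ℕ) ≤ a → [nine b a] ∈ nineRows := by decide
      rcases nine_three hΓ' hω' ht' (fun u v h => (hcube v u (htail.1 h)).symm) with h | h
      · exact ⟨_, _, hmem' ⟨a, ha⟩ ⟨b, hb⟩ hab, h⟩
      · exact ⟨_, _, by decide, h⟩
  · push Not at hcube
    obtain ⟨u, v, huv, hne⟩ := hcube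
    have hc3 : ∀ {x : ℂˣ}, x * x * x = 1 → x ^ 3 = 1 := fun h => by rw [pow_succ, sq, h]
    have hswap : u * u * v = 1 → v * v * u = 1 → u ^ 3 = 1 ∧ v ^ 3 = 1 := by
      intro h1 h2
      have h3 : v = (u * u)⁻¹ := (inv_eq_of_mul_eq_one_right h1).symm
      have hu3 : u ^ 3 = 1 := by
        rw [h3] at h2
        have : (u * u)⁻¹ * (u * u)⁻¹ * u = (u ^ 3)⁻¹ := by group
        rwa [this, inv_eq_one] at h2
      refine ⟨hu3, ?_⟩
      rw [h3, inv_pow, mul_pow, hu3]; simp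
    rcases hj34 with rfl | rfl <;> rcases hk34 with rfl | rfl
    · -- `u³ = 1`, `v²u = 1`
      have hu : u ^ 3 = 1 := hc3 (hj _ huv)
      obtain ⟨c, hc, h⟩ := nine_two hΓ' hω' hb ha ht' (hinv hk) (hinv hj) (htail.2 huv) (hne hu)
      exact ⟨_, _, hmem c hc, h⟩
    · exact absurd (hc3 (hk _ huv)) (hne (hc3 (hj _ huv)))
    · have h := hswap (hj _ huv) (hk _ huv)
      exact absurd h.2 (hne h.1)
    · have hv : v ^ 3 = 1 := hc3 (hk _ huv)
      obtain ⟨c, hc, h⟩ := nine_two hΓ hω ha hb ht hj hk huv (fun h => hne h hv)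
      exact ⟨1, _, hmem c hc, h⟩

/-- A loop through three variables carries the element of order nine; its exponents at the other two
variables have to be multiples of three, because the invariant monomials form a good set. -/
theorem exists_nine {Γ : Subgroup (Fin 5 → ℂˣ)} (hΓ : Good (Inv Γ))
    (hω : vec ones ∈ expLattice 3 Γ) {e : Fin 5 → ℤ} (he : e ∈ expLattice 9 Γ) {i : Fin 5}
    (hi : ¬ (3 : ℤ) ∣ e i) :
    ∃ σ : Equiv.Perm (Fin 5), ∃ row ∈ nineRows, permGroup σ Γ = modelGroup row := by
  have hcop : IsCoprime (e i) (9 : ℕ) := by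
    have : IsCoprime (e i) ((3 : ℕ) ^ 2 : ℤ) := IsCoprime.pow_right
      (((Nat.prime_iff_prime_int.1 (by norm_num : Nat.Prime 3)).coprime_iff_not_dvd).2 hi).symm
    exact_mod_cast this
  obtain ⟨σ, e', he', hval⟩ := exists_chain hΓ (by norm_num) 3 (by decide) he hcop
  replace hΓ := hΓ.permGroup σ
  replace hω := ones_mem_permGroup hω σ
  obtain ⟨hc, hlt⟩ := cong_emod (n := 9) (by norm_num) e'
  have h1 := (hc.mem (self_smul_mem_expLattice (by norm_num) _)).1 he'
  have h3 := hlt 3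
  have h4 := hlt 4
  rw [hval 0 (by decide), hval 1 (by decide), hval 2 (by decide)] at h1
  generalize (e' 3 % (9 : ℕ)).toNat = c at h1 h3
  generalize (e' 4 % (9 : ℕ)).toNat = c' at h1 h4
  replace h1 : vec [1, 7, 4, c, c'] ∈ expLattice 9 (permGroup σ Γ) := h1
  have hcheck : ∀ c < 9, ∀ c' < 9, goodb (monomials.filter (invariantb 9 [1, 7, 4, c, c'])) = true →
      c % 3 = 0 ∧ c' % 3 = 0 := by
    decide +kernel
  obtain ⟨hc3, hc3'⟩ := hcheck c h3 c' h4 (goodb_of_mem hΓ (by norm_num) h1)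
  obtain ⟨a, rfl⟩ : ∃ a, c = 3 * a := ⟨c / 3, by omega⟩
  obtain ⟨b, rfl⟩ : ∃ b, c' = 3 * b := ⟨c' / 3, by omega⟩
  obtain ⟨τ, row, hrow, h⟩ := exists_nine_of_mem (a := a) (b := b) hΓ hω (by omega) (by omega) h1
  exact ⟨τ * σ, row, hrow, h⟩

/-! ### Comparison with the table -/

/-- Normal forms of the nontrivial groups, each generator being given by its order `n` and its
exponents as a vector of powers of `ξ n`. -/
def rows : List (List (ℕ × List ℕ)) :=
  [[(2, [1, 0, 0, 0, 0])], [(2, [1, 1, 0, 0, 0])], [(3, [0, 0, 0, 1, 0])],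
   [(3, [0, 0, 0, 1, 1])], [(3, [0, 0, 0, 1, 2])], [(3, [0, 0, 1, 1, 2])],
   [(4, [1, 2, 0, 0, 0])], [(4, [1, 2, 0, 2, 0])], [(4, [1, 2, 0, 3, 0])],
   [(2, [1, 0, 0, 0, 0]), (2, [0, 0, 1, 0, 0])], [(2, [1, 1, 0, 0, 0]), (2, [0, 1, 1, 0, 0])],
   [(5, [1, 3, 4, 2, 0])], [(2, [1, 0, 1, 0, 0]), (3, [0, 0, 0, 1, 0])],
   [(2, [1, 0, 1, 0, 0]), (3, [0, 0, 1, 1, 0])], [(2, [1, 0, 1, 0, 0]), (3, [0, 0, 1, 1, 2])],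
   [(2, [1, 0, 0, 0, 0]), (3, [0, 0, 1, 0, 0])], [(2, [1, 0, 0, 0, 0]), (3, [0, 0, 1, 0, 1])],
   [(2, [1, 0, 0, 0, 0]), (3, [0, 0, 1, 0, 2])], [(2, [1, 0, 0, 0, 0]), (3, [0, 0, 1, 1, 1])],
   [(2, [1, 0, 0, 0, 0]), (3, [0, 0, 1, 1, 2])], [(8, [1, 6, 4, 0, 0])], [(8, [1, 6, 4, 0, 2])],
   [(4, [1, 2, 0, 0, 0]), (2, [0, 0, 0, 1, 0])], [(9, [1, 7, 4, 0, 0])], [(9, [1, 7, 4, 0, 3])],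
   [(9, [1, 7, 4, 0, 6])], [(9, [1, 7, 4, 3, 3])], [(9, [1, 7, 4, 3, 6])],
   [(9, [1, 7, 4, 6, 6])], [(3, [0, 1, 0, 0, 0]), (3, [0, 0, 1, 0, 0])],
   [(3, [0, 1, 0, 0, 0]), (3, [0, 0, 1, 0, 1])], [(3, [0, 1, 0, 0, 0]), (3, [0, 0, 1, 0, 2])],
   [(3, [0, 1, 0, 0, 1]), (3, [0, 0, 1, 0, 1])], [(3, [0, 1, 0, 0, 1]), (3, [0, 0, 1, 2, 2])],
   [(3, [0, 1, 0, 0, 2]), (3, [0, 0, 1, 0, 2])], [(3, [0, 1, 0, 0, 2]), (3, [0, 0, 1, 2, 2])],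
   [(11, [1, 9, 4, 3, 5])], [(4, [1, 2, 0, 0, 0]), (3, [0, 0, 0, 1, 0])],
   [(4, [1, 2, 0, 0, 0]), (3, [0, 0, 0, 1, 1])], [(4, [1, 2, 0, 0, 0]), (3, [0, 0, 0, 1, 2])],
   [(4, [1, 2, 0, 0, 2]), (3, [0, 0, 0, 1, 1])], [(4, [1, 2, 0, 0, 3]), (3, [0, 0, 0, 1, 0])],
   [(2, [1, 0, 0, 0, 0]), (2, [0, 0, 1, 0, 0]), (3, [0, 0, 1, 1, 0])],
   [(2, [1, 0, 0, 0, 0]), (2, [0, 0, 1, 0, 0]), (3, [0, 0, 1, 1, 2])],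
   [(2, [1, 0, 0, 0, 0]), (2, [0, 0, 1, 0, 0]), (3, [0, 0, 0, 1, 0])],
   [(2, [1, 0, 0, 0, 1]), (2, [0, 0, 1, 0, 1]), (3, [0, 0, 0, 1, 0])],
   [(5, [1, 3, 4, 2, 0]), (3, [0, 0, 0, 0, 1])], [(16, [1, 14, 4, 8, 0])],
   [(9, [1, 7, 4, 0, 0]), (2, [0, 0, 0, 1, 0])], [(9, [1, 7, 4, 3, 3]), (2, [0, 0, 0, 1, 0])],
   [(9, [1, 7, 4, 6, 6]), (2, [0, 0, 0, 1, 0])],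
   [(2, [1, 0, 0, 0, 0]), (3, [0, 0, 1, 0, 0]), (3, [0, 0, 0, 1, 0])],
   [(2, [1, 0, 0, 0, 0]), (3, [0, 0, 1, 0, 0]), (3, [0, 0, 0, 1, 1])],
   [(2, [1, 0, 0, 0, 0]), (3, [0, 0, 1, 0, 0]), (3, [0, 0, 0, 1, 2])],
   [(2, [1, 0, 0, 0, 0]), (3, [0, 0, 1, 0, 1]), (3, [0, 0, 0, 1, 1])],
   [(2, [1, 0, 0, 0, 0]), (3, [0, 0, 1, 0, 2]), (3, [0, 0, 0, 1, 2])],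
   [(2, [1, 0, 0, 0, 1]), (3, [0, 0, 1, 0, 0]), (3, [0, 0, 0, 1, 1])],
   [(8, [1, 6, 4, 0, 0]), (3, [0, 0, 0, 0, 1])],
   [(4, [1, 2, 0, 0, 0]), (2, [0, 0, 0, 1, 0]), (3, [0, 0, 0, 1, 1])],
   [(9, [1, 7, 4, 0, 0]), (3, [0, 0, 0, 1, 0])],
   [(3, [0, 1, 0, 0, 0]), (3, [0, 0, 1, 0, 0]), (3, [0, 0, 0, 1, 0])],
   [(3, [0, 1, 0, 0, 0]), (3, [0, 0, 1, 0, 0]), (3, [0, 0, 0, 1, 2])],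
   [(3, [0, 1, 0, 0, 0]), (3, [0, 0, 1, 0, 1]), (3, [0, 0, 0, 1, 1])],
   [(3, [0, 1, 0, 0, 1]), (3, [0, 0, 1, 0, 1]), (3, [0, 0, 0, 1, 1])],
   [(4, [1, 2, 0, 0, 0]), (3, [0, 0, 0, 1, 0]), (3, [0, 0, 0, 0, 1])],
   [(2, [1, 0, 0, 0, 0]), (2, [0, 1, 0, 0, 0]), (3, [0, 1, 0, 1, 0]), (3, [0, 0, 0, 0, 1])],
   [(2, [1, 0, 0, 0, 0]), (3, [0, 0, 1, 0, 0]), (3, [0, 0, 0, 1, 0]), (3, [0, 0, 0, 0, 1])],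
   [(3, [0, 1, 0, 0, 0]), (3, [0, 0, 1, 0, 0]), (3, [0, 0, 0, 1, 0]), (3, [0, 0, 0, 0, 1])]]

/-- The groups found by the search are those of `rows`, up to permutations. -/
lemma rowOf_mem_rows : ∀ kR ∈ groups, ∀ r ∈ kR.2, rowOf kR.1 r = [] ∨
    ∃ p ∈ perms, permuteRow p (rowOf kR.1 r) ∈ rows := by
  decide +kernel

lemma mem_rows : (∀ row ∈ nineRows, row ∈ rows) ∧ [(11, [1, 9, 4, 3, 5])] ∈ rows ∧
    [(5, [1, 3, 4, 2, 0])] ∈ rows ∧ [(5, [1, 3, 4, 2, 0]), (3, [0, 0, 0, 0, 1])] ∈ rows := by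
  decide +kernel

/-- Up to a permutation of the coordinates, `Γ` is one of the model groups. -/
theorem exists_eq_modelGroup {Γ : Subgroup (Fin 5 → ℂˣ)} (hΓ : Good (Inv Γ))
    (hω : vec ones ∈ expLattice 3 Γ) :
    ∃ σ : Equiv.Perm (Fin 5), ∃ row, (row = [] ∨ row ∈ rows) ∧
      permGroup σ Γ = modelGroup row := by
  by_cases h11 : ∀ e ∈ expLattice 11 Γ, ∀ i, (11 : ℤ) ∣ e i
  · by_cases h5 : ∀ e ∈ expLattice 5 Γ, ∀ i, (5 : ℤ) ∣ e i
    · by_cases h9 : ∀ e ∈ expLattice 9 Γ, ∀ i, (3 : ℤ) ∣ e i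
      · obtain ⟨σ, kR, hkR, r, hr, h⟩ := exists_eq_modelGroup_of_pow hΓ hω
          fun d hd => pow_eq_one_of_no_element hΓ h11 h5 h9 hd
        rcases rowOf_mem_rows kR hkR r hr with h0 | ⟨p, hp, hmem⟩
        · exact ⟨σ, _, Or.inl h0, h⟩
        · obtain ⟨τ, hτ⟩ := exists_perm hp
          refine ⟨τ⁻¹ * σ, _, Or.inr hmem, ?_⟩
          rw [← permGroup_permGroup, h, permGroup_modelGroup hτ]
      · push Not at h9
        obtain ⟨e, he, i, hi⟩ := h9
        obtain ⟨σ, row, hrow, h⟩ := exists_nine hΓ hω he hi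
        exact ⟨σ, row, Or.inr (mem_rows.1 row hrow), h⟩
    · push Not at h5
      obtain ⟨e, he, i, hi⟩ := h5
      obtain ⟨σ, h | h⟩ := exists_five hΓ hω he hi
      · exact ⟨σ, _, Or.inr mem_rows.2.2.1, h⟩
      · exact ⟨σ, _, Or.inr mem_rows.2.2.2, h⟩
  · push Not at h11
    obtain ⟨e, he, i, hi⟩ := h11
    obtain ⟨σ, h⟩ := exists_eleven hΓ hω he hi
    exact ⟨σ, _, Or.inr mem_rows.2.1, h⟩

lemma toVec_eq (n a b c d e : ℕ) :
    toVec (n, [a, b, c, d, e]) = ![ξ n ^ a, ξ n ^ b, ξ n ^ c, ξ n ^ d, ξ n ^ e] := by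
  funext i
  fin_cases i <;> exact zpow_natCast (ξ n) _

lemma ξ_pow_eq_neg_one (n : ℕ) (hn : n ≠ 0) : ξ (2 * n) ^ n = -1 := by
  have := ξ_zpow_eq_zpow (m := 2 * n) (n := 2) (a := n) (b := 1) (by omega) (by norm_num)
    (by push_cast; ring)
  rwa [zpow_one, ξ_two, zpow_natCast] at this

lemma ξ_four_pow_two : ξ 4 ^ 2 = -1 := ξ_pow_eq_neg_one 2 (by norm_num)

lemma ξ_eight_pow_four : ξ 8 ^ 4 = -1 := ξ_pow_eq_neg_one 4 (by norm_num)

lemma ξ_sixteen_pow_eight : ξ 16 ^ 8 = -1 := ξ_pow_eq_neg_one 8 (by norm_num)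

lemma ξ_sixteen_pow_fourteen : ξ 16 ^ 14 = ξ 16 ^ (-2 : ℤ) := by
  rw [← zpow_natCast]
  exact ξ_zpow_congr (by norm_num) (by norm_num)

lemma ξ_nine_pow_six : ξ 9 ^ 6 = ξ 3 ^ 2 := by
  rw [← ξ_nine_pow_three, ← pow_mul]

/-- The model groups are those of the table. -/
theorem exists_table : ∀ row ∈ rows, ∃ u, Table (row.map Prod.fst) (row.map toVec) u := by
  simp only [rows, List.forall_mem_cons, List.not_mem_nil, IsEmpty.forall_iff, implies_true,
    and_true, List.map_cons, List.map_nil, toVec_eq, pow_zero, pow_one, ξ_two, ξ_four_pow_two,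
    ξ_eight_pow_four, ξ_sixteen_pow_eight, ξ_sixteen_pow_fourteen, ξ_nine_pow_three, ξ_nine_pow_six]
  refine ⟨⟨_, by simpa using Table.row1 0 (by simp)⟩, ⟨_, by simpa using Table.row1 1 (by simp)⟩,
    ⟨_, by simpa using Table.row2 0 (by simp)⟩, ⟨_, by simpa using Table.row2 1 (by simp)⟩,
    ⟨_, by simpa using Table.row2 2 (by simp)⟩, ⟨_, by simpa using Table.row3⟩,
    ⟨_, by simpa using Table.row4 0 (by simp)⟩,
    ⟨_, by simpa [ξ_four_pow_two] using Table.row4 2 (by simp)⟩,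
    ⟨_, by simpa using Table.row4 3 (by simp)⟩, ⟨_, by simpa using Table.row5 0 (by simp)⟩,
    ⟨_, by simpa using Table.row5 1 (by simp)⟩, ⟨_, by simpa using Table.row6⟩,
    ⟨_, by simpa using Table.row7⟩, ⟨_, by simpa using Table.row8 0 (by simp)⟩,
    ⟨_, by simpa using Table.row8 2 (by simp)⟩,
    ⟨_, by simpa using Table.row9 0 0 (by simp) (by simp)⟩,
    ⟨_, by simpa using Table.row9 0 1 (by simp) (by simp)⟩,
    ⟨_, by simpa using Table.row9 0 2 (by simp) (by simp)⟩,
    ⟨_, by simpa using Table.row9 1 1 (by simp) (by simp)⟩,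
    ⟨_, by simpa using Table.row9 1 2 (by simp) (by simp)⟩,
    ⟨_, by simpa using Table.row10 0 (by simp)⟩, ⟨_, by simpa using Table.row10 2 (by simp)⟩,
    ⟨_, by simpa using Table.row11⟩, ⟨_, by simpa using Table.row12 0 0 (by simp) (by simp)⟩,
    ⟨_, by simpa using Table.row12 0 1 (by simp) (by simp)⟩,
    ⟨_, by simpa using Table.row12 0 2 (by simp) (by simp)⟩,
    ⟨_, by simpa using Table.row12 1 1 (by simp) (by simp)⟩,
    ⟨_, by simpa using Table.row12 1 2 (by simp) (by simp)⟩,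
    ⟨_, by simpa using Table.row12 2 2 (by simp) (by simp)⟩,
    ⟨_, by simpa using Table.row13 0 0 0 0 (by simp) (by simp) (by simp) (by simp)⟩,
    ⟨_, by simpa using Table.row13 0 0 0 1 (by simp) (by simp) (by simp) (by simp)⟩,
    ⟨_, by simpa using Table.row13 0 0 0 2 (by simp) (by simp) (by simp) (by simp)⟩,
    ⟨_, by simpa using Table.row13 0 1 0 1 (by simp) (by simp) (by simp) (by simp)⟩,
    ⟨_, by simpa using Table.row13 0 1 2 2 (by simp) (by simp) (by simp) (by simp)⟩,
    ⟨_, by simpa using Table.row13 0 2 0 2 (by simp) (by simp) (by simp) (by simp)⟩,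
    ⟨_, by simpa using Table.row13 0 2 2 2 (by simp) (by simp) (by simp) (by simp)⟩,
    ⟨_, by simpa using Table.row14⟩, ⟨_, by simpa using Table.row15 0 (by simp)⟩,
    ⟨_, by simpa using Table.row15 1 (by simp)⟩, ⟨_, by simpa using Table.row15 2 (by simp)⟩,
    ⟨_, by simpa using Table.row16⟩, ⟨_, by simpa using Table.row17⟩,
    ⟨_, by simpa using Table.row18 0 (by simp)⟩, ⟨_, by simpa using Table.row18 2 (by simp)⟩,
    ⟨_, by simpa using Table.row19 0 (by simp)⟩, ⟨_, by simpa using Table.row19 1 (by simp)⟩,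
    ⟨_, by simpa using Table.row20⟩, ⟨_, by simpa using Table.row21⟩,
    ⟨_, by simpa using Table.row22 0 (by simp)⟩, ⟨_, by simpa using Table.row22 1 (by simp)⟩,
    ⟨_, by simpa using Table.row22 2 (by simp)⟩, ⟨_, by simpa using Table.row23 0 (by simp)⟩,
    ⟨_, by simpa using Table.row23 1 (by simp)⟩, ⟨_, by simpa using Table.row23 2 (by simp)⟩,
    ⟨_, by simpa using Table.row24 1 (by simp)⟩, ⟨_, by simpa using Table.row24 2 (by simp)⟩,
    ⟨_, by simpa using Table.row25⟩, ⟨_, by simpa using Table.row26⟩,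
    ⟨_, by simpa using Table.row27⟩, ⟨_, by simpa using Table.row28 0 0 (by simp) (by simp)⟩,
    ⟨_, by simpa using Table.row29 0 0 0 (by simp) (by simp) (by simp)⟩,
    ⟨_, by simpa using Table.row29 0 0 2 (by simp) (by simp) (by simp)⟩,
    ⟨_, by simpa using Table.row29 0 1 1 (by simp) (by simp) (by simp)⟩,
    ⟨_, by simpa using Table.row29 1 1 1 (by simp) (by simp) (by simp)⟩,
    ⟨_, by simpa using Table.row30⟩, ⟨_, by simpa using Table.row31⟩,
    ⟨_, by simpa using Table.row32⟩, ⟨_, by simpa using Table.row33⟩⟩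

/-! ### Products of cyclic groups -/

/-- Splitting off the first factor of a product of cyclic groups. -/
def prodCyclicCons (n : ℕ) (ns : List ℕ) :
    ProdCyclic (n :: ns) ≃* Multiplicative (ZMod n) × ProdCyclic ns where
  toFun x := (x 0, fun i => x i.succ)
  invFun p := Fin.cons (α := fun i => Multiplicative (ZMod ((n :: ns).get i))) p.1 p.2
  left_inv x := Fin.cons_self_tail (α := fun i => Multiplicative (ZMod ((n :: ns).get i))) x
  right_inv _ := rfl
  map_mul' _ _ := rfl

lemma prodCyclic_congr_cons (n : ℕ) {ns ms : List ℕ} (h : Nonempty (ProdCyclic ns ≃* ProdCyclic ms)) :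
    Nonempty (ProdCyclic (n :: ns) ≃* ProdCyclic (n :: ms)) := by
  obtain ⟨f⟩ := h
  exact ⟨(prodCyclicCons n ns).trans (((MulEquiv.refl _).prodCongr f).trans
    (prodCyclicCons n ms).symm)⟩

lemma prodCyclic_perm {ns ms : List ℕ} (h : ns.Perm ms) :
    Nonempty (ProdCyclic ns ≃* ProdCyclic ms) := by
  induction h with
  | nil => exact ⟨MulEquiv.refl _⟩
  | cons n _ ih => exact prodCyclic_congr_cons n ih
  | swap m n l =>
    refine ⟨(prodCyclicCons n (m :: l)).trans (MulEquiv.trans ?_ (prodCyclicCons m (n :: l)).symm)⟩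
    exact ((MulEquiv.refl _).prodCongr (prodCyclicCons m l)).trans
      ((MulEquiv.prodAssoc.symm.trans (MulEquiv.prodComm.prodCongr (MulEquiv.refl _))).trans
        (MulEquiv.prodAssoc.trans ((MulEquiv.refl _).prodCongr (prodCyclicCons n l).symm)))
  | trans _ _ ih₁ ih₂ =>
    obtain ⟨f⟩ := ih₁
    obtain ⟨g⟩ := ih₂
    exact ⟨f.trans g⟩

/-- The Chinese remainder theorem. -/
lemma prodCyclic_chinese {m n : ℕ} (h : m.Coprime n) (ns : List ℕ) :
    Nonempty (ProdCyclic (m :: n :: ns) ≃* ProdCyclic (m * n :: ns)) := by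
  refine ⟨(prodCyclicCons m (n :: ns)).trans (MulEquiv.trans ?_ (prodCyclicCons (m * n) ns).symm)⟩
  let f : Multiplicative (ZMod (m * n)) ≃* Multiplicative (ZMod m) × Multiplicative (ZMod n) :=
    (ZMod.chineseRemainder h).toAddEquiv.toMultiplicative.trans (MulEquiv.prodMultiplicative _ _)
  exact ((MulEquiv.refl _).prodCongr (prodCyclicCons n ns)).trans
    (MulEquiv.prodAssoc.symm.trans (f.symm.prodCongr (MulEquiv.refl _)))

lemma prodCyclic_card (ns : List ℕ) : Nat.card (ProdCyclic ns) = ns.prod := by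
  induction ns with
  | nil =>
    have : Unique (ProdCyclic []) := Pi.uniqueOfIsEmpty (α := Fin 0) _
    exact Nat.card_unique
  | cons n ns ih =>
    rw [Nat.card_congr (prodCyclicCons n ns).toEquiv, Nat.card_prod, ih, List.prod_cons]
    exact congrArg (· * _) (Nat.card_zmod n)

lemma prodCyclic_trans {ns ms ls : List ℕ} (h₁ : Nonempty (ProdCyclic ns ≃* ProdCyclic ms))
    (h₂ : Nonempty (ProdCyclic ms ≃* ProdCyclic ls)) : Nonempty (ProdCyclic ns ≃* ProdCyclic ls) := by
  obtain ⟨f⟩ := h₁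
  obtain ⟨g⟩ := h₂
  exact ⟨f.trans g⟩

/-- All groups of the table are among the 25 groups. -/
lemma exists_abelianType : ∀ row ∈ rows, ∃ ns ∈ abelianTypes,
    Nonempty (ProdCyclic (row.map Prod.fst) ≃* ProdCyclic ns) := by
  have key : ∀ row ∈ rows, row.map Prod.fst ∈ abelianTypes ∨ row.map Prod.fst ∈
      [[2, 3], [4, 3], [2, 2, 3], [5, 3], [9, 2], [2, 3, 3], [8, 3], [4, 2, 3], [4, 3, 3],
        [2, 2, 3, 3], [2, 3, 3, 3]] := by decide +kernel
  intro row hrow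
  rcases key row hrow with h | h
  · exact ⟨_, h, ⟨MulEquiv.refl _⟩⟩
  · generalize row.map Prod.fst = ns at h
    clear hrow
    revert ns
    simp only [List.forall_mem_cons, List.not_mem_nil, IsEmpty.forall_iff, implies_true, and_true]
    refine ⟨⟨[6], by decide, prodCyclic_chinese (by norm_num) []⟩,
      ⟨[12], by decide, prodCyclic_chinese (by norm_num) []⟩,
      ⟨[6, 2], by decide, prodCyclic_trans
        (prodCyclic_perm (show [2, 2, 3].Perm [2, 3, 2] by decide))
        (prodCyclic_chinese (m := 2) (n := 3) (by norm_num) [2])⟩,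
      ⟨[15], by decide, prodCyclic_chinese (by norm_num) []⟩,
      ⟨[18], by decide, prodCyclic_chinese (by norm_num) []⟩,
      ⟨[6, 3], by decide, prodCyclic_chinese (by norm_num) [3]⟩,
      ⟨[24], by decide, prodCyclic_chinese (by norm_num) []⟩,
      ⟨[12, 2], by decide, prodCyclic_trans
        (prodCyclic_perm (show [4, 2, 3].Perm [4, 3, 2] by decide))
        (prodCyclic_chinese (m := 4) (n := 3) (by norm_num) [2])⟩,
      ⟨[12, 3], by decide, prodCyclic_chinese (by norm_num) [3]⟩,
      ⟨[6, 6], by decide, prodCyclic_trans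
        (prodCyclic_perm (show [2, 2, 3, 3].Perm [2, 3, 2, 3] by decide))
        (prodCyclic_trans (prodCyclic_chinese (m := 2) (n := 3) (by norm_num) [2, 3])
          (prodCyclic_trans (prodCyclic_perm (show [6, 2, 3].Perm [2, 3, 6] by decide))
            (prodCyclic_chinese (m := 2) (n := 3) (by norm_num) [6])))⟩,
      ⟨[6, 3, 3], by decide, prodCyclic_chinese (by norm_num) [3, 3]⟩⟩

/-! ### The model groups as products of cyclic groups -/

/-- The homomorphism from a cyclic group given by the image of the generator. -/
def powHom {M : Type*} [CommGroup M] (n : ℕ) (d : M) (h : d ^ n = 1) :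
    Multiplicative (ZMod n) →* M :=
  AddMonoidHom.toMultiplicativeLeft (ZMod.lift n ⟨zmultiplesHom (Additive M) (Additive.ofMul d), by
    simp only [zmultiplesHom_apply, natCast_zsmul]
    exact congrArg Additive.ofMul h⟩)

lemma powHom_ofAdd {M : Type*} [CommGroup M] {n : ℕ} {d : M} (h : d ^ n = 1) (k : ℤ) :
    powHom n d h (Multiplicative.ofAdd (k : ZMod n)) = d ^ k := by
  simp only [powHom]
  show Additive.toMul (ZMod.lift n _ (k : ZMod n)) = _
  rw [ZMod.lift_coe]
  rfl

lemma toVec_pow_self {g : ℕ × List ℕ} (hg : g.1 ≠ 0) : toVec g ^ g.1 = 1 := by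
  funext i
  simp only [toVec, expVec, Pi.pow_apply, Pi.one_apply]
  rw [← zpow_natCast, ← zpow_mul, ξ_zpow_eq_one hg]
  exact dvd_mul_left _ _

/-- The homomorphism from a product of cyclic groups to the diagonal matrices, given by a row. -/
def rowHom : (row : List (ℕ × List ℕ)) → (ProdCyclic (row.map Prod.fst) →* (Fin 5 → ℂˣ))
  | [] => 1
  | g :: row => ((if hg : g.1 = 0 then 1 else powHom g.1 (toVec g) (toVec_pow_self hg)).coprod
      (rowHom row)).comp (prodCyclicCons g.1 (row.map Prod.fst)).toMonoidHom

lemma rowHom_cons {g : ℕ × List ℕ} (hg : g.1 ≠ 0) (row : List (ℕ × List ℕ))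
    (a : Multiplicative (ZMod g.1)) (y : ProdCyclic (row.map Prod.fst)) :
    rowHom (g :: row) ((prodCyclicCons g.1 (row.map Prod.fst)).symm (a, y)) =
      powHom g.1 (toVec g) (toVec_pow_self hg) a * rowHom row y := by
  rw [rowHom, dif_neg hg]
  rfl

lemma mem_range_rowHom {row : List (ℕ × List ℕ)} (hrow : ∀ g ∈ row, g.1 ≠ 0) {d : Fin 5 → ℂˣ} :
    d ∈ (rowHom row).range ↔ d ∈ Subgroup.closure {d | ∃ g ∈ row, d = toVec g} := by
  constructor
  · rintro ⟨x, rfl⟩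
    induction row with
    | nil => exact one_mem _
    | cons g row ih =>
      obtain ⟨⟨a, y⟩, rfl⟩ := (prodCyclicCons g.1 (row.map Prod.fst)).symm.surjective x
      obtain ⟨k, hk⟩ := ZMod.intCast_surjective (Multiplicative.toAdd a)
      obtain rfl : a = Multiplicative.ofAdd (k : ZMod g.1) := by rw [hk]; rfl
      rw [rowHom_cons (hrow g List.mem_cons_self), powHom_ofAdd]
      have hmem : toVec g ∈ Subgroup.closure {d | ∃ g' ∈ g :: row, d = toVec g'} :=
        Subgroup.subset_closure ⟨g, List.mem_cons_self, rfl⟩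
      refine mul_mem (zpow_mem hmem k) ?_
      refine Subgroup.closure_mono ?_ (ih (fun g' h => hrow g' (List.mem_cons_of_mem _ h)) y)
      rintro _ ⟨g', hg', rfl⟩
      exact ⟨g', List.mem_cons_of_mem _ hg', rfl⟩
  · intro hd
    suffices h : ∀ g ∈ row, toVec g ∈ (rowHom row).range by
      refine (Subgroup.closure_le _).2 ?_ hd
      rintro _ ⟨g, hg, rfl⟩
      exact h g hg
    clear hd
    induction row with
    | nil => simp
    | cons g row ih =>
      have hg := hrow g List.mem_cons_self
      intro g' hg'
      rcases List.mem_cons.1 hg' with rfl | hg'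
      · refine ⟨(prodCyclicCons g'.1 (row.map Prod.fst)).symm
          (Multiplicative.ofAdd ((1 : ℤ) : ZMod g'.1), 1), ?_⟩
        rw [rowHom_cons hg, powHom_ofAdd, map_one, mul_one, zpow_one]
      · obtain ⟨y, hy⟩ := ih (fun g' h => hrow g' (List.mem_cons_of_mem _ h)) g' hg'
        refine ⟨(prodCyclicCons g.1 (row.map Prod.fst)).symm (1, y), ?_⟩
        rw [rowHom_cons hg, map_one, one_mul, hy]

/-- All coefficients of elements of a product of cyclic groups, with the corresponding exponents of
`ξ 7920`. -/
def coeffs : List (ℕ × List ℕ) → List (List ℕ × List ℕ)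
  | [] => [([], [0, 0, 0, 0, 0])]
  | g :: row => (List.range g.1).flatMap fun j => (coeffs row).map fun cv =>
      (j :: cv.1, addMul 7920 (j * (7920 / g.1)) cv.2 g.2)

/-- Only trivial coefficients give scalar matrices. -/
def faithfulb (row : List (ℕ × List ℕ)) : Bool :=
  (row.all fun g => !(Nat.beq g.1 0) && Nat.beq (7920 % g.1) 0 && Nat.beq g.2.length 5) &&
  (coeffs row).all fun cv => isZero cv.1 || !(cv.2.all fun x => Nat.beq x (entry cv.2 0))

lemma faithfulb_rows : ∀ row ∈ rows, faithfulb row = true := by decide +kernel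

/-- `coeffs` lists all elements of the product of cyclic groups together with their images. -/
lemma exists_coeffs {row : List (ℕ × List ℕ)}
    (hrow : ∀ g ∈ row, g.1 ≠ 0 ∧ g.1 ∣ 7920 ∧ g.2.length = 5) (x : ProdCyclic (row.map Prod.fst)) :
    ∃ cv ∈ coeffs row, Bounded 7920 cv.2 ∧ rowHom row x = expVec 7920 (vec cv.2) ∧
      (isZero cv.1 = true → x = 1) := by
  induction row with
  | nil =>
    refine ⟨_, List.mem_singleton_self _, ⟨rfl, by simp⟩, ?_, fun _ => ?_⟩
    · rw [vec_eq_zero_of_isZero rfl rfl]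
      funext i
      simp [expVec, rowHom]
    · funext i
      exact i.elim0
  | cons g row ih =>
    obtain ⟨hg0, hgd, hg5⟩ := hrow g List.mem_cons_self
    have : NeZero g.1 := ⟨hg0⟩
    obtain ⟨⟨a, y⟩, rfl⟩ := (prodCyclicCons g.1 (row.map Prod.fst)).symm.surjective x
    obtain ⟨cv, hcv, hb, hy, hz⟩ := ih (fun g' h => hrow g' (List.mem_cons_of_mem _ h)) y
    set j := (Multiplicative.toAdd a).val with hj
    have ha : a = Multiplicative.ofAdd (((j : ℕ) : ℤ) : ZMod g.1) := by
      rw [hj, Int.cast_natCast, ZMod.natCast_zmod_val]; rfl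
    refine ⟨(j :: cv.1, addMul 7920 (j * (7920 / g.1)) cv.2 g.2), List.mem_flatMap.2
      ⟨j, List.mem_range.2 (ZMod.val_lt _), List.mem_map.2 ⟨cv, hcv, rfl⟩⟩,
      addMul_bounded (by norm_num) _ hb.1 hg5, ?_, fun h => ?_⟩
    · rw [rowHom_cons hg0, hy, ha, powHom_ofAdd]
      obtain ⟨z, hz⟩ := cong_addMul 7920 (j * (7920 / g.1)) hb.1 hg5
      simp only
      rw [hz, expVec_add, expVec_add, expVec_self (by norm_num), mul_one, mul_comm]
      congr 1
      rw [toVec, ← expVec_smul]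
      funext i
      refine ξ_zpow_eq_zpow hg0 (by norm_num) ?_
      simp only [Pi.smul_apply, smul_eq_mul]
      obtain ⟨q, hq⟩ := hgd
      rw [hq, Nat.mul_div_cancel_left _ (Nat.pos_of_ne_zero hg0)]
      push_cast
      ring
    · simp only [isZero, List.all_cons, Bool.and_eq_true, Nat.beq_eq] at h
      rw [hz h.2, ha, ← h.1]
      simp only [Nat.cast_zero, Int.cast_zero, ofAdd_zero]
      exact map_one _

lemma row_spec {row : List (ℕ × List ℕ)} (hrow : faithfulb row = true) :
    ∀ g ∈ row, g.1 ≠ 0 ∧ g.1 ∣ 7920 ∧ g.2.length = 5 := by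
  rw [faithfulb, Bool.and_eq_true, List.all_eq_true] at hrow
  intro g hg
  have := hrow.1 g hg
  simp only [Bool.and_eq_true, Bool.not_eq_true', Nat.beq_eq] at this
  refine ⟨fun h => ?_, Nat.dvd_of_mod_eq_zero this.1.2, this.2⟩
  rw [h] at this
  simp at this

/-- No nontrivial element of a model group in the table is scalar. -/
lemma rowHom_eq_const {row : List (ℕ × List ℕ)} (hrow : faithfulb row = true)
    {x : ProdCyclic (row.map Prod.fst)} (hx : ∀ i, rowHom row x i = rowHom row x 0) : x = 1 := by
  obtain ⟨cv, hcv, hb, h, h1⟩ := exists_coeffs (row_spec hrow) x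
  rw [faithfulb, Bool.and_eq_true, List.all_eq_true, List.all_eq_true] at hrow
  have := hrow.2 cv hcv
  rw [Bool.or_eq_true] at this
  refine h1 (this.resolve_right fun h2 => ?_)
  rw [Bool.not_eq_true', ← Bool.not_eq_true, List.all_eq_true] at h2
  refine h2 fun y hy => ?_
  have hall : ∀ i : Fin 5, entry cv.2 i = entry cv.2 0 := fun i => by
    have h3 := hx i
    rw [h] at h3
    simp only [expVec, vec] at h3
    rw [← mul_inv_eq_one, ← zpow_neg, ← zpow_add, ξ_zpow_eq_one (by norm_num)] at h3
    have hlt : ∀ i : Fin 5, entry cv.2 i < 7920 := fun i => by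
      rw [entry, List.getD_eq_getElem _ _ (by rw [hb.1]; exact i.2)]
      exact hb.2 _ (List.getElem_mem _)
    have h5 := hlt i
    have h6 := hlt 0
    simp only [Fin.val_zero] at h3 h6
    omega
  obtain ⟨i, hi, rfl⟩ := List.mem_iff_getElem.1 hy
  have := hall ⟨i, by rw [← hb.1]; exact hi⟩
  rw [entry, List.getD_eq_getElem _ _ hi] at this
  simp [this]

/-! ### Liftings -/

/-- Diagonal matrices in the basis given by the columns of `P`. -/
def conjDiag (P : GL (Fin 5) ℂ) : (Fin 5 → ℂˣ) →* GL (Fin 5) ℂ :=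
  (MulAut.conj P).toMonoidHom.comp diagHom

lemma conjDiag_apply (P : GL (Fin 5) ℂ) (d : Fin 5 → ℂˣ) : conjDiag P d = P * diag d * P⁻¹ := rfl

lemma diagHom_injective : Function.Injective diagHom := by
  intro d e h
  funext i
  have := congrArg (fun A : GL (Fin 5) ℂ => A.val i i) h
  exact Units.ext (by simpa [diagHom, diag] using this)

lemma conjDiag_injective (P : GL (Fin 5) ℂ) : Function.Injective (conjDiag P) :=
  (MulAut.conj P).injective.comp diagHom_injective

lemma scalar_mem_center (u : ℂˣ) :
    Matrix.GeneralLinearGroup.scalar (Fin 5) u ∈ Subgroup.center (GL (Fin 5) ℂ) := by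
  rw [Matrix.GeneralLinearGroup.center_eq_range_scalar]
  exact ⟨u, rfl⟩

lemma conjDiag_const (P : GL (Fin 5) ℂ) (u : ℂˣ) :
    conjDiag P (fun _ => u) = Matrix.GeneralLinearGroup.scalar (Fin 5) u := by
  have h : diag (fun _ => u) = Matrix.GeneralLinearGroup.scalar (Fin 5) u := by
    ext i j
    simp [diag, Matrix.scalar_apply]
  have hc := Subgroup.mem_center_iff.1 (scalar_mem_center u) P
  rw [conjDiag_apply, h, hc, mul_inv_cancel_right]

lemma mk_conjDiag_eq_iff (P : GL (Fin 5) ℂ) {d e : Fin 5 → ℂˣ} :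
    Matrix.ProjGenLinGroup.mk (conjDiag P d) = Matrix.ProjGenLinGroup.mk (conjDiag P e) ↔
      ∃ u : ℂˣ, d * (fun _ => u) = e := by
  rw [Matrix.ProjGenLinGroup.mk_eq_mk_iff]
  refine exists_congr fun u => ?_
  rw [← conjDiag_const P u, ← map_mul, (conjDiag_injective P).eq_iff]

/-- The permutation matrix which maps the basis vector `e_(σ i)` to `e_i`. -/
def permGL (σ : Equiv.Perm (Fin 5)) : GL (Fin 5) ℂ where
  val := Matrix.of fun i j => if σ i = j then 1 else 0
  inv := Matrix.of fun i j => if σ j = i then 1 else 0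
  val_inv := by
    ext i j
    simp [Matrix.mul_apply, Matrix.one_apply, eq_comm]
  inv_val := by
    ext i j
    rw [Matrix.mul_apply, ← Equiv.sum_comp σ.symm]
    simp [Matrix.one_apply, eq_comm]

lemma permGL_mul_diag (σ : Equiv.Perm (Fin 5)) (d : Fin 5 → ℂˣ) :
    permGL σ * diag d = diag (d ∘ σ) * permGL σ := by
  ext i j
  simp only [Units.val_mul, permGL, diag, Matrix.mul_diagonal, Matrix.diagonal_mul, Matrix.of_apply,
    Function.comp]
  split_ifs with h
  · rw [h, one_mul, mul_one]
  · simp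

lemma conjDiag_mul_permGL (P : GL (Fin 5) ℂ) (σ : Equiv.Perm (Fin 5)) (d : Fin 5 → ℂˣ) :
    conjDiag (P * permGL σ) d = conjDiag P (d ∘ σ) := by
  rw [conjDiag_apply, conjDiag_apply, mul_assoc P, permGL_mul_diag, mul_inv_rev]
  group

lemma diagLifts_mul_permGL (F : MvPolynomial (Fin 5) ℂ) (G : Subgroup PGL(5, ℂ)) (P : GL (Fin 5) ℂ)
    (σ : Equiv.Perm (Fin 5)) :
    diagLifts F G (P * permGL σ) = permGroup σ (diagLifts F G P) := by
  ext d
  show conjDiag (P * permGL σ) d ∈ liftGroup F G ↔ conjDiag P (d ∘ σ) ∈ liftGroup F G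
  rw [conjDiag_mul_permGL]

/-- The cubic form of `F` in the basis given by the columns of `P`, as a trilinear form. -/
def basisForm (F : MvPolynomial (Fin 5) ℂ) (P : GL (Fin 5) ℂ) (u v w : Fin 5 → ℂ) : ℂ :=
  polar F (P.val.mulVec u) (P.val.mulVec v) (P.val.mulVec w)

lemma basisForm_symTrilinear (F : MvPolynomial (Fin 5) ℂ) (P : GL (Fin 5) ℂ) :
    SymTrilinear (basisForm F P) :=
  (polar_symTrilinear F).comp P.val.mulVecLin

lemma IsSmoothCubic.nonSing_basisForm {F : MvPolynomial (Fin 5) ℂ} (hF : IsSmoothCubic F)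
    (P : GL (Fin 5) ℂ) : NonSing (basisForm F P) :=
  hF.nonSing.comp (Matrix.toLinearEquiv' P.val (Matrix.invertibleOfIsUnitDet _
    ((Matrix.isUnit_iff_isUnit_det _).1 P.isUnit)))

/-- The monomials which occur in an invariant cubic form are invariant. -/
lemma mul_mul_eq_one_of_basisForm_ne_zero {F : MvPolynomial (Fin 5) ℂ} (hF : IsSmoothCubic F) {P : GL (Fin 5) ℂ}
    {d : Fin 5 → ℂˣ} (hd : subst (conjDiag P d) F = F) {i j k : Fin 5}
    (hne : basisForm F P (Pi.single i 1) (Pi.single j 1) (Pi.single k 1) ≠ 0) :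
    d i * d j * d k = 1 := by
  have hL : ∀ i, (conjDiag P d).val.mulVec (P.val.mulVec (Pi.single i 1)) =
      (d i : ℂ) • P.val.mulVec (Pi.single i 1) := by
    intro i
    rw [Matrix.mulVec_mulVec, ← Units.val_mul, conjDiag_apply, inv_mul_cancel_right, Units.val_mul,
      ← Matrix.mulVec_mulVec, diag_mulVec, ← Matrix.mulVec_smul]
    congr 1
    funext j
    by_cases h : j = i
    · subst h; simp
    · simp [h]
  have h := polar_mulVec hF.homogeneous hd (P.val.mulVec (Pi.single i 1))
    (P.val.mulVec (Pi.single j 1)) (P.val.mulVec (Pi.single k 1))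
  rw [hL, hL, hL, (polar_symTrilinear F).smul, (polar_symTrilinear F).smul₂,
    (polar_symTrilinear F).smul₃] at h
  have h1 : ((d i : ℂ) * d j * d k) = 1 := by
    apply mul_right_cancel₀ hne
    unfold basisForm
    linear_combination h
  exact Units.ext (by simpa using h1)

/-- The monomials which occur in a smooth cubic form a good set, and they are invariant. -/
lemma good_diagLifts {F : MvPolynomial (Fin 5) ℂ} (hF : IsSmoothCubic F) (G : Subgroup PGL(5, ℂ))
    (P : GL (Fin 5) ℂ) : Good (Inv (diagLifts F G P)) :=
  ((hF.nonSing_basisForm P).good (basisForm_symTrilinear F P)).mono fun _ _ _ hne _ hd =>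
    mul_mul_eq_one_of_basisForm_ne_zero hF (mem_liftGroup.1 (mem_diagLifts.1 hd)).2 hne

lemma ones_mem_diagLifts {F : MvPolynomial (Fin 5) ℂ} (hF : IsSmoothCubic F) (G : Subgroup PGL(5, ℂ))
    (P : GL (Fin 5) ℂ) : vec ones ∈ expLattice 3 (diagLifts F G P) := by
  rw [mem_expLattice, expVec_ones]
  show conjDiag P (fun _ => ξ 3) ∈ liftGroup F G
  rw [conjDiag_const, mem_liftGroup]
  constructor
  · have : Matrix.ProjGenLinGroup.mk (Matrix.GeneralLinearGroup.scalar (Fin 5) (ξ 3)) = 1 := by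
      rw [Matrix.ProjGenLinGroup.mk_eq_one]
      exact scalar_mem_center _
    rw [this]
    exact one_mem G
  · rw [subst_eq_iff]
    intro v
    have h4 : (Matrix.GeneralLinearGroup.scalar (Fin 5) (ξ 3)).val.mulVec v = (ξ 3 : ℂ) • v := by
      simp [Matrix.scalar_apply, ← Matrix.smul_one_eq_diagonal, Matrix.smul_mulVec]
    rw [h4, eval_smul hF.homogeneous]
    have : (ξ 3 : ℂ) ^ 3 = 1 := by
      rw [← Units.val_pow_eq_pow_val, ξ_three_pow_three, Units.val_one]
    rw [this, one_mul]

/-- In a suitable basis, the group of all lifts preserving `F` is a model group. -/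
theorem exists_basis {F : MvPolynomial (Fin 5) ℂ} (hF : IsSmoothCubic F) {G : Subgroup PGL(5, ℂ)}
    (hcomm : ∀ g ∈ G, ∀ h ∈ G, g * h = h * g) :
    ∃ P : GL (Fin 5) ℂ, ∃ row, (row = [] ∨ row ∈ rows) ∧ diagLifts F G P = modelGroup row ∧
      ∀ A ∈ liftGroup F G, ∃ d, A = conjDiag P d := by
  obtain ⟨P, hP⟩ := exists_diagonalization hF hcomm
  obtain ⟨σ, row, hrow, h⟩ := exists_eq_modelGroup (good_diagLifts hF G P) (ones_mem_diagLifts hF G P)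
  refine ⟨P * permGL σ, row, hrow, by rw [diagLifts_mul_permGL, h], fun A hA => ?_⟩
  obtain ⟨d, rfl⟩ := hP A hA
  refine ⟨d ∘ σ.symm, ?_⟩
  rw [conjDiag_mul_permGL, conjDiag_apply]
  congr 3
  funext i
  simp

/-- A model group is generated by its row and by scalars. -/
lemma exists_of_mem_modelGroup {row : List (ℕ × List ℕ)} {d : Fin 5 → ℂˣ} (hd : d ∈ modelGroup row) :
    ∃ u : ℂˣ, ∃ e ∈ Subgroup.closure {d | ∃ g ∈ row, d = toVec g}, e * (fun _ => u) = d := by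
  let K : Subgroup (Fin 5 → ℂˣ) :=
    { carrier := {d | ∃ u : ℂˣ, ∃ e ∈ Subgroup.closure {d | ∃ g ∈ row, d = toVec g},
        e * (fun _ => u) = d}
      one_mem' := ⟨1, 1, one_mem _, one_mul _⟩
      mul_mem' := by
        rintro _ _ ⟨u, e, he, rfl⟩ ⟨u', e', he', rfl⟩
        exact ⟨u * u', e * e', mul_mem he he', mul_mul_mul_comm _ _ _ _⟩
      inv_mem' := by
        rintro _ ⟨u, e, he, rfl⟩
        exact ⟨u⁻¹, e⁻¹, inv_mem he, (mul_inv _ _).symm⟩ }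
  refine modelGroup_le (Γ := K) ?_ (fun g hg => ?_) hd
  · exact ⟨ξ 3, 1, one_mem _, by rw [expVec_ones, one_mul]⟩
  · exact ⟨1, _, Subgroup.subset_closure ⟨g, hg, rfl⟩, mul_one _⟩

lemma conj_diagGroup (P : GL (Fin 5) ℂ) (row : List (ℕ × List ℕ)) :
    conj P (diagGroup (row.map toVec)) =
      (Subgroup.closure {d | ∃ g ∈ row, d = toVec g}).map (conjDiag P) := by
  have : diagGroup (row.map toVec) =
      (Subgroup.closure {d | ∃ g ∈ row, d = toVec g}).map diagHom := by
    rw [diagGroup, MonoidHom.map_closure]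
    congr 1
    ext A
    constructor
    · rintro ⟨d, hd, rfl⟩
      obtain ⟨g, hg, rfl⟩ := List.mem_map.1 hd
      exact ⟨_, ⟨g, hg, rfl⟩, rfl⟩
    · rintro ⟨_, ⟨g, hg, rfl⟩, rfl⟩
      exact ⟨_, List.mem_map.2 ⟨g, hg, rfl⟩, rfl⟩
  rw [conj, this, Subgroup.map_map]
  rfl

lemma closure_le_modelGroup (row : List (ℕ × List ℕ)) :
    Subgroup.closure {d | ∃ g ∈ row, d = toVec g} ≤ modelGroup row :=
  Subgroup.closure_mono fun _ h => Or.inr h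

/-- `G` is the image of the group generated by the row, since scalars are trivial in `PGL₅`. -/
lemma map_conjDiag_eq {F : MvPolynomial (Fin 5) ℂ} (hF : IsSmoothCubic F) {G : Subgroup PGL(5, ℂ)}
    (hG : G ≤ aut F) {P : GL (Fin 5) ℂ} {row : List (ℕ × List ℕ)}
    (h : diagLifts F G P = modelGroup row) (hP : ∀ A ∈ liftGroup F G, ∃ d, A = conjDiag P d) :
    (Subgroup.closure {d | ∃ g ∈ row, d = toVec g}).map
      (Matrix.ProjGenLinGroup.mk.comp (conjDiag P)) = G := by
  ext g
  constructor
  · rintro ⟨d, hd, rfl⟩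
    have hd' : d ∈ diagLifts F G P := h ▸ closure_le_modelGroup row hd
    exact (mem_liftGroup.1 (mem_diagLifts.1 hd')).1
  · intro hg
    obtain ⟨A, rfl, hA⟩ := exists_lift hF (hG hg)
    obtain ⟨d, rfl⟩ := hP A ⟨hg, hA⟩
    have hd : d ∈ diagLifts F G P := ⟨hg, hA⟩
    rw [h] at hd
    obtain ⟨u, e, he, hu⟩ := exists_of_mem_modelGroup hd
    exact ⟨e, he, (mk_conjDiag_eq_iff P).2 ⟨u, hu⟩⟩

/-- The group generated by the row contains no nontrivial scalars, so it maps isomorphically onto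
`G`. -/
theorem isFLifting_and_iso {F : MvPolynomial (Fin 5) ℂ} (hF : IsSmoothCubic F)
    {G : Subgroup PGL(5, ℂ)} (hG : G ≤ aut F) {P : GL (Fin 5) ℂ} {row : List (ℕ × List ℕ)}
    (hrow : faithfulb row = true) (h : diagLifts F G P = modelGroup row)
    (hP : ∀ A ∈ liftGroup F G, ∃ d, A = conjDiag P d) :
    IsFLifting F (conj P (diagGroup (row.map toVec))) G ∧
      Nonempty (G ≃* ProdCyclic (row.map Prod.fst)) := by
  have hrange : (rowHom row).range = Subgroup.closure {d | ∃ g ∈ row, d = toVec g} := by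
    ext d
    exact mem_range_rowHom fun g hg => (row_spec hrow g hg).1
  have hmap := map_conjDiag_eq hF hG h hP
  set f : ProdCyclic (row.map Prod.fst) →* PGL(5, ℂ) :=
    (Matrix.ProjGenLinGroup.mk.comp (conjDiag P)).comp (rowHom row) with hf
  have hinj : Function.Injective f := by
    rw [injective_iff_map_eq_one]
    intro x hx
    rw [← map_one (Matrix.ProjGenLinGroup.mk.comp (conjDiag P))] at hx
    obtain ⟨u, hu⟩ := (mk_conjDiag_eq_iff P).1 hx
    refine rowHom_eq_const hrow fun i => ?_
    have h1 := congrFun hu i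
    have h2 := congrFun hu 0
    simp only [Pi.mul_apply, Pi.one_apply] at h1 h2
    exact mul_right_cancel (h1.trans h2.symm)
  have hfr : f.range = G := by
    rw [hf, MonoidHom.range_comp, hrange, hmap]
  refine ⟨⟨?_, ?_, ?_⟩, ⟨(MulEquiv.subgroupCongr hfr).symm.trans (MonoidHom.ofInjective hinj).symm⟩⟩
  · rw [conj_diagGroup, Subgroup.map_map, hmap]
  · rw [conj_diagGroup, ← hrange]
    rintro _ ⟨_, ⟨x, rfl⟩, rfl⟩ _ ⟨_, ⟨y, rfl⟩, rfl⟩ hxy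
    rw [hinj hxy]
  · rw [conj_diagGroup]
    rintro _ ⟨d, hd, rfl⟩
    have hd' : d ∈ diagLifts F G P := h ▸ closure_le_modelGroup row hd
    exact (mem_liftGroup.1 (mem_diagLifts.1 hd')).2

/-- `G` has an `F`-lifting which is conjugate to one of the groups in `rows`. -/
theorem exists_row {F : MvPolynomial (Fin 5) ℂ} (hF : IsSmoothCubic F)
    {G : Subgroup PGL(5, ℂ)} (hG : G ≤ aut F) (hcomm : ∀ g ∈ G, ∀ h ∈ G, g * h = h * g)
    (hne : G ≠ ⊥) : ∃ row ∈ rows, ∃ P : GL (Fin 5) ℂ,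
      IsFLifting F (conj P (diagGroup (row.map toVec))) G ∧
      Nonempty (G ≃* ProdCyclic (row.map Prod.fst)) := by
  obtain ⟨P, row, hrow, h, hP⟩ := exists_basis hF hcomm
  rcases hrow with rfl | hrow
  · refine absurd ?_ hne
    rw [← map_conjDiag_eq hF hG h hP]
    simp
  · exact ⟨row, hrow, P, isFLifting_and_iso hF hG (faithfulb_rows row hrow) h hP⟩

/-! ### Normal forms of cubic forms -/

lemma exists_pow_eq {n : ℕ} (hn : n ≠ 0) (a : ℂ) : ∃ x : ℂ, x ^ n = a :=
  IsAlgClosed.exists_pow_nat_eq a (Nat.pos_of_ne_zero hn)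

/-- A binary cubic with a zero at `(1, 0)` but without double zeros is a sum of two cubes. -/
lemma exists_binary_of_zero {q r s : ℂ} (hq : q ≠ 0) (ht : s - 3 * q * (r / (2 * q)) ^ 2 ≠ 0) :
    ∃ a b c d : ℂ, ∀ x y : ℂ, 3 * q * x ^ 2 * y + 3 * r * x * y ^ 2 + s * y ^ 3 =
      (a * x + b * y) ^ 3 + (c * x + d * y) ^ 3 := by
  -- complete the square, and use `(Ay + Bx)³ + (Ay - Bx)³ = 2A³y³ + 6AB²x²y`
  set k := r / (2 * q) with hk
  have hr : r = 2 * q * k := by rw [hk]; field_simp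
  obtain ⟨A, hA⟩ := exists_pow_eq (n := 3) (by norm_num) ((s - 3 * q * k ^ 2) / 2)
  have hA0 : A ≠ 0 := by
    rintro rfl
    apply ht
    linear_combination (-2) * hA
  obtain ⟨B, hB⟩ := exists_pow_eq (n := 2) (by norm_num) (q / (2 * A))
  have hB' : 2 * A * B ^ 2 = q := by rw [hB]; field_simp
  refine ⟨B, A + B * k, -B, A - B * k, fun x y => ?_⟩
  rw [hr]
  linear_combination (-3 * x ^ 2 * y - 6 * k * x * y ^ 2 - 3 * k ^ 2 * y ^ 3) * hB' - 2 * y ^ 3 * hA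

/-- A binary cubic without multiple zeros is a sum of two cubes. -/
lemma exists_binary {p q r s : ℂ} (h : ∀ x y : ℂ, p * x ^ 2 + 2 * q * x * y + r * y ^ 2 = 0 →
    q * x ^ 2 + 2 * r * x * y + s * y ^ 2 = 0 → x = 0 ∧ y = 0) :
    ∃ a b c d : ℂ, ∀ x y : ℂ, p * x ^ 3 + 3 * q * x ^ 2 * y + 3 * r * x * y ^ 2 + s * y ^ 3 =
      (a * x + b * y) ^ 3 + (c * x + d * y) ^ 3 := by
  have key : ∀ q r s : ℂ, (∀ x y : ℂ, 2 * q * x * y + r * y ^ 2 = 0 →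
      q * x ^ 2 + 2 * r * x * y + s * y ^ 2 = 0 → x = 0 ∧ y = 0) →
      ∃ a b c d : ℂ, ∀ x y : ℂ, 3 * q * x ^ 2 * y + 3 * r * x * y ^ 2 + s * y ^ 3 =
        (a * x + b * y) ^ 3 + (c * x + d * y) ^ 3 := by
    intro q r s h
    have hq : q ≠ 0 := by
      rintro rfl
      exact one_ne_zero (h 1 0 (by ring) (by ring)).1
    refine exists_binary_of_zero hq fun ht => one_ne_zero (h (-(r / (2 * q))) 1 ?_ ?_).2
    · field_simp; ring
    · have hr : r = 2 * q * (r / (2 * q)) := by field_simp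
      generalize r / (2 * q) = k at hr ht
      rw [hr]
      linear_combination ht
  by_cases hp : p = 0
  · subst hp
    obtain ⟨a, b, c, d, hd⟩ := key q r s (fun x y h1 h2 => h x y (by linear_combination h1) h2)
    exact ⟨a, b, c, d, fun x y => by rw [← hd]; ring⟩
  · obtain ⟨ρ, hρ⟩ : ∃ ρ : ℂ, p * ρ ^ 3 + 3 * q * ρ ^ 2 + 3 * r * ρ + s = 0 := by
      obtain ⟨ρ, hρ⟩ := IsAlgClosed.exists_root (Polynomial.C p * Polynomial.X ^ 3 +
        Polynomial.C (3 * q) * Polynomial.X ^ 2 + Polynomial.C (3 * r) * Polynomial.X +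
        Polynomial.C s) (by rw [Polynomial.degree_cubic hp]; norm_num)
      exact ⟨ρ, by simpa [Polynomial.IsRoot] using hρ⟩
    -- move the zero `(ρ, 1)` to `(1, 0)`
    obtain ⟨a, b, c, d, hd⟩ := key (p * ρ ^ 2 + 2 * q * ρ + r) (p * ρ + q) p (fun x y h1 h2 => by
      obtain ⟨h3, h4⟩ := h (y + ρ * x) x (by linear_combination h2)
        (by linear_combination h1 + x ^ 2 * hρ - ρ * h2)
      subst h4
      exact ⟨rfl, by simpa using h3⟩)
    refine ⟨b, a - b * ρ, d, c - d * ρ, fun x y => ?_⟩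
    have := hd y (x - ρ * y)
    linear_combination this + y ^ 3 * hρ

lemma exists_cubeRoot : ∃ ω : ℂ, ω ^ 2 + ω + 1 = 0 := by
  have h := (IsPrimitiveRoot.coe_units_iff.2 (ξ_primitive (n := 3) (by norm_num)))
  refine ⟨ξ 3, ?_⟩
  have := h.geom_sum_eq_zero (by norm_num)
  simp only [Finset.sum_range_succ, Finset.sum_range_zero] at this
  linear_combination this

/-- A loop of length three is a Fermat cubic. It is rescaled to `x²y + y²z + z²x`, which the
discrete Fourier transform on `ℂ³` turns into a sum of three cubes. -/
lemma exists_loop_three {a b c : ℂ} (ha : a ≠ 0) (hb : b ≠ 0) (hc : c ≠ 0) :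
    ∃ A : Fin 3 → Fin 3 → ℂ, ∀ x y z : ℂ, a * x ^ 2 * y + b * y ^ 2 * z + c * z ^ 2 * x =
      (A 0 0 * x + A 0 1 * y + A 0 2 * z) ^ 3 + (A 1 0 * x + A 1 1 * y + A 1 2 * z) ^ 3 +
      (A 2 0 * x + A 2 1 * y + A 2 2 * z) ^ 3 := by
  -- solve `k²l = a`, `l²m = b`, `m²k = c` by eliminating `l` and `m`
  obtain ⟨k, hk⟩ := exists_pow_eq (n := 9) (by norm_num) (c * a ^ 4 / b ^ 2)
  have hk0 : k ≠ 0 := by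
    rintro rfl
    have : c * a ^ 4 / b ^ 2 ≠ 0 := by positivity
    exact this (by rw [← hk]; simp)
  set l := a / k ^ 2 with hl
  set m := b / l ^ 2 with hm
  have hl0 : l ≠ 0 := by positivity
  have h1 : k ^ 2 * l = a := by rw [hl]; field_simp
  have h2 : l ^ 2 * m = b := by rw [hm]; field_simp
  have h3 : m ^ 2 * k = c := by
    rw [hm, hl]
    field_simp
    field_simp at hk
    linear_combination hk
  obtain ⟨ω, hω⟩ := exists_cubeRoot
  obtain ⟨α, hα⟩ := exists_pow_eq (n := 3) (by norm_num) (1 / 9)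
  obtain ⟨β, hβ⟩ := exists_pow_eq (n := 3) (by norm_num) (ω ^ 2 / 9)
  obtain ⟨γ, hγ⟩ := exists_pow_eq (n := 3) (by norm_num) (ω / 9)
  refine ⟨![![α * k, α * l, α * m], ![β * k, β * ω * l, β * ω ^ 2 * m],
    ![γ * k, γ * ω ^ 2 * l, γ * ω * m]], fun x y z => ?_⟩
  simp only [Matrix.cons_val_zero, Matrix.cons_val_one, Matrix.cons_val]
  rw [← h1, ← h2, ← h3]
  have key : ∀ X Y Z : ℂ, X ^ 2 * Y + Y ^ 2 * Z + Z ^ 2 * X = 1 / 9 * (X + Y + Z) ^ 3 +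
      ω ^ 2 / 9 * (X + ω * Y + ω ^ 2 * Z) ^ 3 + ω / 9 * (X + ω ^ 2 * Y + ω * Z) ^ 3 := by
    intro X Y Z
    grind
  have := key (k * x) (l * y) (m * z)
  linear_combination this - (k * x + l * y + m * z) ^ 3 * hα -
    (k * x + ω * (l * y) + ω ^ 2 * (m * z)) ^ 3 * hβ -
    (k * x + ω ^ 2 * (l * y) + ω * (m * z)) ^ 3 * hγ

/-- `(i, j, k)` is, up to order, one of the triples of `S`. -/
def inSupport (S : List (Fin 5 × Fin 5 × Fin 5)) (i j k : Fin 5) : Bool :=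
  S.any fun t => t = (i, j, k) || t = (i, k, j) || t = (j, i, k) || t = (j, k, i) ||
    t = (k, i, j) || t = (k, j, i)

section Support

variable {B : (Fin 5 → ℂ) → (Fin 5 → ℂ) → (Fin 5 → ℂ) → ℂ}

/-- The coefficients of a trilinear form. -/
def coef (B : (Fin 5 → ℂ) → (Fin 5 → ℂ) → (Fin 5 → ℂ) → ℂ) (i j k : Fin 5) : ℂ :=
  B (Pi.single i 1) (Pi.single j 1) (Pi.single k 1)

/-- The only monomials which may occur in the cubic form `B` are those of `S`. -/
def Supported (B : (Fin 5 → ℂ) → (Fin 5 → ℂ) → (Fin 5 → ℂ) → ℂ)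
    (S : List (Fin 5 × Fin 5 × Fin 5)) : Prop :=
  ∀ i j k, inSupport S i j k = false → coef B i j k = 0

lemma SymTrilinear.coef_swap₁₂ (hB : SymTrilinear B) (i j k : Fin 5) :
    coef B i j k = coef B j i k := hB.swap₁₂ _ _ _

lemma SymTrilinear.coef_swap₂₃ (hB : SymTrilinear B) (i j k : Fin 5) :
    coef B i j k = coef B i k j := hB.swap₂₃ _ _ _

set_option maxHeartbeats 1000000 in
lemma SymTrilinear.eq_sum_monomials (hB : SymTrilinear B) (v : Fin 5 → ℂ) : B v v v =
    coef B 0 0 0 * v 0 ^ 3 + coef B 1 1 1 * v 1 ^ 3 + coef B 2 2 2 * v 2 ^ 3 +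
    coef B 3 3 3 * v 3 ^ 3 + coef B 4 4 4 * v 4 ^ 3 +
    3 * (coef B 0 0 1 * v 0 ^ 2 * v 1 + coef B 0 0 2 * v 0 ^ 2 * v 2 +
      coef B 0 0 3 * v 0 ^ 2 * v 3 + coef B 0 0 4 * v 0 ^ 2 * v 4 +
      coef B 0 1 1 * v 0 * v 1 ^ 2 + coef B 1 1 2 * v 1 ^ 2 * v 2 +
      coef B 1 1 3 * v 1 ^ 2 * v 3 + coef B 1 1 4 * v 1 ^ 2 * v 4 +
      coef B 0 2 2 * v 0 * v 2 ^ 2 + coef B 1 2 2 * v 1 * v 2 ^ 2 +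
      coef B 2 2 3 * v 2 ^ 2 * v 3 + coef B 2 2 4 * v 2 ^ 2 * v 4 +
      coef B 0 3 3 * v 0 * v 3 ^ 2 + coef B 1 3 3 * v 1 * v 3 ^ 2 +
      coef B 2 3 3 * v 2 * v 3 ^ 2 + coef B 3 3 4 * v 3 ^ 2 * v 4 +
      coef B 0 4 4 * v 0 * v 4 ^ 2 + coef B 1 4 4 * v 1 * v 4 ^ 2 +
      coef B 2 4 4 * v 2 * v 4 ^ 2 + coef B 3 4 4 * v 3 * v 4 ^ 2) +
    6 * (coef B 0 1 2 * v 0 * v 1 * v 2 + coef B 0 1 3 * v 0 * v 1 * v 3 +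
      coef B 0 1 4 * v 0 * v 1 * v 4 + coef B 0 2 3 * v 0 * v 2 * v 3 +
      coef B 0 2 4 * v 0 * v 2 * v 4 + coef B 0 3 4 * v 0 * v 3 * v 4 +
      coef B 1 2 3 * v 1 * v 2 * v 3 + coef B 1 2 4 * v 1 * v 2 * v 4 +
      coef B 1 3 4 * v 1 * v 3 * v 4 + coef B 2 3 4 * v 2 * v 3 * v 4) := by
  rw [hB.expand]
  change ∑ i, ∑ j, ∑ k, v i * v j * v k * coef B i j k = _
  simp only [Fin.sum_univ_five]
  simp only [hB.coef_swap₁₂, hB.coef_swap₂₃]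
  ring

/-- Nonsingularity on the line through two coordinate points. -/
lemma NonSing.exists_coef (hB : SymTrilinear B) (hs : NonSing B) {i j : Fin 5} (hij : i ≠ j)
    {x y : ℂ} (hxy : x ≠ 0 ∨ y ≠ 0) :
    ∃ k, coef B i i k * x ^ 2 + 2 * coef B i j k * x * y + coef B j j k * y ^ 2 ≠ 0 := by
  obtain ⟨u, hu⟩ := hs (x • Pi.single i 1 + y • Pi.single j 1) (by
    intro h
    have h1 := congrFun h i
    have h2 := congrFun h j
    simp [hij, hij.symm] at h1 h2
    exact hxy.elim (fun h => h h1) (fun h => h h2))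
  by_contra! hcon
  apply hu
  rw [hB.expand₃]
  refine Finset.sum_eq_zero fun k _ => ?_
  simp only [hB.add, hB.add₂, hB.smul, hB.smul₂]
  have := hcon k
  have h := hB.coef_swap₁₂ i j k
  simp only [coef] at this h
  rw [← h]
  linear_combination u k * this

/-- If `xᵢ²xⱼ` is the only possible monomial which is a multiple of `xᵢ²`, its coefficient does not
vanish. -/
lemma NonSing.coef_ne_zero (hB : SymTrilinear B) (hs : NonSing B)
    {S : List (Fin 5 × Fin 5 × Fin 5)} (hS : Supported B S) (i j : Fin 5)
    (h : ∀ k, k ≠ j → inSupport S i i k = false) : coef B i i j ≠ 0 := by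
  intro h0
  obtain ⟨l, hl⟩ : ∃ l : Fin 5, i ≠ l := ⟨i + 1, by simp⟩
  obtain ⟨k, hk⟩ := hs.exists_coef hB hl (x := 1) (y := 0) (Or.inl one_ne_zero)
  apply hk
  by_cases hkj : k = j
  · subst hkj; rw [h0]; ring
  · rw [hS i i k (h k hkj)]; ring

/-- The part of a nonsingular cubic form in two variables which do not interact with the others is a
sum of two cubes. -/
lemma NonSing.exists_binary (hB : SymTrilinear B) (hs : NonSing B)
    {S : List (Fin 5 × Fin 5 × Fin 5)} (hS : Supported B S) (i j : Fin 5) (hij : i ≠ j)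
    (h : ∀ k, k ≠ i → k ≠ j → inSupport S i i k = false ∧ inSupport S i j k = false ∧
      inSupport S j j k = false) :
    ∃ a b c d : ℂ, ∀ x y : ℂ, coef B i i i * x ^ 3 + 3 * coef B i i j * x ^ 2 * y +
      3 * coef B i j j * x * y ^ 2 + coef B j j j * y ^ 3 =
        (a * x + b * y) ^ 3 + (c * x + d * y) ^ 3 := by
  refine CubicThreefold.exists_binary fun x y h1 h2 => ?_
  by_contra! hcon
  have hxy : x ≠ 0 ∨ y ≠ 0 := by
    by_cases hx : x = 0
    · exact Or.inr (hcon hx)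
    · exact Or.inl hx
  obtain ⟨k, hk⟩ := hs.exists_coef hB hij hxy
  apply hk
  by_cases hki : k = i
  · subst hki
    have e1 := hB.coef_swap₂₃ k j k
    have e2 : coef B j j k = coef B k j j := by rw [hB.coef_swap₂₃, hB.coef_swap₁₂]
    rw [e1, e2]
    exact h1
  by_cases hkj : k = j
  · subst hkj; exact h2
  · obtain ⟨h3, h4, h5⟩ := h k hki hkj
    rw [hS _ _ _ h3, hS _ _ _ h4, hS _ _ _ h5]; ring

end Support

/-- The linear map with the given matrix. -/
abbrev mapOf (A : Matrix (Fin 5) (Fin 5) ℂ) : (Fin 5 → ℂ) →ₗ[ℂ] (Fin 5 → ℂ) := A.mulVecLin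

section Types

variable {B : (Fin 5 → ℂ) → (Fin 5 → ℂ) → (Fin 5 → ℂ) → ℂ}

/-- Monomials of `x₀²x₁ + x₁²x₂ + x₂²x₀` and of binary cubics in `x₃, x₄`. -/
def loopBinary : List (Fin 5 × Fin 5 × Fin 5) :=
  [(0, 0, 1), (1, 1, 2), (0, 2, 2), (3, 3, 3), (3, 3, 4), (3, 4, 4), (4, 4, 4)]

lemma Supported.loopBinary (hB : SymTrilinear B) (hs : NonSing B) (hS : Supported B loopBinary) :
    ∃ M : (Fin 5 → ℂ) →ₗ[ℂ] (Fin 5 → ℂ), ∀ v, B v v v = eval (M v) cubic₁ := by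
  obtain ⟨p, q, r, s, h34⟩ := hs.exists_binary hB hS 3 4 (by decide) (by decide)
  obtain ⟨A, hA⟩ := exists_loop_three
    (mul_ne_zero three_ne_zero (hs.coef_ne_zero hB hS 0 1 (by decide)))
    (mul_ne_zero three_ne_zero (hs.coef_ne_zero hB hS 1 2 (by decide)))
    (mul_ne_zero three_ne_zero (hs.coef_ne_zero hB hS 2 0 (by decide)))
  refine ⟨mapOf !![A 0 0, A 0 1, A 0 2, 0, 0; A 1 0, A 1 1, A 1 2, 0, 0; A 2 0, A 2 1, A 2 2, 0, 0;
    0, 0, 0, p, q; 0, 0, 0, r, s], fun v => ?_⟩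
  have h1 := hA (v 0) (v 1) (v 2)
  have h2 := h34 (v 3) (v 4)
  rw [show coef B 2 2 0 = coef B 0 2 2 by rw [hB.coef_swap₂₃, hB.coef_swap₁₂]] at h1
  have h0 := fun i j k => hS i j k
  rw [hB.eq_sum_monomials]
  simp (decide := true) only [h0]
  simp [cubic₁, dotProduct, Fin.sum_univ_five]
  linear_combination h1 + h2

/-- Monomials of binary cubics in `x₀, x₁` and in `x₃, x₄`, and `x₂³`. -/
def binaryBinary : List (Fin 5 × Fin 5 × Fin 5) :=
  [(0, 0, 0), (0, 0, 1), (0, 1, 1), (1, 1, 1), (2, 2, 2), (3, 3, 3), (3, 3, 4), (3, 4, 4),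
    (4, 4, 4)]

lemma Supported.binaryBinary (hB : SymTrilinear B) (hs : NonSing B)
    (hS : Supported B binaryBinary) :
    ∃ M : (Fin 5 → ℂ) →ₗ[ℂ] (Fin 5 → ℂ), ∀ v, B v v v = eval (M v) cubic₁ := by
  obtain ⟨p, q, r, s, h34⟩ := hs.exists_binary hB hS 3 4 (by decide) (by decide)
  obtain ⟨p', q', r', s', h01⟩ := hs.exists_binary hB hS 0 1 (by decide) (by decide)
  obtain ⟨a, ha⟩ := exists_pow_eq (n := 3) (by norm_num) (coef B 2 2 2)
  refine ⟨mapOf !![p', q', 0, 0, 0; r', s', 0, 0, 0; 0, 0, a, 0, 0;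
    0, 0, 0, p, q; 0, 0, 0, r, s], fun v => ?_⟩
  have h0 := fun i j k => hS i j k
  rw [hB.eq_sum_monomials]
  simp (decide := true) only [h0]
  simp [cubic₁, dotProduct, Fin.sum_univ_five]
  linear_combination h34 (v 3) (v 4) + h01 (v 0) (v 1) - v 2 ^ 3 * ha

/-- Monomials of binary cubics in `x₀, x₂` and in `x₁, x₃`, and `x₄³`. -/
def binaryBinary' : List (Fin 5 × Fin 5 × Fin 5) :=
  [(0, 0, 0), (0, 0, 2), (0, 2, 2), (2, 2, 2), (1, 1, 1), (1, 1, 3), (1, 3, 3), (3, 3, 3),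
    (4, 4, 4)]

lemma Supported.binaryBinary' (hB : SymTrilinear B) (hs : NonSing B)
    (hS : Supported B binaryBinary') :
    ∃ M : (Fin 5 → ℂ) →ₗ[ℂ] (Fin 5 → ℂ), ∀ v, B v v v = eval (M v) cubic₁ := by
  obtain ⟨p, q, r, s, h13⟩ := hs.exists_binary hB hS 1 3 (by decide) (by decide)
  obtain ⟨p', q', r', s', h02⟩ := hs.exists_binary hB hS 0 2 (by decide) (by decide)
  obtain ⟨a, ha⟩ := exists_pow_eq (n := 3) (by norm_num) (coef B 4 4 4)
  refine ⟨mapOf !![p', 0, q', 0, 0; r', 0, s', 0, 0; 0, p, 0, q, 0; 0, r, 0, s, 0;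
    0, 0, 0, 0, a], fun v => ?_⟩
  have h0 := fun i j k => hS i j k
  rw [hB.eq_sum_monomials]
  simp (decide := true) only [h0]
  simp [cubic₁, dotProduct, Fin.sum_univ_five]
  linear_combination h13 (v 1) (v 3) + h02 (v 0) (v 2) - v 4 ^ 3 * ha

lemma exists_sq_mul_eq {a l : ℂ} (ha : a ≠ 0) (hl : l ≠ 0) : ∃ k : ℂ, k ≠ 0 ∧ k ^ 2 * l = a := by
  obtain ⟨k, hk⟩ := exists_pow_eq (n := 2) (by norm_num) (a / l)
  refine ⟨k, ?_, by rw [hk]; field_simp⟩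
  rintro rfl
  have : a / l ≠ 0 := div_ne_zero ha hl
  exact this (by rw [← hk]; simp)

lemma exists_cube_eq {a : ℂ} (ha : a ≠ 0) : ∃ k : ℂ, k ≠ 0 ∧ k ^ 3 = a := by
  obtain ⟨k, hk⟩ := exists_pow_eq (n := 3) (by norm_num) a
  exact ⟨k, by rintro rfl; exact ha (by rw [← hk]; simp), hk⟩

/-- Monomials of `x₀²x₁ + x₁²x₂ + x₂³` and of binary cubics in `x₃, x₄`. -/
def chainBinary : List (Fin 5 × Fin 5 × Fin 5) :=
  [(0, 0, 1), (1, 1, 2), (2, 2, 2), (3, 3, 3), (3, 3, 4), (3, 4, 4), (4, 4, 4)]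

/-- The Hesse cubic with parameter `√3 - 1` is invariant, up to a scalar, under the discrete Fourier
transform. In the basis of eigenvectors `(1 + √3, 1, 1)`, `(1 - √3, 1, 1)`, `(0, 1, -1)` of the
latter it becomes a chain. -/
lemma hesse_eq_chain {m s t r : ℂ} (hm : m ^ 2 = 3) :
    ((1 + m) * s + (1 - m) * t) ^ 3 + (s + t + r) ^ 3 + (s + t - r) ^ 3 +
      3 * (m - 1) * ((1 + m) * s + (1 - m) * t) * (s + t + r) * (s + t - r) =
    (18 - 6 * m) * r ^ 2 * t + (18 * m - 18) * t ^ 2 * s + (18 + 6 * m) * s ^ 3 := by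
  grind

lemma Supported.chainBinary (hB : SymTrilinear B) (hs : NonSing B)
    (hS : Supported B chainBinary) :
    ∃ M : (Fin 5 → ℂ) →ₗ[ℂ] (Fin 5 → ℂ), ∀ v, B v v v = eval (M v) cubic₂ := by
  obtain ⟨p, q, r, s, h34⟩ := hs.exists_binary hB hS 3 4 (by decide) (by decide)
  have h01 := hs.coef_ne_zero hB hS 0 1 (by decide)
  have h12 := hs.coef_ne_zero hB hS 1 2 (by decide)
  have h22 := hs.coef_ne_zero hB hS 2 2 (by decide)
  set m : ℂ := ((Real.sqrt 3 : ℝ) : ℂ) with hm_def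
  have hm : m ^ 2 = 3 := by
    rw [hm_def, ← Complex.ofReal_pow, Real.sq_sqrt (by norm_num)]; norm_num
  have hA : 18 - 6 * m ≠ 0 := fun h => by
    have : (6 : ℂ) = 0 := by linear_combination hm + (m / 6 + 1 / 2) * h
    norm_num at this
  have hB' : 18 * m - 18 ≠ 0 := fun h => by
    have : (2 : ℂ) = 0 := by linear_combination (m / 18 + 1 / 18) * h - hm
    norm_num at this
  have hC : 18 + 6 * m ≠ 0 := fun h => by
    have : (6 : ℂ) = 0 := by linear_combination hm + (1 / 2 - m / 6) * h
    norm_num at this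
  obtain ⟨c, hc0, hc⟩ := exists_cube_eq (div_ne_zero h22 hC)
  obtain ⟨b, hb0, hb⟩ := exists_sq_mul_eq (div_ne_zero (mul_ne_zero three_ne_zero h12) hB') hc0
  obtain ⟨a, -, ha⟩ := exists_sq_mul_eq (div_ne_zero (mul_ne_zero three_ne_zero h01) hA) hb0
  rw [eq_div_iff hC] at hc
  rw [eq_div_iff hB'] at hb
  rw [eq_div_iff hA] at ha
  refine ⟨mapOf !![0, (1 - m) * b, (1 + m) * c, 0, 0; a, b, c, 0, 0; -a, b, c, 0, 0;
    0, 0, 0, p, q; 0, 0, 0, r, s], fun v => ?_⟩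
  have h0 := fun i j k => hS i j k
  have key := hesse_eq_chain (s := c * v 2) (t := b * v 1) (r := a * v 0) hm
  rw [hB.eq_sum_monomials]
  simp (decide := true) only [h0]
  simp [cubic₂, dotProduct, Fin.sum_univ_five, ← hm_def]
  linear_combination h34 (v 3) (v 4) - key - v 2 ^ 3 * hc - v 1 ^ 2 * v 2 * hb - v 0 ^ 2 * v 1 * ha

/-- Monomials of `x₀²x₁ + x₁²x₂ + x₂²x₃ + x₃³ + x₄³`. -/
def chainFour : List (Fin 5 × Fin 5 × Fin 5) :=
  [(0, 0, 1), (1, 1, 2), (2, 2, 3), (3, 3, 3), (4, 4, 4)]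

lemma Supported.chainFour (hB : SymTrilinear B) (hs : NonSing B) (hS : Supported B chainFour) :
    ∃ M : (Fin 5 → ℂ) →ₗ[ℂ] (Fin 5 → ℂ), ∀ v, B v v v = eval (M v) cubic₃ := by
  have h01 := hs.coef_ne_zero hB hS 0 1 (by decide)
  have h12 := hs.coef_ne_zero hB hS 1 2 (by decide)
  have h23 := hs.coef_ne_zero hB hS 2 3 (by decide)
  have h33 := hs.coef_ne_zero hB hS 3 3 (by decide)
  obtain ⟨e, he⟩ := exists_pow_eq (n := 3) (by norm_num) (coef B 4 4 4)
  obtain ⟨d, hd0, hd⟩ := exists_cube_eq h33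
  obtain ⟨c, hc0, hc⟩ := exists_sq_mul_eq (mul_ne_zero three_ne_zero h23) hd0
  obtain ⟨b, hb0, hb⟩ := exists_sq_mul_eq (mul_ne_zero three_ne_zero h12) hc0
  obtain ⟨a, -, ha⟩ := exists_sq_mul_eq (mul_ne_zero three_ne_zero h01) hb0
  refine ⟨mapOf (Matrix.diagonal ![a, b, c, d, e]), fun v => ?_⟩
  have h0 := fun i j k => hS i j k
  rw [hB.eq_sum_monomials]
  simp (decide := true) only [h0]
  simp [cubic₃, Matrix.mulVec_diagonal]
  linear_combination -v 4 ^ 3 * he - v 3 ^ 3 * hd - v 2 ^ 2 * v 3 * hc - v 1 ^ 2 * v 2 * hb -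
    v 0 ^ 2 * v 1 * ha

/-- Monomials of `x₀²x₁ + x₁²x₂ + x₂²x₃ + x₃²x₄ + x₄³`. -/
def chainFive : List (Fin 5 × Fin 5 × Fin 5) :=
  [(0, 0, 1), (1, 1, 2), (2, 2, 3), (3, 3, 4), (4, 4, 4)]

lemma Supported.chainFive (hB : SymTrilinear B) (hs : NonSing B) (hS : Supported B chainFive) :
    ∃ M : (Fin 5 → ℂ) →ₗ[ℂ] (Fin 5 → ℂ), ∀ v, B v v v = eval (M v) cubic₄ := by
  have h01 := hs.coef_ne_zero hB hS 0 1 (by decide)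
  have h12 := hs.coef_ne_zero hB hS 1 2 (by decide)
  have h23 := hs.coef_ne_zero hB hS 2 3 (by decide)
  have h34 := hs.coef_ne_zero hB hS 3 4 (by decide)
  have h44 := hs.coef_ne_zero hB hS 4 4 (by decide)
  obtain ⟨e, he0, he⟩ := exists_cube_eq h44
  obtain ⟨d, hd0, hd⟩ := exists_sq_mul_eq (mul_ne_zero three_ne_zero h34) he0
  obtain ⟨c, hc0, hc⟩ := exists_sq_mul_eq (mul_ne_zero three_ne_zero h23) hd0
  obtain ⟨b, hb0, hb⟩ := exists_sq_mul_eq (mul_ne_zero three_ne_zero h12) hc0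
  obtain ⟨a, -, ha⟩ := exists_sq_mul_eq (mul_ne_zero three_ne_zero h01) hb0
  refine ⟨mapOf (Matrix.diagonal ![a, b, c, d, e]), fun v => ?_⟩
  have h0 := fun i j k => hS i j k
  rw [hB.eq_sum_monomials]
  simp (decide := true) only [h0]
  simp [cubic₄, Matrix.mulVec_diagonal]
  linear_combination -v 4 ^ 3 * he - v 3 ^ 2 * v 4 * hd - v 2 ^ 2 * v 3 * hc - v 1 ^ 2 * v 2 * hb -
    v 0 ^ 2 * v 1 * ha

/-- Monomials of `x₀²x₁ + x₁²x₂ + x₂²x₃ + x₃²x₄ + x₄²x₀`. -/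
def loopFive : List (Fin 5 × Fin 5 × Fin 5) :=
  [(0, 0, 1), (1, 1, 2), (2, 2, 3), (3, 3, 4), (0, 4, 4)]

/-- Coefficients of a loop can be rescaled to `1`; eliminating all but one of the scaling factors
leaves an equation for its power with exponent `33 = 1 - (-2)⁵`. -/
lemma exists_loop_five {a b c d e : ℂ} (ha : a ≠ 0) (hb : b ≠ 0) (hc : c ≠ 0) (hd : d ≠ 0)
    (he : e ≠ 0) : ∃ k l m n p : ℂ, k ^ 2 * l = a ∧ l ^ 2 * m = b ∧ m ^ 2 * n = c ∧ n ^ 2 * p = d ∧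
      p ^ 2 * k = e := by
  obtain ⟨k, hk⟩ := exists_pow_eq (n := 33) (by norm_num) (e * c ^ 4 * a ^ 16 / (d ^ 2 * b ^ 8))
  have hk0 : k ≠ 0 := by
    rintro rfl
    have : e * c ^ 4 * a ^ 16 / (d ^ 2 * b ^ 8) ≠ 0 := by positivity
    exact this (by rw [← hk]; simp)
  have hk' : k ^ 33 * (d ^ 2 * b ^ 8) = e * c ^ 4 * a ^ 16 := by
    rw [hk]; field_simp
  refine ⟨k, a / k ^ 2, b * k ^ 4 / a ^ 2, c * a ^ 4 / (b ^ 2 * k ^ 8),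
    d * b ^ 4 * k ^ 16 / (c ^ 2 * a ^ 8), ?_, ?_, ?_, ?_, ?_⟩
  · field_simp
  · field_simp
  · field_simp
  · field_simp
  · rw [div_pow, div_mul_eq_mul_div, div_eq_iff (by positivity)]
    linear_combination hk'

lemma Supported.loopFive (hB : SymTrilinear B) (hs : NonSing B) (hS : Supported B loopFive) :
    ∃ M : (Fin 5 → ℂ) →ₗ[ℂ] (Fin 5 → ℂ), ∀ v, B v v v = eval (M v) cubic₅ := by
  obtain ⟨a, b, c, d, e, ha, hb, hc, hd, he⟩ := exists_loop_five
    (mul_ne_zero three_ne_zero (hs.coef_ne_zero hB hS 0 1 (by decide)))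
    (mul_ne_zero three_ne_zero (hs.coef_ne_zero hB hS 1 2 (by decide)))
    (mul_ne_zero three_ne_zero (hs.coef_ne_zero hB hS 2 3 (by decide)))
    (mul_ne_zero three_ne_zero (hs.coef_ne_zero hB hS 3 4 (by decide)))
    (mul_ne_zero three_ne_zero (hs.coef_ne_zero hB hS 4 0 (by decide)))
  rw [show coef B 4 4 0 = coef B 0 4 4 by rw [hB.coef_swap₂₃, hB.coef_swap₁₂]] at he
  refine ⟨mapOf (Matrix.diagonal ![a, b, c, d, e]), fun v => ?_⟩
  have h0 := fun i j k => hS i j k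
  rw [hB.eq_sum_monomials]
  simp (decide := true) only [h0]
  simp [cubic₅, Matrix.mulVec_diagonal]
  linear_combination -v 4 ^ 2 * v 0 * he - v 3 ^ 2 * v 4 * hd - v 2 ^ 2 * v 3 * hc -
    v 1 ^ 2 * v 2 * hb - v 0 ^ 2 * v 1 * ha

/-- Monomials of `x₀²x₁ + x₁²x₂ + x₂²x₃ + x₃²x₀ + x₄³`. -/
def loopFour : List (Fin 5 × Fin 5 × Fin 5) :=
  [(0, 0, 1), (1, 1, 2), (2, 2, 3), (0, 3, 3), (4, 4, 4)]

/-- For a loop of length four, the exponent is `15 = (-2)⁴ - 1`. -/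
lemma exists_loop_four {a b c d : ℂ} (ha : a ≠ 0) (hb : b ≠ 0) (hc : c ≠ 0) (hd : d ≠ 0) :
    ∃ k l m n : ℂ, k ^ 2 * l = a ∧ l ^ 2 * m = b ∧ m ^ 2 * n = c ∧ n ^ 2 * k = d := by
  obtain ⟨k, hk⟩ := exists_pow_eq (n := 15) (by norm_num) (c ^ 2 * a ^ 8 / (d * b ^ 4))
  have hk0 : k ≠ 0 := by
    rintro rfl
    have : c ^ 2 * a ^ 8 / (d * b ^ 4) ≠ 0 := by positivity
    exact this (by rw [← hk]; simp)
  have hk' : k ^ 15 * (d * b ^ 4) = c ^ 2 * a ^ 8 := by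
    rw [hk]; field_simp
  refine ⟨k, a / k ^ 2, b * k ^ 4 / a ^ 2, c * a ^ 4 / (b ^ 2 * k ^ 8), ?_, ?_, ?_, ?_⟩
  · field_simp
  · field_simp
  · field_simp
  · rw [div_pow, div_mul_eq_mul_div, div_eq_iff (by positivity)]
    linear_combination -k * hk'

/-- The discrete Fourier transform on `ℂ⁵` turns the sum of five cubes, on the hyperplane
`∑ yⱼ = 0`, into a loop. -/
lemma fourier_cubes {ζ : ℂ} (hζ : ∀ w : ℕ, 1 + ζ ^ w + ζ ^ (2 * w) + ζ ^ (3 * w) + ζ ^ (4 * w) =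
    if 5 ∣ w then 5 else 0) (z₁ z₂ z₃ z₄ : ℂ) :
    (z₁ + z₂ + z₃ + z₄) ^ 3 + (ζ * z₁ + ζ ^ 2 * z₂ + ζ ^ 3 * z₃ + ζ ^ 4 * z₄) ^ 3 +
      (ζ ^ 2 * z₁ + ζ ^ 4 * z₂ + ζ ^ 6 * z₃ + ζ ^ 8 * z₄) ^ 3 +
      (ζ ^ 3 * z₁ + ζ ^ 6 * z₂ + ζ ^ 9 * z₃ + ζ ^ 12 * z₄) ^ 3 +
      (ζ ^ 4 * z₁ + ζ ^ 8 * z₂ + ζ ^ 12 * z₃ + ζ ^ 16 * z₄) ^ 3 =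
    15 * (z₁ ^ 2 * z₃ + z₃ ^ 2 * z₄ + z₄ ^ 2 * z₂ + z₂ ^ 2 * z₁) := by
  have h3 := hζ 3
  have h4 := hζ 4
  have h5 := hζ 5
  have h6 := hζ 6
  have h7 := hζ 7
  have h8 := hζ 8
  have h9 := hζ 9
  have h10 := hζ 10
  have h11 := hζ 11
  have h12 := hζ 12
  norm_num at h3 h4 h5 h6 h7 h8 h9 h10 h11 h12
  linear_combination z₁ ^ 3 * h3 + 3 * z₁ ^ 2 * z₂ * h4 + (3 * z₁ ^ 2 * z₃ + 3 * z₁ * z₂ ^ 2) * h5 +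
    (3 * z₁ ^ 2 * z₄ + 6 * z₁ * z₂ * z₃ + z₂ ^ 3) * h6 +
    (6 * z₁ * z₂ * z₄ + 3 * z₁ * z₃ ^ 2 + 3 * z₂ ^ 2 * z₃) * h7 +
    (6 * z₁ * z₃ * z₄ + 3 * z₂ ^ 2 * z₄ + 3 * z₂ * z₃ ^ 2) * h8 +
    (3 * z₁ * z₄ ^ 2 + 6 * z₂ * z₃ * z₄ + z₃ ^ 3) * h9 +
    (3 * z₂ * z₄ ^ 2 + 3 * z₃ ^ 2 * z₄) * h10 + 3 * z₃ * z₄ ^ 2 * h11 + z₄ ^ 3 * h12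

lemma exists_fifthRoot : ∃ ζ : ℂ, ∀ w : ℕ,
    1 + ζ ^ w + ζ ^ (2 * w) + ζ ^ (3 * w) + ζ ^ (4 * w) = if 5 ∣ w then 5 else 0 := by
  have h := IsPrimitiveRoot.coe_units_iff.2 (ξ_primitive (n := 5) (by norm_num))
  refine ⟨ξ 5, fun w => ?_⟩
  have e : ∀ k, (ξ 5 : ℂ) ^ (k * w) = ((ξ 5 : ℂ) ^ w) ^ k := fun k => by
    rw [← pow_mul, mul_comm]
  rw [e, e, e]
  split_ifs with hw
  · rw [(h.pow_eq_one_iff_dvd w).2 hw]; norm_num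
  · have := (h.pow_of_coprime w (((Nat.Prime.coprime_iff_not_dvd (by norm_num)).2 hw).symm)).geom_sum_eq_zero (by norm_num)
    simp only [Finset.sum_range_succ, Finset.sum_range_zero] at this
    linear_combination this

lemma Supported.loopFour (hB : SymTrilinear B) (hs : NonSing B) (hS : Supported B loopFour) :
    ∃ M : (Fin 5 → ℂ) →ₗ[ℂ] (Fin 6 → ℂ), (∀ v, B v v v = M v 0 ^ 3 + M v 1 ^ 3 + M v 2 ^ 3 +
      M v 3 ^ 3 + M v 4 ^ 3 + M v 5 ^ 3) ∧ ∀ v, M v 0 + M v 1 + M v 2 + M v 3 + M v 4 = 0 := by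
  have h15 : ∀ {x : ℂ}, x ≠ 0 → 3 * x / 15 ≠ 0 := fun hx =>
    div_ne_zero (mul_ne_zero three_ne_zero hx) (by norm_num)
  obtain ⟨a, b, c, d, ha, hb, hc, hd⟩ := exists_loop_four
    (h15 (hs.coef_ne_zero hB hS 0 1 (by decide))) (h15 (hs.coef_ne_zero hB hS 1 2 (by decide)))
    (h15 (hs.coef_ne_zero hB hS 2 3 (by decide))) (h15 (hs.coef_ne_zero hB hS 3 0 (by decide)))
  rw [show coef B 3 3 0 = coef B 0 3 3 by rw [hB.coef_swap₂₃, hB.coef_swap₁₂]] at hd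
  obtain ⟨e, he⟩ := exists_pow_eq (n := 3) (by norm_num) (coef B 4 4 4)
  obtain ⟨ζ, hζ⟩ := exists_fifthRoot
  refine ⟨Matrix.mulVecLin !![a, b, c, d, 0; ζ * a, ζ ^ 3 * b, ζ ^ 4 * c, ζ ^ 2 * d, 0;
    ζ ^ 2 * a, ζ ^ 6 * b, ζ ^ 8 * c, ζ ^ 4 * d, 0; ζ ^ 3 * a, ζ ^ 9 * b, ζ ^ 12 * c, ζ ^ 6 * d, 0;
    ζ ^ 4 * a, ζ ^ 12 * b, ζ ^ 16 * c, ζ ^ 8 * d, 0; 0, 0, 0, 0, e], fun v => ?_, fun v => ?_⟩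
  · have h0 := fun i j k => hS i j k
    have key := fourier_cubes hζ (a * v 0) (d * v 3) (b * v 1) (c * v 2)
    rw [hB.eq_sum_monomials]
    simp (decide := true) only [h0]
    simp [dotProduct, Fin.sum_univ_five]
    linear_combination -v 4 ^ 3 * he - 15 * v 3 ^ 2 * v 0 * hd - 15 * v 2 ^ 2 * v 3 * hc -
      15 * v 1 ^ 2 * v 2 * hb - 15 * v 0 ^ 2 * v 1 * ha - key
  · have h1 := hζ 1
    have h2 := hζ 2
    have h3 := hζ 3
    have h4 := hζ 4
    norm_num at h1 h2 h3 h4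
    simp [dotProduct, Fin.sum_univ_five]
    linear_combination a * v 0 * h1 + d * v 3 * h2 + b * v 1 * h3 + c * v 2 * h4

end Types

/-! ### Recognizing the special cubic threefolds -/

/-- An injective linear map which identifies the equations of two loci and reaches the second locus
induces an isomorphism of them. -/
lemma linearlyIsomorphic_of_injective {m n : ℕ} {S : Set (MvPolynomial (Fin m) ℂ)}
    {T : Set (MvPolynomial (Fin n) ℂ)} (hS : ∀ f ∈ S, ∃ d, f.IsHomogeneous d)
    (hT : ∀ f ∈ T, ∃ d, f.IsHomogeneous d) (L : (Fin m → ℂ) →ₗ[ℂ] (Fin n → ℂ))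
    (hL : Function.Injective L)
    (h : ∀ v, (∀ f ∈ S, eval v f = 0) ↔ ∀ f ∈ T, eval (L v) f = 0)
    (hr : ∀ w, (∀ f ∈ T, eval w f = 0) → w ∈ LinearMap.range L) :
    LinearlyIsomorphic (projZeros S) (projZeros T) := by
  refine ⟨L, hL, ?_⟩
  ext p
  constructor
  · rintro ⟨q, hq, rfl⟩
    induction q with
    | h v hv =>
      rw [mk_mem_projZeros hS, h] at hq
      rwa [Projectivization.map_mk, mk_mem_projZeros hT]
  · intro hp
    induction p with
    | h w hw =>
      rw [mk_mem_projZeros hT] at hp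
      obtain ⟨v, rfl⟩ := hr w hp
      have hv : v ≠ 0 := by rintro rfl; exact hw (map_zero L)
      refine ⟨Projectivization.mk ℂ v hv, ?_, Projectivization.map_mk L hL v hv⟩
      rwa [mk_mem_projZeros hS, h]

/-- A nonsingular cubic form does not factor through a quotient. -/
lemma NonSing.injective_of_eq {B : (Fin 5 → ℂ) → (Fin 5 → ℂ) → (Fin 5 → ℂ) → ℂ}
    (hB : SymTrilinear B) (hs : NonSing B) {n : ℕ} (M : (Fin 5 → ℂ) →ₗ[ℂ] (Fin n → ℂ))
    (q : (Fin n → ℂ) → ℂ) (h : ∀ v, B v v v = q (M v)) : Function.Injective M := by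
  rw [injective_iff_map_eq_zero]
  intro v hv
  by_contra hne
  obtain ⟨u, hu⟩ := hs v hne
  apply hu
  have h6 := hB.six_mul_diag v u
  have hneg : B (v - u) (v - u) (v - u) = - B u u u := by
    have h1 : B (v - u) (v - u) (v - u) = B ((-1 : ℂ) • u) ((-1 : ℂ) • u) ((-1 : ℂ) • u) := by
      rw [h, h, map_sub, hv, map_smul, zero_sub, neg_one_smul]
    rw [h1, hB.smul, hB.smul₂, hB.smul₃]
    ring
  have hpos : B (v + u) (v + u) (v + u) = B u u u := by rw [h, h, map_add, hv, zero_add]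
  rw [hneg, hpos] at h6
  linear_combination h6 / 6

/-- The coordinates in the basis given by the columns of `P`. -/
def coordinates (P : GL (Fin 5) ℂ) : (Fin 5 → ℂ) →ₗ[ℂ] (Fin 5 → ℂ) := (P⁻¹).val.mulVecLin

lemma coordinates_injective (P : GL (Fin 5) ℂ) : Function.Injective (coordinates P) :=
  Function.LeftInverse.injective (g := P.val.mulVecLin) fun v => by
    simp [coordinates, Matrix.mulVec_mulVec, ← Units.val_mul, -Matrix.coe_units_inv]

lemma basisForm_coordinates {F : MvPolynomial (Fin 5) ℂ} (hF : F.IsHomogeneous 3)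
    (P : GL (Fin 5) ℂ) (v : Fin 5 → ℂ) :
    basisForm F P (coordinates P v) (coordinates P v) (coordinates P v) = eval v F := by
  have h : P.val.mulVec (coordinates P v) = v := by
    simp [coordinates, Matrix.mulVec_mulVec, ← Units.val_mul, -Matrix.coe_units_inv]
  rw [basisForm, h, polar_diag hF]

lemma linearlyIsomorphic_hypersurface {F : MvPolynomial (Fin 5) ℂ} (hF : IsSmoothCubic F)
    (P : GL (Fin 5) ℂ) {q : MvPolynomial (Fin 5) ℂ} (hq : q.IsHomogeneous 3)
    (h : ∃ M : (Fin 5 → ℂ) →ₗ[ℂ] (Fin 5 → ℂ), ∀ v, basisForm F P v v v = eval (M v) q) :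
    LinearlyIsomorphic (hypersurface F) (hypersurface q) := by
  obtain ⟨M, hM⟩ := h
  have hinj := (hF.nonSing_basisForm P).injective_of_eq (basisForm_symTrilinear F P) M
    (fun w => eval w q) hM
  refine linearlyIsomorphic_of_injective (by rintro f rfl; exact ⟨3, hF.homogeneous⟩)
    (by rintro f rfl; exact ⟨3, hq⟩) (M ∘ₗ coordinates P) (hinj.comp (coordinates_injective P))
    (fun v => ?_) (fun w _ => ?_)
  · simp only [Set.mem_singleton_iff, forall_eq, LinearMap.comp_apply, ← hM,
      basisForm_coordinates hF.homogeneous]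
  · exact LinearMap.surjective_of_injective (f := M ∘ₗ coordinates P)
      (hinj.comp (coordinates_injective P)) w

lemma linearlyIsomorphic_locus₆ {F : MvPolynomial (Fin 5) ℂ} (hF : IsSmoothCubic F)
    (P : GL (Fin 5) ℂ)
    (h : ∃ M : (Fin 5 → ℂ) →ₗ[ℂ] (Fin 6 → ℂ), (∀ v, basisForm F P v v v = M v 0 ^ 3 + M v 1 ^ 3 +
      M v 2 ^ 3 + M v 3 ^ 3 + M v 4 ^ 3 + M v 5 ^ 3) ∧
      ∀ v, M v 0 + M v 1 + M v 2 + M v 3 + M v 4 = 0) :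
    LinearlyIsomorphic (hypersurface F) locus₆ := by
  obtain ⟨M, hM, hM0⟩ := h
  have hinj := (hF.nonSing_basisForm P).injective_of_eq (basisForm_symTrilinear F P) M
    (fun w => w 0 ^ 3 + w 1 ^ 3 + w 2 ^ 3 + w 3 ^ 3 + w 4 ^ 3 + w 5 ^ 3) hM
  -- a point of the hyperplane is determined by its last five coordinates
  let p : (Fin 6 → ℂ) →ₗ[ℂ] (Fin 5 → ℂ) := LinearMap.funLeft ℂ ℂ Fin.succ
  have hp : ∀ w : Fin 6 → ℂ, w 0 + w 1 + w 2 + w 3 + w 4 = 0 → p w = 0 → w = 0 := by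
    intro w hw h0
    have h1 : ∀ i : Fin 5, w i.succ = 0 := fun i => congrFun h0 i
    have h1' := h1 0; have h2 := h1 1; have h3 := h1 2; have h4 := h1 3
    simp only [Fin.isValue, Fin.reduceSucc, Fin.succ_zero_eq_one] at h1' h2 h3 h4
    rw [h1', h2, h3, h4] at hw
    funext i
    refine Fin.cases ?_ h1 i
    simpa using hw
  have hpM : Function.Injective (p ∘ₗ M) := by
    rw [injective_iff_map_eq_zero]
    intro v hv
    exact (injective_iff_map_eq_zero M).1 hinj v (hp _ (hM0 v) hv)
  have h3 : (X 0 ^ 3 + X 1 ^ 3 + X 2 ^ 3 + X 3 ^ 3 + X 4 ^ 3 + X 5 ^ 3 :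
      MvPolynomial (Fin 6) ℂ).IsHomogeneous 3 :=
    (((((isHomogeneous_X_pow _ _).add (isHomogeneous_X_pow _ _)).add
      (isHomogeneous_X_pow _ _)).add (isHomogeneous_X_pow _ _)).add (isHomogeneous_X_pow _ _)).add
      (isHomogeneous_X_pow _ _)
  have h1 : (X 0 + X 1 + X 2 + X 3 + X 4 : MvPolynomial (Fin 6) ℂ).IsHomogeneous 1 :=
    ((((isHomogeneous_X _ _).add (isHomogeneous_X _ _)).add (isHomogeneous_X _ _)).add
      (isHomogeneous_X _ _)).add (isHomogeneous_X _ _)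
  refine linearlyIsomorphic_of_injective (by rintro f rfl; exact ⟨3, hF.homogeneous⟩)
    (by rintro f (rfl | rfl); exacts [⟨3, h3⟩, ⟨1, h1⟩]) (M ∘ₗ coordinates P)
    (hinj.comp (coordinates_injective P)) (fun v => ?_) (fun w hw => ?_)
  · simp only [Set.mem_singleton_iff, Set.mem_insert_iff, forall_eq, forall_eq_or_imp,
      LinearMap.comp_apply, ← basisForm_coordinates hF.homogeneous P, hM]
    simp [hM0]
  · have hw' : w 0 + w 1 + w 2 + w 3 + w 4 = 0 := by
      simpa using hw _ (Or.inr rfl)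
    obtain ⟨v, hv⟩ := LinearMap.surjective_of_injective hpM (p w)
    obtain ⟨v', rfl⟩ := LinearMap.surjective_of_injective (coordinates_injective P) v
    refine ⟨v', sub_eq_zero.1 (hp _ ?_ ?_)⟩
    · simp only [LinearMap.comp_apply, Pi.sub_apply]
      linear_combination hM0 (coordinates P v') - hw'
    · rw [map_sub, sub_eq_zero]
      exact hv

/-- The invariants of degree three of the matrices encoded by `row` are spanned by the monomials of
`S`. -/
def supportb (row : List (ℕ × List ℕ)) (S : List (Fin 5 × Fin 5 × Fin 5)) : Bool :=
  decide (∀ i j k : Fin 5, inSupport S i j k = false →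
    ∃ g ∈ row, g.1 ≠ 0 ∧ ¬ g.1 ∣ entry g.2 i + entry g.2 j + entry g.2 k)

lemma supported_of_supportb {F : MvPolynomial (Fin 5) ℂ} (hF : IsSmoothCubic F) {P : GL (Fin 5) ℂ}
    {ds : List (Fin 5 → ℂˣ)} (hds : ∀ d ∈ ds, subst (conjDiag P d) F = F)
    (row : List (ℕ × List ℕ)) (hrow : ∀ g ∈ row, toVec g ∈ ds)
    {S : List (Fin 5 × Fin 5 × Fin 5)} (h : supportb row S = true) :
    Supported (basisForm F P) S := by
  intro i j k hijk
  obtain ⟨g, hg, hg0, hdvd⟩ := of_decide_eq_true h i j k hijk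
  by_contra hne
  have h1 := mul_mul_eq_one_of_basisForm_ne_zero hF (hds _ (hrow g hg)) hne
  simp only [toVec, expVec, vec] at h1
  rw [← zpow_add, ← zpow_add, ξ_zpow_eq_one hg0] at h1
  exact hdvd (by exact_mod_cast h1)

lemma isHomogeneous_cubic₁ : cubic₁.IsHomogeneous 3 :=
  ((((isHomogeneous_X_pow _ _).add (isHomogeneous_X_pow _ _)).add
    (isHomogeneous_X_pow _ _)).add (isHomogeneous_X_pow _ _)).add (isHomogeneous_X_pow _ _)

lemma isHomogeneous_cubic₂ : cubic₂.IsHomogeneous 3 :=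
  (((((isHomogeneous_X_pow _ _).add (isHomogeneous_X_pow _ _)).add
    (isHomogeneous_X_pow _ _)).add ((((isHomogeneous_C _ _).mul (isHomogeneous_X _ _)).mul
      (isHomogeneous_X _ _)).mul (isHomogeneous_X _ _))).add (isHomogeneous_X_pow _ _)).add
      (isHomogeneous_X_pow _ _)

lemma isHomogeneous_sq_mul (i j : Fin 5) :
    (X i ^ 2 * X j : MvPolynomial (Fin 5) ℂ).IsHomogeneous 3 :=
  (isHomogeneous_X_pow _ _).mul (isHomogeneous_X _ _)

lemma isHomogeneous_cubic₃ : cubic₃.IsHomogeneous 3 :=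
  ((((isHomogeneous_sq_mul _ _).add (isHomogeneous_sq_mul _ _)).add
    (isHomogeneous_sq_mul _ _)).add (isHomogeneous_X_pow _ _)).add (isHomogeneous_X_pow _ _)

lemma isHomogeneous_cubic₄ : cubic₄.IsHomogeneous 3 :=
  ((((isHomogeneous_sq_mul _ _).add (isHomogeneous_sq_mul _ _)).add
    (isHomogeneous_sq_mul _ _)).add (isHomogeneous_sq_mul _ _)).add (isHomogeneous_X_pow _ _)

lemma isHomogeneous_cubic₅ : cubic₅.IsHomogeneous 3 :=
  ((((isHomogeneous_sq_mul _ _).add (isHomogeneous_sq_mul _ _)).add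
    (isHomogeneous_sq_mul _ _)).add (isHomogeneous_sq_mul _ _)).add (isHomogeneous_sq_mul _ _)

lemma supportb_nine : ∀ a < 3, ∀ b < 3, supportb [nine a b] loopBinary = true := by decide +kernel

/-- Every group of the table with an entry in the uniqueness column leaves so few monomials
invariant that the cubic can be brought to a normal form. -/
theorem isIsoTo_of_table {F : MvPolynomial (Fin 5) ℂ} (hF : IsSmoothCubic F) {ns : List ℕ}
    {ds : List (Fin 5 → ℂˣ)} {T : Special} (h : Table ns ds (some T)) {G : Subgroup PGL(5, ℂ)}
    {P : GL (Fin 5) ℂ} (hl : IsFLifting F (conj P (diagGroup ds)) G) :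
    IsIsoTo (hypersurface F) T := by
  have hds : ∀ d ∈ ds, subst (conjDiag P d) F = F := fun d hd =>
    hl.invariant _ ⟨diag d, Subgroup.subset_closure ⟨d, hd, rfl⟩, rfl⟩
  have hB := basisForm_symTrilinear F P
  have hs := hF.nonSing_basisForm P
  have key : ∀ row : List (ℕ × List ℕ), (∀ g ∈ row, toVec g ∈ ds) → ∀ {S}, supportb row S = true →
      Supported (basisForm F P) S := fun row hrow _ h => supported_of_supportb hF hds row hrow h
  have fermat : (∃ M : (Fin 5 → ℂ) →ₗ[ℂ] (Fin 5 → ℂ), ∀ v, basisForm F P v v v =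
      eval (M v) cubic₁) → IsIsoTo (hypersurface F) .X₁ :=
    linearlyIsomorphic_hypersurface hF P isHomogeneous_cubic₁
  have hnine : ∀ a b, a ≤ 2 → b ≤ 2 → ![ξ 9, ξ 9 ^ 7, ξ 9 ^ 4, ξ 3 ^ a, ξ 3 ^ b] ∈ ds →
      IsIsoTo (hypersurface F) .X₁ := fun a b ha hb hmem =>
    fermat (Supported.loopBinary hB hs (key [nine a b] (by simpa [toVec_nine] using hmem)
      (supportb_nine a (by omega) b (by omega))))
  -- in rows 23 and 24 the entry of the uniqueness column depends on the parameter
  generalize hu : some T = u at h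
  cases h with
  | row12 a b hab hb =>
    cases hu
    exact hnine a b (by omega) hb (by simp)
  | row14 =>
    cases hu
    exact linearlyIsomorphic_hypersurface hF P isHomogeneous_cubic₅ (Supported.loopFive hB hs
      (key [(11, [1, 9, 4, 3, 5])] (by simp [toVec_eq]) (by decide +kernel)))
  | row20 =>
    cases hu
    exact linearlyIsomorphic_locus₆ hF P (Supported.loopFour hB hs
      (key [(5, [1, 3, 4, 2, 0]), (3, [0, 0, 0, 0, 1])] (by simp [toVec_eq]) (by decide +kernel)))
  | row21 =>
    cases hu
    exact linearlyIsomorphic_hypersurface hF P isHomogeneous_cubic₄ (Supported.chainFive hB hs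
      (key [(16, [1, 14, 4, 8, 0])] (by
        simp [toVec_eq, -zpow_neg, ξ_sixteen_pow_eight, ξ_sixteen_pow_fourteen]) (by decide +kernel)))
  | row22 a ha =>
    cases hu
    exact hnine a a ha ha (by simp)
  | row23 a ha =>
    split_ifs at hu with h1
    cases hu
    subst h1
    exact fermat (Supported.binaryBinary hB hs (key
      [(2, [1, 0, 0, 0, 0]), (3, [0, 0, 1, 0, 0]), (3, [0, 0, 0, 1, 1])]
      (by simp [toVec_eq, ξ_two]) (by decide +kernel)))
  | row24 a ha =>
    split_ifs at hu with h1
    cases hu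
    subst h1
    exact fermat (Supported.binaryBinary hB hs (key
      [(2, [1, 0, 0, 0, 0]), (3, [0, 0, 1, 0, 1]), (3, [0, 0, 0, 1, 1])]
      (by simp [toVec_eq, ξ_two]) (by decide +kernel)))
  | row25 =>
    cases hu
    exact fermat (Supported.binaryBinary hB hs (key
      [(2, [1, 0, 0, 0, 1]), (3, [0, 0, 1, 0, 0]), (3, [0, 0, 0, 1, 1])]
      (by simp [toVec_eq, ξ_two]) (by decide +kernel)))
  | row26 =>
    cases hu
    exact linearlyIsomorphic_hypersurface hF P isHomogeneous_cubic₃ (Supported.chainFour hB hs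
      (key [(8, [1, 6, 4, 0, 0]), (3, [0, 0, 0, 0, 1])] (by simp [toVec_eq, ξ_eight_pow_four])
        (by decide +kernel)))
  | row27 =>
    cases hu
    exact linearlyIsomorphic_hypersurface hF P isHomogeneous_cubic₂ (Supported.chainBinary hB hs
      (key [(4, [1, 2, 0, 0, 0]), (2, [0, 0, 0, 1, 0]), (3, [0, 0, 0, 1, 1])]
        (by simp [toVec_eq, ξ_two, ξ_four_pow_two]) (by decide +kernel)))
  | row28 a b ha hb =>
    cases hu
    exact hnine 0 a (by omega) ha (by simp)
  | row30 =>
    cases hu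
    exact linearlyIsomorphic_hypersurface hF P isHomogeneous_cubic₂ (Supported.chainBinary hB hs
      (key [(4, [1, 2, 0, 0, 0]), (3, [0, 0, 0, 1, 0]), (3, [0, 0, 0, 0, 1])]
        (by simp [toVec_eq, ξ_four_pow_two]) (by decide +kernel)))
  | row31 =>
    cases hu
    exact fermat (Supported.binaryBinary' hB hs (key
      [(2, [1, 0, 0, 0, 0]), (2, [0, 1, 0, 0, 0]), (3, [0, 1, 0, 1, 0]), (3, [0, 0, 0, 0, 1])]
      (by simp [toVec_eq, ξ_two]) (by decide +kernel)))
  | row32 =>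
    cases hu
    exact fermat (Supported.binaryBinary hB hs (key
      [(2, [1, 0, 0, 0, 0]), (3, [0, 0, 1, 0, 0]), (3, [0, 0, 0, 1, 0]), (3, [0, 0, 0, 0, 1])]
      (by simp [toVec_eq, ξ_two]) (by decide +kernel)))
  | row33 =>
    cases hu
    exact fermat (Supported.binaryBinary hB hs (key
      [(3, [0, 1, 0, 0, 0]), (3, [0, 0, 1, 0, 0]), (3, [0, 0, 0, 1, 0]), (3, [0, 0, 0, 0, 1])]
      (by simp [toVec_eq]) (by decide +kernel)))
  | _ => cases hu

lemma eq_of_prod_eq_eleven : ∀ row ∈ rows, (row.map Prod.fst).prod = 11 →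
    row.map Prod.fst = [11] := by
  decide +kernel

lemma eq_of_prod_eq_sixteen :
    ∀ row ∈ rows, (row.map Prod.fst).prod = 16 → row.map Prod.fst = [16] := by decide +kernel

lemma eq_of_prod_eq_eightyOne :
    ∀ row ∈ rows, (row.map Prod.fst).prod = 81 → row.map Prod.fst = [3, 3, 3, 3] := by decide +kernel

lemma eq_of_prod_eq_nine : ∀ row ∈ rows, (row.map Prod.fst).prod = 9 →
    row.map Prod.fst = [9] ∨ row.map Prod.fst = [3, 3] := by decide +kernel

lemma not_prodCyclic_three_three : ¬ Nonempty (ProdCyclic [9] ≃* ProdCyclic [3, 3]) := by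
  rintro ⟨f⟩
  have h3 : ∀ x : ProdCyclic [3, 3], x ^ 3 = 1 := by
    have key : ∀ y : Multiplicative (ZMod 3), y ^ 3 = 1 := by decide
    intro x
    funext i
    fin_cases i <;> exact key _
  have h9 : ∃ x : ProdCyclic [9], x ^ 3 ≠ 1 := by
    have key : (Multiplicative.ofAdd (1 : ZMod 9)) ^ 3 ≠ 1 := by decide
    refine ⟨fun i => Multiplicative.ofAdd ((1 : ℤ) : ZMod _), fun h => key ?_⟩
    simpa using congrFun h 0
  obtain ⟨x, hx⟩ := h9
  exact hx (f.injective (by rw [map_pow, h3, map_one]))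

end CubicThreefold

end

open CubicThreefold in
theorem theorem5p4 (F : MvPolynomial (Fin 5) ℂ) (hF : IsSmoothCubic F)
    (G : Subgroup PGL(5, ℂ)) (hG : G ≤ aut F) (hcomm : ∀ g ∈ G, ∀ h ∈ G, g * h = h * g)
    (hne : G ≠ ⊥) :
    (∃ ns ∈ abelianTypes, Nonempty (G ≃* ProdCyclic ns)) ∧
    (∃ ns ds u, Table ns ds u ∧ Nonempty (G ≃* ProdCyclic ns) ∧
      ∃ P : GL (Fin 5) ℂ, IsFLifting F (conj P (diagGroup ds)) G) ∧
    (∀ ns ds T, Table ns ds (some T) →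
      (∃ P : GL (Fin 5) ℂ, IsFLifting F (conj P (diagGroup ds)) G) →
        IsIsoTo (hypersurface F) T) ∧
    (Nonempty (G ≃* ProdCyclic [9]) → IsIsoTo (hypersurface F) .X₁) ∧
    (Nonempty (G ≃* ProdCyclic [16]) → IsIsoTo (hypersurface F) .X₄) ∧
    (Nonempty (G ≃* ProdCyclic [11]) → IsIsoTo (hypersurface F) .X₅) ∧
    (Nonempty (G ≃* ProdCyclic [3, 3, 3, 3]) → IsIsoTo (hypersurface F) .X₁) := by
  obtain ⟨row, hrow, P, hlift, ⟨f⟩⟩ := exists_row hF hG hcomm hne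
  obtain ⟨u, htable⟩ := exists_table row hrow
  obtain ⟨ns, hns, ⟨g⟩⟩ := exists_abelianType row hrow
  have hcard : ∀ {ms}, Nonempty (G ≃* ProdCyclic ms) → (row.map Prod.fst).prod = ms.prod := by
    rintro ms ⟨e⟩
    rw [← prodCyclic_card, ← prodCyclic_card, Nat.card_congr (f.symm.trans e).toEquiv]
  refine ⟨⟨ns, hns, ⟨f.trans g⟩⟩, ⟨_, _, u, htable, ⟨f⟩, P, hlift⟩,
    fun _ _ _ ht ⟨_, hl⟩ => isIsoTo_of_table hF ht hl, fun h => ?_, fun h => ?_, fun h => ?_,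
    fun h => ?_⟩
  · have h9 := (eq_of_prod_eq_nine row hrow (hcard h)).resolve_right fun h3 =>
      not_prodCyclic_three_three (h.map fun e => e.symm.trans (h3 ▸ f))
    rw [h9] at htable
    generalize row.map toVec = ds at *
    cases htable with
    | row12 a b hab hb => exact isIsoTo_of_table hF (.row12 a b hab hb) hlift
  · rw [eq_of_prod_eq_sixteen row hrow (hcard h)] at htable
    generalize row.map toVec = ds at *
    cases htable
    exact isIsoTo_of_table hF .row21 hlift
  · rw [eq_of_prod_eq_eleven row hrow (hcard h)] at htable
    generalize row.map toVec = ds at *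
    cases htable
    exact isIsoTo_of_table hF .row14 hlift
  · rw [eq_of_prod_eq_eightyOne row hrow (hcard h)] at htable
    generalize row.map toVec = ds at *
    cases htable
    exact isIsoTo_of_table hF .row33 hlift
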